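/- For natural numbers $a,b$ and $k\ge 2$ let $A_0(k,b)=k^b$, $A_{a+1}(k,0)=f^{k}(0)$ and $A_{a+1}(k,b+1)=f^{k}(A_{a+1}(k,b))$, where $f(x)=A_a(k,x)$ and $f^k$ is the $k$-fold composition of $f$. For every $c>0$ there are unique $a,b,m,n\in\mathbb N$ with $c=A_a(k,b)\cdot m+n$, $A_a(k,0)\le c<A_{a+1}(k,0)$, $A_a(k,b)\le c<A_a(k,b+1)$ and $n<A_a(k,b)$; this is the $k$-normal form of $c$. The nested base change is defined recursively by $0[k\leftarrow k+1]=0$ and, if $c=A_a(k,b)\cdot m+n$ is in $k$-normal form, $$c[k\leftarrow k+1]=A_{a[k\leftarrow k+1]}(k+1,\,b[k\leftarrow k+1])\cdot m+n[k\leftarrow k+1].$$ For $\ell\in\mathbb N$ the Goodstein process $(c_k(\ell))_{k\in\mathbb N}$ is defined by $c_0(\ell)=\ell$, by $c_{k+1}(\ell)=c_k(\ell)[k+2\leftarrow k+3]-1$ if $c_k(\ell)>0$, and by $c_{k+1}(\ell)=0$ if $c_k(\ell)=0$. Let $\varphi_2(0)$ be the least ordinal $\alpha$ with $\varepsilon_\alpha=\alpha$,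 and let ${\sf PA}+{\rm TI}(\varphi_2 0)$ be first-order Peano arithmetic extended by the schema of transfinite induction, for all arithmetical formulas, along the standard arithmetical notation system for the ordinals below $\varphi_2(0)$ (built from $0$, $+$, $\xi\mapsto\omega^\xi$ and $\xi\mapsto\varepsilon_\xi$). **Theorem.** For every $\ell\in\mathbb N$ there is a $k\in\mathbb N$ such that $c_k(\ell)=0$. Moreover, the (standard arithmetization of the) sentence $\forall \ell\,\exists k\; c_k(\ell)=0$ is provable in ${\sf PA}+{\rm TI}(\varphi_2 0)$. -/

import Mathlib

namespace Goodstein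

open FirstOrder FirstOrder.Language

/-! ### The Ackermann function, normal forms, base change and the Goodstein process -/

/-- `A a k b` is the value `A_a(k, b)` of the Ackermann function to the base `k`. -/
def A : ℕ → ℕ → ℕ → ℕ
  | 0, k, b => k ^ b
  | a + 1, k, 0 => (fun x => A a k x)^[k] 0
  | a + 1, k, b + 1 => (fun x => A a k x)^[k] (A (a + 1) k b)
termination_by a _ b => (a, b)

/-- `c = A_a(k, b) * m + n` is the `k`-normal form of `c`. -/
structure IsNF (k c a b m n : ℕ) : Prop where
  eq : c = A a k b * m + n
  index_le : A a k 0 ≤ c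
  lt_index : c < A (a + 1) k 0
  arg_le : A a k b ≤ c
  lt_arg : c < A a k (b + 1)
  rem_lt : n < A a k b

theorem lt_iterate {f : ℕ → ℕ} (hf : ∀ x, x < f x) (j x : ℕ) : x < f^[j + 1] x := by
  induction j with
  | zero => exact hf x
  | succ j ih =>
    rw [Function.iterate_succ_apply']
    exact ih.trans (hf _)

theorem A_strictMono_and_lt {k : ℕ} (hk : 2 ≤ k) (a : ℕ) :
    StrictMono (A a k) ∧ ∀ b, b < A a k b := by
  obtain ⟨j, rfl⟩ : ∃ j, k = j + 1 := ⟨k - 1, by omega⟩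
  induction a with
  | zero =>
    have h : A 0 (j + 1) = fun b => (j + 1) ^ b := by
      funext b
      rw [A]
    rw [h]
    exact ⟨pow_right_strictMono₀ (by omega), fun b => Nat.lt_pow_self (by omega)⟩
  | succ a ih =>
    have hs : StrictMono (A (a + 1) (j + 1)) := by
      refine strictMono_nat_of_lt_succ fun b => ?_
      rw [A.eq_3]
      exact lt_iterate ih.2 _ _
    refine ⟨hs, fun b => ?_⟩
    induction b with
    | zero =>
      rw [A.eq_2]
      exact lt_iterate ih.2 _ _
    | succ b hb => exact lt_of_le_of_lt hb (hs (Nat.lt_succ_self b))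

theorem A_zero_strictMono {k : ℕ} (hk : 2 ≤ k) : StrictMono fun a => A a k 0 := by
  obtain ⟨j, rfl⟩ : ∃ j, k = j + 1 + 1 := ⟨k - 2, by omega⟩
  refine strictMono_nat_of_lt_succ fun a => ?_
  have h := A_strictMono_and_lt hk a
  show A a (j + 1 + 1) 0 < A (a + 1) (j + 1 + 1) 0
  rw [A.eq_2, Function.iterate_succ_apply]
  exact lt_iterate h.2 _ _

/-- The components on which the base change recurses are smaller than the number itself. -/
theorem IsNF.lt {k c a b m n : ℕ} (hk : 2 ≤ k) (h : IsNF k c a b m n) : a < c ∧ b < c ∧ n < c := by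
  refine ⟨?_, ((A_strictMono_and_lt hk a).2 b).trans_le h.arg_le, h.rem_lt.trans_le h.arg_le⟩
  have h1 : ∀ a, a < A a k 0 := by
    intro a
    induction a with
    | zero => simp [A]
    | succ a ih => exact lt_of_le_of_lt ih (A_zero_strictMono hk (Nat.lt_succ_self a))
  exact (h1 a).trans_le h.index_le

theorem exists_between {g : ℕ → ℕ} (hg : StrictMono g) {c : ℕ} (h0 : g 0 ≤ c) :
    ∃ i, g i ≤ c ∧ c < g (i + 1) := by
  by_contra! h
  have h1 : ∀ i, g i ≤ c := by
    intro i
    induction i with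
    | zero => exact h0
    | succ i ih => exact h i ih
  exact absurd (hg.le_apply (x := c + 1)) (by have := h1 (c + 1); omega)

/-- For `2 ≤ k`, every positive number has a `k`-normal form. -/
theorem IsNF.exists {k c : ℕ} (hk : 2 ≤ k) (hc : 0 < c) :
    ∃ p : ℕ × ℕ × ℕ × ℕ, IsNF k c p.1 p.2.1 p.2.2.1 p.2.2.2 := by
  obtain ⟨a, ha, ha'⟩ := exists_between (A_zero_strictMono hk) (c := c) (by simp only [A, pow_zero]; omega)
  obtain ⟨b, hb, hb'⟩ := exists_between (A_strictMono_and_lt hk a).1 ha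
  exact ⟨(a, b, c / A a k b, c % A a k b), (Nat.div_add_mod _ _).symm, ha, ha', hb, hb',
    Nat.mod_lt _ (Nat.zero_lt_of_lt ((A_strictMono_and_lt hk a).2 b))⟩

/-- For `2 ≤ k`, the `k`-normal form is unique. -/
theorem IsNF.unique {k c a b m n a' b' m' n' : ℕ} (hk : 2 ≤ k) (h : IsNF k c a b m n)
    (h' : IsNF k c a' b' m' n') : a = a' ∧ b = b' ∧ m = m' ∧ n = n' := by
  have key : ∀ {g : ℕ → ℕ}, StrictMono g → ∀ {i j : ℕ}, g i ≤ c → c < g (j + 1) → i ≤ j := by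
    intro g hg i j h1 h2
    exact Nat.lt_succ_iff.1 (hg.lt_iff_lt.1 (h1.trans_lt h2))
  obtain rfl : a = a' := le_antisymm (key (A_zero_strictMono hk) h.index_le h'.lt_index)
    (key (A_zero_strictMono hk) h'.index_le h.lt_index)
  have hm := (A_strictMono_and_lt hk a).1
  obtain rfl : b = b' := le_antisymm (key hm h.arg_le h'.lt_arg) (key hm h'.arg_le h.lt_arg)
  have hq := (Nat.div_mod_unique (Nat.zero_lt_of_lt h.rem_lt)).2
    ⟨(by rw [h.eq]; ring : n + A a k b * m = c), h.rem_lt⟩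
  have hq' := (Nat.div_mod_unique (Nat.zero_lt_of_lt h.rem_lt)).2
    ⟨(by rw [h'.eq]; ring : n' + A a k b * m' = c), h'.rem_lt⟩
  exact ⟨rfl, rfl, hq.1.symm.trans hq'.1, hq.2.symm.trans hq'.2⟩

open Classical in
/-- The nested base change `c[k ← k + 1]`, for `2 ≤ k`: it sends `0` to `0`, and `c` with `k`-normal
form `A_a(k, b) * m + n` to `A_a'(k + 1, b') * m + n'`, where `a', b', n'` are the base changes of
`a, b, n`. For `k < 2`, where there are no normal forms, the value is `0` by convention. -/
noncomputable def baseChange (k c : ℕ) : ℕ :=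
  if h : 2 ≤ k ∧ 0 < c then
    let p := (IsNF.exists h.1 h.2).choose
    A (baseChange k p.1) (k + 1) (baseChange k p.2.1) * p.2.2.1 + baseChange k p.2.2.2
  else 0
termination_by c
decreasing_by
  all_goals
    have hs := IsNF.lt h.1 (IsNF.exists h.1 h.2).choose_spec
  · exact hs.1
  · exact hs.2.1
  · exact hs.2.2

theorem baseChange_zero (k : ℕ) : baseChange k 0 = 0 := by
  rw [baseChange]
  simp

/-- The defining equation of the base change. -/
theorem baseChange_of_isNF {k c a b m n : ℕ} (hk : 2 ≤ k) (h : IsNF k c a b m n) :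
    baseChange k c = A (baseChange k a) (k + 1) (baseChange k b) * m + baseChange k n := by
  have hc : 2 ≤ k ∧ 0 < c := ⟨hk, Nat.zero_lt_of_lt (h.lt hk).1⟩
  obtain ⟨h1, h2, h3, h4⟩ := IsNF.unique hk h (IsNF.exists hc.1 hc.2).choose_spec
  have hp : (IsNF.exists hc.1 hc.2).choose = (a, b, m, n) := by
    rw [h1, h2, h3, h4]
  rw [baseChange, dif_pos hc]
  dsimp only
  rw [hp]

/-- The Goodstein process: `goodstein l k` is the number `c_k(l)`. -/
noncomputable def goodstein (l : ℕ) : ℕ → ℕ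
  | 0 => l
  | k + 1 => if goodstein l k = 0 then 0 else baseChange (k + 2) (goodstein l k) - 1

/-! ### First-order provability -/

/-- Substitution of the term `t` for the outermost bound variable. -/
def inst {L : FirstOrder.Language.{0, 0}} (φ : L.BoundedFormula ℕ 1) (t : L.Term ℕ) : L.Formula ℕ :=
  φ.toFormula.subst (Sum.elim Term.var fun _ => t)

/-- Derivability from the axioms `T` in a Hilbert calculus for classical first-order logic with
equality. The free variables are indexed by `ℕ`; axioms with free variables are understood to be
universally closed. -/
inductive Provable {L : FirstOrder.Language.{0, 0}} (T : Set (L.Formula ℕ)) : L.Formula ℕ → Prop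
  | ax {φ : L.Formula ℕ} : φ ∈ T → Provable T φ
  | mp {φ ψ : L.Formula ℕ} : Provable T (φ.imp ψ) → Provable T φ → Provable T ψ
  | imp_const (φ ψ : L.Formula ℕ) : Provable T (φ.imp (ψ.imp φ))
  | imp_distrib (φ ψ χ : L.Formula ℕ) :
      Provable T ((φ.imp (ψ.imp χ)).imp ((φ.imp ψ).imp (φ.imp χ)))
  | not_not (φ : L.Formula ℕ) : Provable T (((φ.imp ⊥).imp ⊥).imp φ)
  | all_elim (φ : L.BoundedFormula ℕ 1) (t : L.Term ℕ) : Provable T (φ.all.imp (inst φ t))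
  | all_intro (ψ : L.Formula ℕ) (φ : L.BoundedFormula ℕ 1) (x : ℕ) :
      x ∉ ψ.freeVarFinset → x ∉ φ.freeVarFinset →
      Provable T (ψ.imp (inst φ (Term.var x))) → Provable T (ψ.imp φ.all)
  | eq_refl (t : L.Term ℕ) : Provable T (t.equal t)
  | eq_subst (φ : L.BoundedFormula ℕ 1) (s t : L.Term ℕ) :
      Provable T ((s.equal t).imp ((inst φ s).imp (inst φ t)))

/-! ### The language of arithmetic -/

/-- The function symbols `0`, `S`, `+`, `*`. -/
inductive ArithFunc : ℕ → Type
  | zero : ArithFunc 0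
  | succ : ArithFunc 1
  | add : ArithFunc 2
  | mul : ArithFunc 2

/-- The language of arithmetic. -/
def arith : FirstOrder.Language.{0, 0} := ⟨ArithFunc, fun _ => Empty⟩

/-- Terms of arithmetic; the free variables of terms and formulas are numbered. -/
abbrev Tm : Type := arith.Term ℕ

/-- Formulas of arithmetic. -/
abbrev Fm : Type := arith.Formula ℕ

/-- The variable with number `i`. -/
def v (i : ℕ) : Tm := Term.var i

/-- The term `0`. -/
def O : Tm := Term.func (L := arith) ArithFunc.zero ![]

/-- The term `S t`. -/
def S (t : Tm) : Tm := Term.func (L := arith) ArithFunc.succ ![t]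

/-- The term `s + t`. -/
def plus (s t : Tm) : Tm := Term.func (L := arith) ArithFunc.add ![s, t]

/-- The term `s * t`. -/
def times (s t : Tm) : Tm := Term.func (L := arith) ArithFunc.mul ![s, t]

/-- The formula `s = t`. -/
def eqF (s t : Tm) : Fm := Term.equal s t

/-- Universal quantification over the variable with number `i`. -/
def all (i : ℕ) (φ : Fm) : Fm :=
  BoundedFormula.all (n := 0)
    (BoundedFormula.relabel (n := 1) (fun j => if j = i then Sum.inr 0 else Sum.inl j) φ)

/-- Existential quantification over the variable with number `i`. -/
def ex (i : ℕ) (φ : Fm) : Fm :=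
  BoundedFormula.ex (n := 0)
    (BoundedFormula.relabel (n := 1) (fun j => if j = i then Sum.inr 0 else Sum.inl j) φ)

/-- Existential quantification over all the variables of a list. -/
def exs (l : List ℕ) (φ : Fm) : Fm := l.foldr ex φ

/-- Disjunction of a list of formulas. -/
def disj (l : List Fm) : Fm := l.foldr (· ⊔ ·) ⊥

/-- Conjunction of a list of formulas. -/
def conj (l : List Fm) : Fm := l.foldr (· ⊓ ·) ⊤

/-- Simultaneous (capture-free) substitution of the terms of the list `l` for the variables
`0, …, l.length - 1`. -/
def ap (φ : Fm) (l : List Tm) : Fm := φ.subst fun i => l.getD i (v i)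

/-- The formula `s < t`. -/
def ltF (s t : Tm) : Fm := ap (ex 2 (eqF (plus (v 0) (S (v 2))) (v 1))) [s, t]

/-- The formula `s ≤ t`. -/
def leF (s t : Tm) : Fm := ap (ex 2 (eqF (plus (v 0) (v 2)) (v 1))) [s, t]

/-- The pair `⟨s, t⟩ = (s + t)² + s`, an injective pairing. -/
def pair (s t : Tm) : Tm := plus (times (plus s t) (plus s t)) s

/-- The tuple `⟨t₁, ⟨t₂, …⟩⟩`. -/
def tup : List Tm → Tm
  | [] => O
  | [t] => t
  | t :: l => pair t (tup l)

/-! ### Recursive definitions in arithmetic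

The numbers `c, d, N` code the finite set of all `x < N` such that `1 + (x + 1) * d` divides `c`;
every finite set of numbers has such a code. An inductively defined predicate is expressed by the
existence of a finite set in which each element follows from other elements by one of the clauses
of the definition. In all the definitions below the clauses are well-founded: they lead back to
smaller data. -/

/-- `x` belongs to the finite set coded by `c, d, N`. -/
def memF (x c d N : Tm) : Fm :=
  ap (ltF (v 0) (v 3) ⊓ ex 4 (eqF (times (S (times (S (v 0)) (v 2))) (v 4)) (v 1))) [x, c, d, N]

/-- Membership in the finite set that the clauses of an inductive definition refer to: its code
consists of the variables `1, 2, 3`. -/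
def known (x : Tm) : Fm := memF x (v 1) (v 2) (v 3)

/-- The predicate of the variable `0` that is defined inductively by the clauses `Φ`: in `Φ`, the
variable `0` is the element to be justified, `known` expresses that an element has been obtained,
and the variables from `4` on are parameters. -/
def inductiveF (Φ : Fm) : Fm := exs [1, 2, 3] (known (v 0) ⊓ all 0 ((known (v 0)).imp Φ))

/-- Clauses for the Ackermann function to the base `k`, which is the variable `4`:
`⟨0, a, b, c⟩` stands for `A_a(k, b) = c`, and `⟨1, a, i, x, y⟩` for `A_a^i(k, ·)(x) = y`. -/
def ackClauses : Fm := disj [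
  eqF (v 0) (tup [O, O, O, S O]),
  exs [5, 6] (conj [eqF (v 0) (tup [O, O, S (v 5), times (v 6) (v 4)]),
    known (tup [O, O, v 5, v 6])]),
  exs [5, 6] (conj [eqF (v 0) (tup [O, S (v 5), O, v 6]),
    known (tup [S O, v 5, v 4, O, v 6])]),
  exs [5, 6, 7, 8] (conj [eqF (v 0) (tup [O, S (v 5), S (v 6), v 8]),
    known (tup [O, S (v 5), v 6, v 7]), known (tup [S O, v 5, v 4, v 7, v 8])]),
  exs [5, 6] (eqF (v 0) (tup [S O, v 5, O, v 6, v 6])),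
  exs [5, 6, 7, 8, 9] (conj [eqF (v 0) (tup [S O, v 5, S (v 6), v 7, v 9]),
    known (tup [S O, v 5, v 6, v 7, v 8]), known (tup [O, v 5, v 8, v 9])])]

/-- The formula `A_a(k, b) = c`. -/
def ackF (a k b c : Tm) : Fm :=
  ap (ap (inductiveF ackClauses) [tup [O, v 0, v 2, v 3], v 1, v 2, v 3, v 1]) [a, k, b, c]

/-- The formula saying that `c = A_a(k, b) * m + n` is the `k`-normal form of `c`. -/
def nfF (k c a b m n : Tm) : Fm :=
  ap (exs [6, 7, 8, 9] (conj [
    ackF (v 2) (v 0) (v 3) (v 6), ackF (v 2) (v 0) O (v 7), ackF (S (v 2)) (v 0) O (v 8),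
    ackF (v 2) (v 0) (S (v 3)) (v 9),
    eqF (v 1) (plus (times (v 6) (v 4)) (v 5)),
    leF (v 7) (v 1), ltF (v 1) (v 8), leF (v 6) (v 1), ltF (v 1) (v 9), ltF (v 5) (v 6)]))
    [k, c, a, b, m, n]

/-- Clauses for the base change at the base `k`, which is the variable `4`: `⟨c, d⟩` stands for
`c[k ← k + 1] = d`. The variables `5, …, 9` are `c, a, b, m, n`, the variables `10, 11, 12` are
`a', b', n'`, and the variable `13` is `A_a'(k + 1, b')`. -/
def baseChangeClauses : Fm := disj [
  eqF (v 0) (tup [O, O]),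
  exs [5, 6, 7, 8, 9, 10, 11, 12, 13] (conj [
    eqF (v 0) (tup [v 5, plus (times (v 13) (v 8)) (v 12)]),
    nfF (v 4) (v 5) (v 6) (v 7) (v 8) (v 9),
    known (tup [v 6, v 10]), known (tup [v 7, v 11]), known (tup [v 9, v 12]),
    ackF (v 10) (S (v 4)) (v 11) (v 13)])]

/-- The formula `c[k ← k + 1] = d`. -/
def baseChangeF (k c d : Tm) : Fm :=
  ap (ap (inductiveF baseChangeClauses) [tup [v 1, v 2], v 1, v 2, v 3, v 0]) [k, c, d]

/-- Clauses for the Goodstein process that starts with `l`, which is the variable `4`: `⟨k, y⟩`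
stands for `c_k(l) = y`. -/
def goodsteinClauses : Fm := disj [
  eqF (v 0) (tup [O, v 4]),
  exs [5] (conj [eqF (v 0) (tup [S (v 5), O]), known (tup [v 5, O])]),
  exs [5, 6, 7] (conj [eqF (v 0) (tup [S (v 5), v 7]), known (tup [v 5, v 6]),
    ltF O (v 6), baseChangeF (S (S (v 5))) (v 6) (S (v 7))])]

/-- The formula `c_k(l) = y`. -/
def goodsteinF (l k y : Tm) : Fm :=
  ap (ap (inductiveF goodsteinClauses) [tup [v 1, v 2], v 1, v 2, v 3, v 0]) [l, k, y]

/-- The sentence `∀ l ∃ k c_k(l) = 0`. -/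
def terminationF : Fm := all 0 (ex 1 (goodsteinF (v 0) (v 1) O))

/-! ### Peano arithmetic -/

/-- The induction axiom for `φ` in the variable `0`; the other variables are parameters. -/
def inductionF (φ : Fm) : Fm :=
  (ap φ [O]).imp ((all 0 (φ.imp (ap φ [S (v 0)]))).imp (all 0 φ))

/-- The axioms of Peano arithmetic. -/
def PA : Set Fm :=
  {(eqF (S (v 0)) O).imp ⊥,
    (eqF (S (v 0)) (S (v 1))).imp (eqF (v 0) (v 1)),
    eqF (plus (v 0) O) (v 0),
    eqF (plus (v 0) (S (v 1))) (S (plus (v 0) (v 1))),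
    eqF (times (v 0) O) O,
    eqF (times (v 0) (S (v 1))) (plus (times (v 0) (v 1)) (v 0))} ∪ Set.range inductionF

/-! ### Ordinal notations and transfinite induction up to `φ₂(0)`

The ordinals below `φ₂(0)` are denoted by natural numbers: `0` denotes `0`, the number
`1 + ⟨0, x, y⟩` denotes `ω ^ x + y`, and `1 + ⟨1, x, y⟩` denotes `ε_x + y`, where `x` and `y` stand
for the ordinals that they denote. The notations in normal form are those whose subnotations are in
normal form, where the additively indecomposable summands do not increase, and where `ω ^ x` is not
used if `x` is an epsilon number. So each ordinal below `φ₂(0)` has exactly one notation. -/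

/-- The notation for `ω ^ x + y` (if `t = 0`) or for `ε_x + y` (if `t = 1`). -/
def ord (t x y : Tm) : Tm := S (tup [t, x, y])

/-- Clauses for the order of the notations: `⟨x, y⟩` stands for `x ≺ y`. -/
def ordLtClauses : Fm := disj [
  exs [5, 6, 7] (eqF (v 0) (tup [O, ord (v 5) (v 6) (v 7)])),
  exs [5, 6, 7, 8] (conj [
    eqF (v 0) (tup [ord (v 5) (v 6) (v 7), ord (v 5) (v 6) (v 8)]), known (tup [v 7, v 8])]),
  exs [5, 6, 7, 8, 9] (conj [
    eqF (v 0) (tup [ord (v 5) (v 6) (v 8), ord (v 5) (v 7) (v 9)]), known (tup [v 6, v 7])]),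
  exs [6, 7, 8, 9] (conj [
    eqF (v 0) (tup [ord O (v 6) (v 8), ord (S O) (v 7) (v 9)]),
    known (tup [v 6, ord (S O) (v 7) O])]),
  exs [6, 7, 8, 9] (conj [
    eqF (v 0) (tup [ord (S O) (v 6) (v 8), ord O (v 7) (v 9)]),
    known (tup [ord (S O) (v 6) O, v 7])])]

/-- The formula `x ≺ y`. -/
def ordLtF (x y : Tm) : Fm := ap (inductiveF ordLtClauses) [pair x y]

/-- Clauses for the notations in normal form. -/
def ordNFClauses : Fm := disj [
  eqF (v 0) O,
  exs [5, 6, 7] (conj [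
    eqF (v 0) (ord (v 5) (v 6) (v 7)),
    eqF (v 5) O ⊔ eqF (v 5) (S O),
    known (v 6), known (v 7),
    (eqF (v 5) O).imp ((ex 8 (eqF (v 6) (ord (S O) (v 8) O))).imp ⊥),
    eqF (v 7) O ⊔ exs [8, 9, 10] (conj [
      eqF (v 7) (ord (v 8) (v 9) (v 10)),
      eqF (ord (v 8) (v 9) O) (ord (v 5) (v 6) O) ⊔
        ordLtF (ord (v 8) (v 9) O) (ord (v 5) (v 6) O)])])]

/-- The formula saying that `x` is a notation in normal form. -/
def ordNFF (x : Tm) : Fm := ap (inductiveF ordNFClauses) [x]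

/-- Transfinite induction over all ordinals below `φ₂(0)` for the formula that arises from `φ` by
renaming each parameter `i + 1` as `i + 2`, which makes the variable `1` available. -/
def transfiniteInductionF (φ : Fm) : Fm :=
  let atVar (i : ℕ) : Fm := φ.subst fun j => if j = 0 then v i else v (j + 1)
  (all 0 ((ordNFF (v 0)).imp
      ((all 1 ((ordNFF (v 1)).imp ((ordLtF (v 1) (v 0)).imp (atVar 1)))).imp (atVar 0)))).imp
    (all 0 ((ordNFF (v 0)).imp (atVar 0)))

/-- The schema of transfinite induction up to `φ₂(0)`, for all formulas of arithmetic. -/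
def TI : Set Fm := Set.range transfiniteInductionF

end Goodstein

namespace Goodstein

open FirstOrder FirstOrder.Language

/-! ### Syntactic lemmas on instances of formulas -/

section Syntax_lemmas

variable {L : FirstOrder.Language.{0, 0}} {α β γ δ : Type}

/-! Every number carries an ordinal: if `c = A_a(k, b) * m + n` in `k`-normal form and `a, b, n`
have the ordinals `α, β, ν`, then `c` has the ordinal `ω ^ (ε_α + β) * m + ν`, which is below
`φ₂(0)`. Two facts make the process stop. First, the base change is strictly increasing and maps
normal forms to normal forms with the same `m`, so the ordinal of `c[k ← k + 1]` to the base `k + 1`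
is that of `c` to the base `k`. Second, for a fixed base the ordinal is strictly increasing in `c`.
So subtracting `1` after the base change makes the ordinal drop.

The combinatorial heart is `good`: monotonicity of the base change and the bounds that keep the
image in normal form are proved by one strong induction. The second fact reflects closure
properties: what lies below `A_a(k, 0)` is built from indices below `a`, and `ε_α` is closed under
addition and `ω`-powers.

For provability no derivation is written down. By the completeness theorem `provable_of_models`,
proved by Henkin's method, it suffices that the sentence holds in every model `M` of the axioms.
Such an `M` may be nonstandard, so the whole argument is carried out inside it: predicates must be
definable with parameters (`Dfn`, `DfnF`, found by instance search), recursive functions come from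
coded finite sets (`comprehension`, `IndPred.iff`), and inductions use the axiom schema
(`induction`, `strong_induction`). Ordinals become notations `od k c`, which are elements of `M`. As
a notation has to be in normal form, `ω ^ (ε_α + β)` is written `ε_α` if `β = 0`, and `ω ^ β` if `β`
absorbs `ε_α`. The two facts turn into `od_bc` and `od_strictMono`; with `ordNF_od` they allow an
appeal to `transfinite_induction`.

Termination for actual natural numbers uses actual ordinals (`toOrdinal`). There the preservation of
normal forms is not proved again: it is the internal result, read in the standard model. -/

theorem term_subst_subst (t : L.Term α) (f : α → L.Term β) (g : β → L.Term γ) :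
    (t.subst f).subst g = t.subst fun i => (f i).subst g := by
  induction t with
  | var => rfl
  | func _ _ ih => simp [ih]

theorem term_relabel_subst (t : L.Term α) (f : α → β) (g : β → L.Term γ) :
    (t.relabel f).subst g = t.subst fun i => g (f i) := by
  induction t with
  | var => rfl
  | func _ _ ih => simp [ih]

theorem term_subst_relabel (t : L.Term α) (f : α → L.Term β) (g : β → γ) :
    (t.subst f).relabel g = t.subst fun i => (f i).relabel g := by
  induction t with
  | var => rfl
  | func _ _ ih => simp [ih]

theorem term_relabel_eq_subst (t : L.Term α) (f : α → β) :
    t.relabel f = t.subst fun i => Term.var (f i) := by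
  induction t with
  | var => rfl
  | func _ _ ih => simp [ih]

theorem term_subst_var (t : L.Term α) : (t.subst fun i => Term.var i) = t := by
  induction t with
  | var => rfl
  | func _ _ ih => simp [ih]

theorem subst_subst {n : ℕ} (φ : L.BoundedFormula α n) (f : α → L.Term β) (g : β → L.Term γ) :
    (φ.subst f).subst g = φ.subst fun i => (f i).subst g := by
  unfold BoundedFormula.subst
  rw [BoundedFormula.mapTermRel_mapTermRel]
  congr 1
  funext n t
  simp only [Function.comp, term_subst_subst]
  congr 1
  funext i
  rcases i with i | i
  · simp [term_relabel_subst, term_subst_relabel]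
  · simp

/-- Serves the quantifier case of `toFormula_relabel`, where a renaming of free variables must be
moved past the relabelling that binds one of them. -/
theorem subst_relabel_comm {m n : ℕ} (F : L.BoundedFormula α m) (p : α → β) (q : β → γ ⊕ Fin n)
    (q' : α → δ ⊕ Fin n) (p' : δ → γ) (h : ∀ a, q (p a) = Sum.map p' id (q' a)) :
    (F.subst fun a => Term.var (p a)).relabel q =
      (F.relabel q').subst fun a => Term.var (p' a) := by
  have key : ∀ (k : ℕ) (t : L.Term (α ⊕ Fin k)),
      (t.subst (Sum.elim (Term.relabel Sum.inl ∘ fun a => Term.var (p a))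
        (Term.var ∘ Sum.inr))).relabel (BoundedFormula.relabelAux q k) =
      (t.relabel (BoundedFormula.relabelAux q' k)).subst
        (Sum.elim (Term.relabel Sum.inl ∘ fun a => Term.var (p' a)) (Term.var ∘ Sum.inr)) := by
    intro k t
    rw [term_subst_relabel, term_relabel_subst]
    congr 1
    funext i
    rcases i with i | i
    · have := h i
      rcases hq : q' i with j | j
      · simp [BoundedFormula.relabelAux, this, hq]
      · simp [BoundedFormula.relabelAux, this, hq]
    · simp [BoundedFormula.relabelAux]
  induction F with
  | falsum => rfl
  | equal t₁ t₂ =>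
    exact congrArg₂ BoundedFormula.equal (key _ t₁) (key _ t₂)
  | rel R ts =>
    exact congrArg (BoundedFormula.rel R) (funext fun i => key _ (ts i))
  | imp _ _ h1 h2 => exact congrArg₂ BoundedFormula.imp h1 h2
  | all f ih =>
    rw [BoundedFormula.relabel_all]
    change (BoundedFormula.all (f.subst _)).relabel q = BoundedFormula.all ((f.relabel q').subst _)
    rw [BoundedFormula.relabel_all, ih]

/-- `inst` is defined through `toFormula`, whereas the quantifier `all` over a numbered variable is
defined through `relabel`; this is the bridge between the two. -/
theorem toFormula_relabel {k : ℕ} (φ : L.BoundedFormula α k) (g : α → β ⊕ Fin 1) :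
    (φ.relabel g).toFormula =
      φ.toFormula.subst fun x => Term.var (BoundedFormula.relabelAux g k x) := by
  have key : ∀ (k : ℕ) (t₁ t₂ : L.Term (α ⊕ Fin k)),
      (BoundedFormula.relabel g (BoundedFormula.equal t₁ t₂)).toFormula =
      (BoundedFormula.equal t₁ t₂).toFormula.subst
        fun x => Term.var (BoundedFormula.relabelAux g k x) := by
    intro k t₁ t₂
    simp only [BoundedFormula.relabel, BoundedFormula.mapTermRel, BoundedFormula.toFormula,
      BoundedFormula.subst, Term.equal, Term.bdEqual]
    congr 1 <;> rw [term_relabel_subst, term_relabel_eq_subst, term_relabel_subst] <;> rfl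
  induction φ with
  | falsum => rfl
  | equal t₁ t₂ => exact key _ t₁ t₂
  | rel R ts =>
    simp only [BoundedFormula.relabel, BoundedFormula.mapTermRel, BoundedFormula.toFormula,
      BoundedFormula.subst, Relations.formula, Relations.boundedFormula]
    refine congrArg (BoundedFormula.rel R) (funext fun i => ?_)
    rw [term_relabel_subst, term_relabel_eq_subst, term_relabel_subst]
    rfl
  | imp _ _ h1 h2 => exact congrArg₂ BoundedFormula.imp h1 h2
  | @all k f ih =>
    rw [BoundedFormula.relabel_all]
    simp only [BoundedFormula.toFormula]
    refine congrArg BoundedFormula.all ?_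
    refine (congrArg (BoundedFormula.relabel _) ih).trans ?_
    refine subst_relabel_comm _ _ _ _ _ fun a => ?_
    rcases a with a | a
    · rcases h : g a with j | j
      · simp [BoundedFormula.relabelAux, h]
      · have : (finSumFinEquiv.symm ((finSumFinEquiv (Sum.inl j : Fin 1 ⊕ Fin (k+1)) :
            Fin (1 + (k + 1))) : Fin (1 + k + 1)) : Fin (1 + k) ⊕ Fin 1) =
            Sum.inl (finSumFinEquiv (Sum.inl j)) := by
          rw [Equiv.symm_apply_eq]
          ext
          simp
        simp only [BoundedFormula.relabelAux, h, Function.comp, Sum.map_inl, Sum.elim_inl,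
          Equiv.sumAssoc_apply_inl_inr, Sum.map_inr, Sum.elim_inr]
        erw [this]
        simp
    · refine Fin.lastCases ?_ (fun a => ?_) a
      · have : (finSumFinEquiv.symm ((finSumFinEquiv (Sum.inr (Fin.last k) : Fin 1 ⊕ Fin (k+1)) :
            Fin (1 + (k + 1))) : Fin (1 + k + 1)) : Fin (1 + k) ⊕ Fin 1) = Sum.inr 0 := by
          rw [Equiv.symm_apply_eq]
          ext
          simp
        have h2 : (finSumFinEquiv.symm (Fin.last k) : Fin k ⊕ Fin 1) = Sum.inr 0 := by
          rw [Equiv.symm_apply_eq]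
          ext
          simp
        simp only [BoundedFormula.relabelAux, Function.comp, Sum.map_inr,
          Equiv.sumAssoc_apply_inr, Sum.elim_inr, h2, id]
        erw [this]
        simp
      · have : (finSumFinEquiv.symm ((finSumFinEquiv (Sum.inr a.castSucc : Fin 1 ⊕ Fin (k+1)) :
            Fin (1 + (k + 1))) : Fin (1 + k + 1)) : Fin (1 + k) ⊕ Fin 1) =
            Sum.inl (finSumFinEquiv (Sum.inr a)) := by
          rw [Equiv.symm_apply_eq]
          ext
          simp
        have h2 : (finSumFinEquiv.symm a.castSucc : Fin k ⊕ Fin 1) = Sum.inl a := by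
          rw [Equiv.symm_apply_eq]
          ext
          simp
        simp only [BoundedFormula.relabelAux, Function.comp, Sum.map_inr,
          Equiv.sumAssoc_apply_inr, Sum.elim_inr, h2, id]
        erw [this]
        simp

/-- Binding the last variable and then the remaining `k` gives the same as binding all `k + 1` at
once; the cast only reassociates `k + 1 + m`. -/
theorem relabel_id_relabel {k m : ℕ} (F : L.BoundedFormula (α ⊕ Fin (k + 1)) m) :
    (F.relabel (Sum.elim (Sum.inl ∘ Sum.inl) (Sum.map Sum.inr id ∘ finSumFinEquiv.symm) :
        α ⊕ Fin (k + 1) → (α ⊕ Fin k) ⊕ Fin 1)).relabel (id : α ⊕ Fin k → α ⊕ Fin k) =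
      (F.relabel (id : α ⊕ Fin (k + 1) → α ⊕ Fin (k + 1))).castLE
        (Nat.add_assoc k 1 m).le := by
  have key : ∀ (m : ℕ) (t : L.Term ((α ⊕ Fin (k + 1)) ⊕ Fin m)),
      (t.relabel (BoundedFormula.relabelAux (Sum.elim (Sum.inl ∘ Sum.inl)
        (Sum.map Sum.inr id ∘ finSumFinEquiv.symm) :
        α ⊕ Fin (k + 1) → (α ⊕ Fin k) ⊕ Fin 1) m)).relabel
        (BoundedFormula.relabelAux (id : α ⊕ Fin k → α ⊕ Fin k) (1 + m)) =
      (t.relabel (BoundedFormula.relabelAux (id : α ⊕ Fin (k + 1) → α ⊕ Fin (k + 1)) m)).relabel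
        (Sum.map id (Fin.castLE (Nat.add_assoc k 1 m).le)) := by
    intro m t
    rw [Term.relabel_relabel, Term.relabel_relabel]
    congr 1
    funext i
    rcases i with (i | i) | i
    · simp [BoundedFormula.relabelAux]
    · refine Fin.lastCases ?_ (fun a => ?_) i
      · have h2 : (finSumFinEquiv.symm (Fin.last k) : Fin k ⊕ Fin 1) = Sum.inr 0 := by
          rw [Equiv.symm_apply_eq]
          ext
          simp
        simp only [BoundedFormula.relabelAux, Function.comp, Sum.map_inl, Sum.elim_inr, h2,
          Sum.map_inr, id, Equiv.sumAssoc_apply_inl_inr, Equiv.sumAssoc_apply_inr,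
          finSumFinEquiv_apply_left, finSumFinEquiv_apply_right]
        congr 1
      · have h2 : (finSumFinEquiv.symm a.castSucc : Fin k ⊕ Fin 1) = Sum.inl a := by
          rw [Equiv.symm_apply_eq]
          ext
          simp
        simp only [BoundedFormula.relabelAux, Function.comp, Sum.map_inl, Sum.elim_inr, h2,
          id, Equiv.sumAssoc_apply_inl_inr, Equiv.sumAssoc_apply_inl_inl, Sum.map_inr,
          finSumFinEquiv_apply_left]
        congr 1
    · simp only [BoundedFormula.relabelAux, Function.comp, Sum.map_inr, id,
        Equiv.sumAssoc_apply_inr, finSumFinEquiv_apply_right]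
      congr 1
      ext
      simp [Nat.add_assoc]
  induction F with
  | falsum => rfl
  | equal t₁ t₂ => exact congrArg₂ BoundedFormula.equal (key _ t₁) (key _ t₂)
  | rel R ts => exact congrArg (BoundedFormula.rel R) (funext fun i => key _ (ts i))
  | imp _ _ h1 h2 => exact congrArg₂ BoundedFormula.imp h1 h2
  | all f ih =>
    rw [BoundedFormula.relabel_all, BoundedFormula.relabel_all, BoundedFormula.relabel_all, ih]
    rfl

/-- Relabelling along the identity binds again exactly the variables that `toFormula` has made free.
-/
theorem relabel_id_toFormula {k : ℕ} (φ : L.BoundedFormula α k) :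
    BoundedFormula.relabel (id : α ⊕ Fin k → α ⊕ Fin k) φ.toFormula = φ := by
  have key : ∀ (k : ℕ) (t : L.Term (α ⊕ Fin k)), (t.relabel Sum.inl).relabel
      (BoundedFormula.relabelAux (id : α ⊕ Fin k → α ⊕ Fin k) 0) = t := by
    intro k t
    rw [Term.relabel_relabel, term_relabel_eq_subst]
    refine Eq.trans ?_ (term_subst_var t)
    congr 1
    funext i
    rcases i with i | i
    · rfl
    · rfl
  induction φ with
  | falsum => rfl
  | equal t₁ t₂ => exact congrArg₂ BoundedFormula.equal (key _ t₁) (key _ t₂)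
  | rel R ts => exact congrArg (BoundedFormula.rel R) (funext fun i => key _ (ts i))
  | imp _ _ h1 h2 => exact congrArg₂ BoundedFormula.imp h1 h2
  | @all k f ih =>
    simp only [BoundedFormula.toFormula]
    rw [BoundedFormula.relabel_all, relabel_id_relabel, ih, BoundedFormula.castLE_rfl]

theorem castLE_relabel_id {m : ℕ} (F : L.BoundedFormula (α ⊕ Fin 0) m)
    (h : α ⊕ Fin 0 → L.Term α) (hh : ∀ a, h (Sum.inl a) = Term.var a) :
    F.subst h = (F.relabel (id : α ⊕ Fin 0 → α ⊕ Fin 0)).castLE (Nat.zero_add m).le := by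
  have key : ∀ (m : ℕ) (t : L.Term ((α ⊕ Fin 0) ⊕ Fin m)),
      t.subst (Sum.elim (Term.relabel Sum.inl ∘ h) (Term.var ∘ Sum.inr)) =
      (t.relabel (BoundedFormula.relabelAux (id : α ⊕ Fin 0 → α ⊕ Fin 0) m)).relabel
        (Sum.map id (Fin.castLE (Nat.zero_add m).le)) := by
    intro m t
    rw [Term.relabel_relabel, term_relabel_eq_subst]
    congr 1
    funext i
    rcases i with (i | i) | i
    · simp [BoundedFormula.relabelAux, hh]
    · exact i.elim0
    · simp [BoundedFormula.relabelAux]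
      rfl
  induction F with
  | falsum => rfl
  | equal t₁ t₂ => exact congrArg₂ BoundedFormula.equal (key _ t₁) (key _ t₂)
  | rel R ts => exact congrArg (BoundedFormula.rel R) (funext fun i => key _ (ts i))
  | imp _ _ h1 h2 => exact congrArg₂ BoundedFormula.imp h1 h2
  | all f ih =>
    rw [BoundedFormula.relabel_all]
    change BoundedFormula.all (f.subst h) = _
    rw [ih]
    rfl

theorem toFormula_subst_eq_self (φ : L.Formula α) (h : α ⊕ Fin 0 → L.Term α)
    (hh : ∀ a, h (Sum.inl a) = Term.var a) : φ.toFormula.subst h = φ := by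
  rw [castLE_relabel_id _ h hh, relabel_id_toFormula, BoundedFormula.castLE_rfl]

/-- Binding variable `i` and instantiating it by itself changes nothing. Together with the freshness
of `i` after binding, this adapts the calculus rule `all_intro` to `all i`. -/
theorem inst_relabel (i : ℕ) (ψ : L.Formula ℕ) :
    inst (BoundedFormula.relabel (n := 1)
      (fun j => if j = i then Sum.inr 0 else Sum.inl j) ψ) (Term.var i) = ψ := by
  unfold inst
  have h := toFormula_relabel ψ
    (fun j => if j = i then Sum.inr 0 else Sum.inl j : ℕ → ℕ ⊕ Fin 1)
  refine (congrArg (fun F => BoundedFormula.subst F _) h).trans ?_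
  rw [subst_subst]
  refine toFormula_subst_eq_self _ _ fun a => ?_
  by_cases ha : a = i <;> simp [BoundedFormula.relabelAux, ha]

theorem notMem_freeVarFinset_relabel {k : ℕ} (i : ℕ) (ψ : L.BoundedFormula ℕ k) :
    i ∉ (BoundedFormula.relabel (n := 1)
      (fun j => if j = i then Sum.inr 0 else Sum.inl j) ψ).freeVarFinset := by
  have key : ∀ (m : ℕ) (t : L.Term (ℕ ⊕ Fin m)), i ∉ (t.relabel (BoundedFormula.relabelAux
      (fun j => if j = i then Sum.inr 0 else Sum.inl j : ℕ → ℕ ⊕ Fin 1) m)).varFinsetLeft := by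
    intro m t
    induction t with
    | var x =>
      rcases x with x | x
      · by_cases hx : x = i
        · simp [BoundedFormula.relabelAux, hx]
        · simp [BoundedFormula.relabelAux, hx, Ne.symm hx]
      · simp [BoundedFormula.relabelAux]
    | func f ts ih => simpa using ih
  induction ψ with
  | falsum => simp
  | equal t₁ t₂ =>
    simp only [BoundedFormula.relabel, BoundedFormula.mapTermRel, BoundedFormula.freeVarFinset,
      Finset.mem_union, not_or]
    exact ⟨key _ t₁, key _ t₂⟩
  | rel R ts =>
    simp only [BoundedFormula.relabel, BoundedFormula.mapTermRel, BoundedFormula.freeVarFinset,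
      Finset.mem_biUnion, not_exists, not_and]
    exact fun j _ => key _ (ts j)
  | imp _ _ h1 h2 =>
    simp only [BoundedFormula.relabel_imp, BoundedFormula.freeVarFinset, Finset.mem_union, not_or]
    exact ⟨h1, h2⟩
  | all f ih =>
    rw [BoundedFormula.relabel_all]
    exact ih

/-- The number of connectives and quantifiers of a formula. -/
def complexity : ∀ {n : ℕ}, L.BoundedFormula α n → ℕ
  | _, .falsum => 0
  | _, .equal _ _ => 0
  | _, .rel _ _ => 0
  | _, .imp φ ψ => complexity φ + complexity ψ + 1
  | _, .all φ => complexity φ + 1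

theorem complexity_subst {n : ℕ} (φ : L.BoundedFormula α n) (f : α → L.Term β) :
    complexity (φ.subst f) = complexity φ := by
  induction φ with
  | falsum => rfl
  | equal => rfl
  | rel => rfl
  | imp _ _ h1 h2 => exact congrArg₂ (fun a b => a + b + 1) h1 h2
  | all _ ih => exact congrArg (· + 1) ih

theorem complexity_relabel {n k : ℕ} (φ : L.BoundedFormula α k) (g : α → β ⊕ Fin n) :
    complexity (φ.relabel g) = complexity φ := by
  induction φ with
  | falsum => rfl
  | equal => rfl
  | rel => rfl
  | imp _ _ h1 h2 => exact congrArg₂ (fun a b => a + b + 1) h1 h2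
  | all _ ih =>
    rw [BoundedFormula.relabel_all]
    exact congrArg (· + 1) ih

theorem complexity_toFormula {n : ℕ} (φ : L.BoundedFormula α n) :
    complexity φ.toFormula = complexity φ := by
  induction φ with
  | falsum => rfl
  | equal => rfl
  | rel => rfl
  | imp _ _ h1 h2 => exact congrArg₂ (fun a b => a + b + 1) h1 h2
  | all _ ih => exact congrArg (· + 1) ((complexity_relabel _ _).trans ih)

/-- An instance of a universal formula is not a structural subterm of it, so the truth lemma is
proved by induction on this measure, which instantiation leaves unchanged. -/
theorem complexity_inst (φ : L.BoundedFormula ℕ 1) (t : L.Term ℕ) :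
    complexity (inst φ t) = complexity φ :=
  (complexity_subst _ _).trans (complexity_toFormula _)

theorem inst_bdEqual (t₁ t₂ : L.Term (ℕ ⊕ Fin 1)) (t : L.Term ℕ) :
    inst (t₁.bdEqual t₂) t = (t₁.subst (Sum.elim Term.var fun _ => t)).equal
      (t₂.subst (Sum.elim Term.var fun _ => t)) := by
  simp only [inst, Term.bdEqual, BoundedFormula.toFormula, Term.equal, BoundedFormula.subst,
    BoundedFormula.mapTermRel, term_relabel_subst, term_subst_relabel]
  rfl

theorem realize_inst {M : Type} [L.Structure M] (φ : L.BoundedFormula ℕ 1) (t : L.Term ℕ)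
    (e : ℕ → M) : (inst φ t).Realize e ↔ BoundedFormula.Realize φ e fun _ => t.realize e := by
  unfold inst Formula.Realize
  rw [BoundedFormula.realize_subst, ← Formula.Realize, BoundedFormula.realize_toFormula]
  rfl

end Syntax_lemmas

/-! ### Derivations from assumptions -/

section Calculus

variable {L : FirstOrder.Language.{0, 0}} {T : Set (L.Formula ℕ)}

/-- Derivability from the set `A` of assumptions, whose free variables are kept fixed. -/
inductive Derives (T A : Set (L.Formula ℕ)) : L.Formula ℕ → Prop
  | thm {φ : L.Formula ℕ} : Provable T φ → Derives T A φ
  | hyp {φ : L.Formula ℕ} : φ ∈ A → Derives T A φ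
  | mp {φ ψ : L.Formula ℕ} : Derives T A (φ.imp ψ) → Derives T A φ → Derives T A ψ

theorem provable_imp_self (φ : L.Formula ℕ) : Provable T (φ.imp φ) :=
  .mp (.mp (.imp_distrib φ (φ.imp φ) φ) (.imp_const _ _)) (.imp_const _ _)

namespace Derives

variable {A B : Set (L.Formula ℕ)} {φ ψ χ : L.Formula ℕ}

theorem mono (hAB : A ⊆ B) (h : Derives T A φ) : Derives T B φ := by
  induction h with
  | thm h => exact .thm h
  | hyp h => exact .hyp (hAB h)
  | mp _ _ h1 h2 => exact .mp h1 h2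

/-- No side condition on variables is needed: generalization occurs only inside `Provable T` and
never below an assumption. -/
theorem deduction (h : Derives T (insert φ A) ψ) : Derives T A (φ.imp ψ) := by
  induction h with
  | @thm ψ h => exact .thm (.mp (.imp_const _ _) h)
  | @hyp ψ h =>
    rcases h with rfl | h
    · exact .thm (provable_imp_self _)
    · exact .mp (.thm (.imp_const _ _)) (.hyp h)
  | mp _ _ h1 h2 => exact .mp (.mp (.thm (.imp_distrib _ _ _)) h1) h2

theorem cut (h1 : Derives T A φ) (h2 : Derives T (insert φ A) ψ) : Derives T A ψ :=
  .mp h2.deduction h1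

theorem head : Derives T (insert φ A) φ := .hyp (Set.mem_insert _ _)

theorem weaken (h : Derives T A φ) : Derives T (insert ψ A) φ := h.mono (Set.subset_insert _ _)

theorem by_contradiction (h : Derives T (insert (φ.imp ⊥) A) ⊥) : Derives T A φ :=
  .mp (.thm (.not_not φ)) h.deduction

theorem exfalso (h : Derives T A ⊥) : Derives T A φ := by_contradiction h.weaken

theorem provable (h : Derives T ∅ φ) : Provable T φ := by
  induction h with
  | thm h => exact h
  | hyp h => exact h.elim
  | mp _ _ h1 h2 => exact .mp h1 h2

/-- `φ ⊓ ψ` abbreviates `(φ → (ψ → ⊥)) → ⊥`, so the projections are obtained by classical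
refutation. -/
theorem inf_left : Derives T {φ ⊓ ψ} φ := by
  refine by_contradiction (.mp (.mono (B := _) ?_ (head (A := ∅) (φ := φ ⊓ ψ))) ?_)
  · intro x hx
    rw [LawfulSingleton.insert_empty_eq] at hx
    exact Or.inr hx
  · exact deduction (exfalso (.mp (weaken head) head))

theorem inf_right : Derives T {φ ⊓ ψ} ψ := by
  refine by_contradiction (.mp (.mono (B := _) ?_ (head (A := ∅) (φ := φ ⊓ ψ))) ?_)
  · intro x hx
    rw [LawfulSingleton.insert_empty_eq] at hx
    exact Or.inr hx
  · exact deduction (weaken head)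

theorem exists_finite (h : Derives T A φ) : ∃ F : Set (L.Formula ℕ), F.Finite ∧ F ⊆ A ∧
    Derives T F φ := by
  induction h with
  | thm h => exact ⟨∅, Set.finite_empty, Set.empty_subset _, .thm h⟩
  | @hyp ψ h => exact ⟨{ψ}, Set.finite_singleton _, Set.singleton_subset_iff.2 h, .hyp rfl⟩
  | mp _ _ h1 h2 =>
    obtain ⟨F, hF, hFA, h1⟩ := h1
    obtain ⟨G, hG, hGA, h2⟩ := h2
    exact ⟨F ∪ G, hF.union hG, Set.union_subset hFA hGA,
      .mp (h1.mono Set.subset_union_left) (h2.mono Set.subset_union_right)⟩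

/-- Finitely many assumptions can be replaced by their conjunction. -/
theorem exists_conjunction {F : Set (L.Formula ℕ)} (hF : F.Finite) :
    ∃ ψ : L.Formula ℕ, (∀ φ, Derives T F φ → Derives T {ψ} φ) ∧ Derives T F ψ ∧
      ∀ x, (∀ φ ∈ F, x ∉ φ.freeVarFinset) → x ∉ ψ.freeVarFinset := by
  induction F, hF using Set.Finite.induction_on with
  | empty =>
    exact ⟨⊤, fun φ h => h.mono (Set.empty_subset _), .thm (provable_imp_self _),
      fun x _ => Finset.notMem_empty x⟩
  | @insert θ F _ _ ih =>
    obtain ⟨ψ, h1, h2, h3⟩ := ih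
    refine ⟨θ ⊓ ψ, fun φ h => ?_, ?_, fun x hx => ?_⟩
    · have h4 : Derives T {θ ⊓ ψ} (ψ.imp (θ.imp φ)) := by
        have := (h1 _ h.deduction)
        rw [← LawfulSingleton.insert_empty_eq] at this
        exact this.deduction.mono (Set.empty_subset _)
      exact .mp (.mp h4 inf_right) inf_left
    · refine deduction (.mp (.mp head ?_) ?_)
      · exact weaken head
      · exact weaken (weaken h2)
    · have := h3 x fun φ hφ => hx φ (Or.inr hφ)
      have := hx θ (Or.inl rfl)
      simp only [Min.min, BoundedFormula.not, BoundedFormula.freeVarFinset, Finset.mem_union]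
      simp_all

/-- The rule `all_intro` allows a single premise. A derivation uses finitely many assumptions, and
their conjunction serves as that premise. -/
theorem generalize (φ : L.BoundedFormula ℕ 1) (x : ℕ) (hA : ∀ ψ ∈ A, x ∉ ψ.freeVarFinset)
    (hx : x ∉ φ.freeVarFinset) (h : Derives T A (inst φ (Term.var x))) : Derives T A φ.all := by
  obtain ⟨F, hF, hFA, h⟩ := h.exists_finite
  obtain ⟨ψ, h1, h2, h3⟩ := exists_conjunction (T := T) hF
  have h4 := h1 _ h
  rw [← LawfulSingleton.insert_empty_eq] at h4
  exact .mp (.thm (.all_intro ψ φ x (h3 x fun θ hθ => hA θ (hFA hθ)) hx h4.deduction.provable))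
    (h2.mono hFA)

end Derives

open Derives

theorem Provable.generalize {ψ : L.Formula ℕ} (i : ℕ) (h : Provable T ψ) :
    Provable T (BoundedFormula.all (BoundedFormula.relabel (n := 1)
      (fun j => if j = i then Sum.inr 0 else Sum.inl j) ψ)) := by
  refine (Derives.generalize (A := ∅) _ i (by simp) (notMem_freeVarFinset_relabel i ψ) ?_).provable
  rw [inst_relabel]
  exact .thm h

/-! ### Maximal consistent sets with witnesses -/

theorem exists_fresh {F : Set (L.Formula ℕ)} (hF : F.Finite) :
    ∃ x, ∀ ψ ∈ F, x ∉ ψ.freeVarFinset := by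
  obtain ⟨x, hx⟩ := (hF.toFinset.biUnion fun ψ => ψ.freeVarFinset).exists_notMem
  refine ⟨x, fun ψ hψ h => hx ?_⟩
  simp only [Finset.mem_biUnion, Set.Finite.mem_toFinset]
  exact ⟨ψ, hψ, h⟩

/-- `B` decides the formula `θ`, with a witness if it refutes a universal formula. -/
def Decides (B : Set (L.Formula ℕ)) (θ : L.Formula ℕ) : Prop :=
  θ ∈ B ∨ θ.imp ⊥ ∈ B ∧ ∀ χ : L.BoundedFormula ℕ 1, θ = χ.all →
    ∃ x, (inst χ (Term.var x)).imp ⊥ ∈ B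

theorem Decides.mono {B C : Set (L.Formula ℕ)} (hBC : B ⊆ C) {θ : L.Formula ℕ}
    (h : Decides B θ) : Decides C θ := by
  rcases h with h | ⟨h, h'⟩
  · exact Or.inl (hBC h)
  · exact Or.inr ⟨hBC h, fun χ hχ => (h' χ hχ).imp fun x hx => hBC hx⟩

/-- Since the set remains finite, a variable that occurs in none of its formulas is always available
as a witness. So Henkin's construction needs no new constants. -/
theorem exists_decides {F : Set (L.Formula ℕ)} (hF : F.Finite) (hc : ¬Derives T F ⊥)
    (θ : L.Formula ℕ) :
    ∃ G : Set (L.Formula ℕ), G.Finite ∧ ¬Derives T G ⊥ ∧ F ⊆ G ∧ Decides G θ := by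
  by_cases h1 : Derives T (insert θ F) ⊥
  · have hn : Derives T F (θ.imp ⊥) := h1.deduction
    have hc' : ¬Derives T (insert (θ.imp ⊥) F) ⊥ := fun h => hc (hn.cut h)
    by_cases hθ : ∃ χ : L.BoundedFormula ℕ 1, θ = χ.all
    · obtain ⟨χ, rfl⟩ := hθ
      obtain ⟨x, hx⟩ := exists_fresh (hF.insert χ.all)
      refine ⟨insert ((inst χ (Term.var x)).imp ⊥) (insert (χ.all.imp ⊥) F),
        (hF.insert _).insert _, fun h => hc' ?_,
        (Set.subset_insert _ _).trans (Set.subset_insert _ _),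
        Or.inr ⟨Or.inr (Or.inl rfl), fun χ' hχ => ?_⟩⟩
      -- If the added counterexample were inconsistent, `inst χ x` would be derivable for a fresh
      -- `x`, hence `χ.all` itself, contrary to its negation.
      · refine .mp head (Derives.generalize χ x ?_ (hx χ.all (Or.inl rfl)) h.by_contradiction)
        rintro ψ (rfl | hψ)
        · simpa [Bot.bot] using hx χ.all (Or.inl rfl)
        · exact hx ψ (Or.inr hψ)
      · cases hχ
        exact ⟨x, Or.inl rfl⟩
    · exact ⟨_, hF.insert _, hc', Set.subset_insert _ _, Or.inr ⟨Or.inl rfl, fun χ h =>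
        (hθ ⟨χ, h⟩).elim⟩⟩
  · exact ⟨_, hF.insert _, h1, Set.subset_insert _ _, Or.inl (Or.inl rfl)⟩

/-- Stage `n + 1` decides the `n`-th formula of an enumeration. An inconsistency of the union would
use finitely many formulas and so appear at some stage. -/
theorem exists_maximal [Countable (L.Formula ℕ)] {F : Set (L.Formula ℕ)} (hF : F.Finite)
    (hc : ¬Derives T F ⊥) :
    ∃ G : Set (L.Formula ℕ), ¬Derives T G ⊥ ∧ F ⊆ G ∧ ∀ θ, Decides G θ := by
  obtain ⟨f, hf⟩ := exists_surjective_nat (L.Formula ℕ)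
  choose! next h1 h2 h3 h4 using
    fun (F : Set (L.Formula ℕ)) (h : F.Finite ∧ ¬Derives T F ⊥) θ => exists_decides h.1 h.2 θ
  let G : ℕ → Set (L.Formula ℕ) := Nat.rec F fun n B => next B (f n)
  have hG : ∀ n, (G n).Finite ∧ ¬Derives T (G n) ⊥ := by
    intro n
    induction n with
    | zero => exact ⟨hF, hc⟩
    | succ n ih => exact ⟨h1 _ ih _, h2 _ ih _⟩
  have hm : Monotone G := monotone_nat_of_le_succ fun n => h3 _ (hG n) _
  refine ⟨⋃ n, G n, fun h => ?_, Set.subset_iUnion G 0, fun θ => ?_⟩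
  · obtain ⟨B, hB, hBG, h⟩ := h.exists_finite
    obtain ⟨n, hn⟩ : ∃ n, B ⊆ G n := by
      have := hm.directed_le.exists_mem_subset_of_finset_subset_biUnion (s := hB.toFinset)
        (by simpa using hBG)
      simpa using this
    exact (hG n).2 (h.mono hn)
  · obtain ⟨n, rfl⟩ := hf θ
    exact (h4 _ (hG n) (f n)).mono (Set.subset_iUnion G (n + 1))

end Calculus

/-! ### The completeness theorem for the language of arithmetic -/

section Henkin

variable {T G : Set Fm}

/-- A set of formulas that is maximal consistent over `T` and has witnesses. -/
structure Henkin (T G : Set Fm) : Prop where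
  consistent : ¬Derives T G ⊥
  decides : ∀ θ, Decides G θ

namespace Henkin

theorem mem_of_derives (h : Henkin T G) {φ : Fm} (hφ : Derives T G φ) : φ ∈ G :=
  (h.decides φ).resolve_right fun h' => h.consistent (.mp (.hyp h'.1) hφ)

theorem mem_of_provable (h : Henkin T G) {φ : Fm} (hφ : Provable T φ) : φ ∈ G :=
  h.mem_of_derives (.thm hφ)

theorem mem_mp (h : Henkin T G) {φ ψ : Fm} (h1 : φ.imp ψ ∈ G) (h2 : φ ∈ G) : ψ ∈ G :=
  h.mem_of_derives (.mp (.hyp h1) (.hyp h2))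

theorem mem_imp (h : Henkin T G) {φ ψ : Fm} : φ.imp ψ ∈ G ↔ (φ ∈ G → ψ ∈ G) := by
  refine ⟨h.mem_mp, fun h1 => h.mem_of_derives (Derives.deduction ?_)⟩
  rcases h.decides φ with h2 | h2
  · exact (Derives.hyp (h1 h2)).weaken
  · exact .exfalso (.mp (.hyp (Or.inr h2.1)) .head)

theorem mem_all (h : Henkin T G) (χ : arith.BoundedFormula ℕ 1) :
    χ.all ∈ G ↔ ∀ t, inst χ t ∈ G := by
  refine ⟨fun h1 t => h.mem_mp (h.mem_of_provable (.all_elim χ t)) h1, fun h1 => ?_⟩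
  refine (h.decides χ.all).resolve_right fun h2 => ?_
  obtain ⟨x, hx⟩ := h2.2 χ rfl
  exact h.consistent (.mp (.hyp hx) (.hyp (h1 _)))

/-- Leibniz's law for the template `C(s) = C(x)`, applied to the reflexivity of `C(s)`. -/
theorem context (h : Henkin T G) (C : arith.Term (ℕ ⊕ Fin 1)) {s t : Tm} (hst : eqF s t ∈ G) :
    eqF (C.subst (Sum.elim Term.var fun _ => s)) (C.subst (Sum.elim Term.var fun _ => t)) ∈ G := by
  have h1 := h.mem_mp (h.mem_of_provable (.eq_subst (Term.bdEqual
    ((C.subst (Sum.elim Term.var fun _ => s)).relabel Sum.inl) C) s t)) hst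
  simp only [inst_bdEqual, term_relabel_subst, Sum.elim_inl, term_subst_var] at h1
  exact h.mem_mp h1 (h.mem_of_provable (.eq_refl _))

theorem eq_symm (h : Henkin T G) {s t : Tm} (hst : eqF s t ∈ G) : eqF t s ∈ G := by
  have h1 := h.mem_mp (h.mem_of_provable (.eq_subst (Term.bdEqual (Term.var (Sum.inr 0))
    (s.relabel Sum.inl)) s t)) hst
  simp only [inst_bdEqual, term_relabel_subst, Sum.elim_inl, term_subst_var, Term.subst,
    Sum.elim_inr] at h1
  exact h.mem_mp h1 (h.mem_of_provable (.eq_refl _))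

theorem eq_trans (h : Henkin T G) {s t u : Tm} (hst : eqF s t ∈ G) (htu : eqF t u ∈ G) :
    eqF s u ∈ G := by
  have h1 := h.mem_mp (h.mem_of_provable (.eq_subst (Term.bdEqual (s.relabel Sum.inl)
    (Term.var (Sum.inr 0))) t u)) htu
  simp only [inst_bdEqual, term_relabel_subst, Sum.elim_inl, term_subst_var, Term.subst,
    Sum.elim_inr] at h1
  exact h.mem_mp h1 hst

/-- Provable equality of terms. -/
def setoid (h : Henkin T G) : Setoid Tm where
  r s t := eqF s t ∈ G
  iseqv := ⟨fun _ => h.mem_of_provable (.eq_refl _), h.eq_symm, h.eq_trans⟩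

theorem term_zero (ts : Fin 0 → Tm) : Term.func (L := arith) ArithFunc.zero ts = O :=
  congrArg _ (Subsingleton.elim _ _)

theorem term_succ (ts : Fin 1 → Tm) : Term.func (L := arith) ArithFunc.succ ts = S (ts 0) :=
  congrArg _ (funext fun i => by fin_cases i; rfl)

theorem term_add (ts : Fin 2 → Tm) : Term.func (L := arith) ArithFunc.add ts =
    plus (ts 0) (ts 1) :=
  congrArg _ (funext fun i => by fin_cases i <;> rfl)

theorem term_mul (ts : Fin 2 → Tm) : Term.func (L := arith) ArithFunc.mul ts =
    times (ts 0) (ts 1) :=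
  congrArg _ (funext fun i => by fin_cases i <;> rfl)

theorem eq_succ (h : Henkin T G) {s t : Tm} (hst : eqF s t ∈ G) : eqF (S s) (S t) ∈ G := by
  have := h.context (Term.func (L := arith) ArithFunc.succ ![Term.var (Sum.inr 0)]) hst
  simpa [term_succ] using this

theorem eq_binary (h : Henkin T G) (f : ArithFunc 2) {s t s' t' : Tm} (hs : eqF s s' ∈ G)
    (ht : eqF t t' ∈ G) : eqF (Term.func (L := arith) f ![s, t])
      (Term.func (L := arith) f ![s', t']) ∈ G := by
  have e : ∀ (a b : arith.Term (ℕ ⊕ Fin 1)) (σ : ℕ ⊕ Fin 1 → Tm),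
      (Term.func (L := arith) f ![a, b]).subst σ =
      Term.func (L := arith) f ![a.subst σ, b.subst σ] :=
    fun a b σ => congrArg (Term.func (L := arith) (l := 2) f)
      (funext fun i => by fin_cases i <;> rfl)
  have h1 := h.context (Term.func (L := arith) f ![Term.var (Sum.inr 0), t.relabel Sum.inl]) hs
  have h2 := h.context (Term.func (L := arith) f ![s'.relabel Sum.inl, Term.var (Sum.inr 0)]) ht
  rw [e, e] at h1 h2
  simp only [term_relabel_subst, Term.subst, Sum.elim_inl, Sum.elim_inr, term_subst_var] at h1 h2
  exact h.eq_trans h1 h2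

/-- The domain of the term model. -/
def Model (h : Henkin T G) : Type := Quotient h.setoid

instance (h : Henkin T G) : Nonempty h.Model := ⟨Quotient.mk _ O⟩

noncomputable instance (h : Henkin T G) : arith.Structure h.Model where
  funMap f ts := Quotient.mk h.setoid (Term.func (L := arith) f fun i => (ts i).out)
  RelMap r := r.elim

/-- The assignment that sends each variable to its class. -/
def classes (h : Henkin T G) (i : ℕ) : h.Model := Quotient.mk h.setoid (Term.var i)

theorem realize_term (h : Henkin T G) (t : Tm) : t.realize h.classes = Quotient.mk h.setoid t := by
  induction t with
  | var => rfl
  | @func n f ts ih =>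
    have e : ∀ i, eqF ((ts i).realize h.classes).out (ts i) ∈ G := fun i => by
      rw [ih i]
      exact Quotient.mk_out (s := h.setoid) (ts i)
    refine Quotient.sound (s := h.setoid) ?_
    change eqF (Term.func (L := arith) f fun i => ((ts i).realize h.classes).out) _ ∈ G
    rcases f with _ | _ | _ | _
    · rw [term_zero, term_zero]
      exact h.mem_of_provable (.eq_refl _)
    · rw [term_succ, term_succ]
      exact h.eq_succ (e 0)
    · rw [term_add, term_add]
      exact h.eq_binary _ (e 0) (e 1)
    · rw [term_mul, term_mul]
      exact h.eq_binary _ (e 0) (e 1)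

/-- The truth lemma. In the quantifier case every element of the model is the class of a term, and
the set `G` contains a universal formula iff it contains all its instances. -/
theorem mem_iff_realize (h : Henkin T G) (φ : Fm) : φ ∈ G ↔ φ.Realize h.classes := by
  induction hn : complexity φ using Nat.strong_induction_on generalizing φ with
  | _ n ih =>
    cases φ with
    | falsum => exact iff_of_false (fun h' => h.consistent (.hyp h')) id
    | equal t₁ t₂ =>
      have e : ∀ t : arith.Term (ℕ ⊕ Fin 0), ∃ s : Tm, s.relabel Sum.inl = t := fun t =>
        ⟨t.relabel (Sum.elim id Fin.elim0), by
          rw [Term.relabel_relabel, term_relabel_eq_subst]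
          refine Eq.trans ?_ (term_subst_var t)
          congr 1
          funext i
          rcases i with i | i
          · rfl
          · exact i.elim0⟩
      obtain ⟨s₁, rfl⟩ := e t₁
      obtain ⟨s₂, rfl⟩ := e t₂
      change eqF s₁ s₂ ∈ G ↔ (Term.equal s₁ s₂).Realize h.classes
      rw [Formula.realize_equal, realize_term, realize_term]
      exact (Quotient.eq (r := h.setoid)).symm
    | rel R => exact R.elim
    | imp φ ψ =>
      simp only [complexity] at hn
      rw [h.mem_imp, ih _ (by omega) φ rfl, ih _ (by omega) ψ rfl]
      exact BoundedFormula.realize_imp.symm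
    | all χ =>
      simp only [complexity] at hn
      rw [h.mem_all, Formula.Realize, BoundedFormula.realize_all]
      have e : ∀ t, inst χ t ∈ G ↔ χ.Realize h.classes
          (Fin.snoc default (Quotient.mk h.setoid t)) := by
        intro t
        rw [ih _ (by rw [← hn]; exact Nat.lt_succ_self _) _ (complexity_inst χ t), realize_inst,
          realize_term, iff_iff_eq]
        refine congrArg _ (funext fun i => ?_)
        fin_cases i
        rfl
      exact ⟨fun h1 a => Quotient.inductionOn a fun t => (e t).1 (h1 t), fun h1 t => (e t).2 (h1 _)⟩

end Henkin

end Henkin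

/-! ### Semantics of quantification over numbered variables. -/

section Realize_lemmas

variable {M : Type} [arith.Structure M]

theorem realize_all (i : ℕ) (φ : Fm) (e : ℕ → M) :
    (all i φ).Realize e ↔ ∀ x, φ.Realize (Function.update e i x) := by
  unfold all Formula.Realize
  rw [BoundedFormula.realize_all]
  refine forall_congr' fun a => ?_
  refine (BoundedFormula.realize_relabel (n := 0)).trans ?_
  rw [iff_iff_eq]
  congr 1
  · funext j
    by_cases h : j = i
    · subst h
      simp [Fin.snoc]
    · simp [h]
  · exact Subsingleton.elim _ _

theorem realize_ex (i : ℕ) (φ : Fm) (e : ℕ → M) :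
    (ex i φ).Realize e ↔ ∃ x, φ.Realize (Function.update e i x) := by
  unfold ex Formula.Realize
  rw [BoundedFormula.realize_ex]
  refine exists_congr fun a => ?_
  refine (BoundedFormula.realize_relabel (n := 0)).trans ?_
  rw [iff_iff_eq]
  congr 1
  · funext j
    by_cases h : j = i
    · subst h
      simp [Fin.snoc]
    · simp [h]
  · exact Subsingleton.elim _ _

theorem realize_congr {φ : Fm} {e e' : ℕ → M} (h : ∀ i ∈ φ.freeVarFinset, e i = e' i) :
    φ.Realize e ↔ φ.Realize e' := by
  unfold Formula.Realize
  have h1 := BoundedFormula.realize_restrictFreeVar' (φ := φ) (s := {i | i ∈ φ.freeVarFinset})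
    (fun i hi => hi) (v := e) (xs := default)
  have h2 := BoundedFormula.realize_restrictFreeVar' (φ := φ) (s := {i | i ∈ φ.freeVarFinset})
    (fun i hi => hi) (v := e') (xs := default)
  rw [← h1, ← h2, iff_iff_eq]
  congr 1
  funext i
  exact h i i.2

end Realize_lemmas

/-- **Completeness**: what holds in all models of `T` is provable from `T`. -/
theorem provable_of_models {T : Set Fm} {φ : Fm}
    (h : ∀ (M : Type) [arith.Structure M] [Nonempty M], (∀ ψ ∈ T, ∀ e : ℕ → M, ψ.Realize e) →
      ∀ e : ℕ → M, φ.Realize e) : Provable T φ := by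
  by_contra hφ
  have : Countable (Σ l, arith.Functions l) := by
    refine Function.Injective.countable (β := ℕ) (f := fun x => match x with
      | ⟨_, ArithFunc.zero⟩ => 0
      | ⟨_, ArithFunc.succ⟩ => 1
      | ⟨_, ArithFunc.add⟩ => 2
      | ⟨_, ArithFunc.mul⟩ => 3) ?_
    rintro ⟨_, _ | _ | _ | _⟩ ⟨_, _ | _ | _ | _⟩ h <;> first | rfl | simp at h
  have : Countable (Σ l, arith.Relations l) :=
    Function.Injective.countable (β := ℕ) (f := fun x => x.2.elim) fun x => x.2.elim
  have : Countable arith.Symbols := inferInstanceAs (Countable (_ ⊕ _))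
  have hc : ¬Derives T {φ.imp ⊥} ⊥ := fun h' => hφ (by
    rw [← LawfulSingleton.insert_empty_eq] at h'
    exact h'.by_contradiction.provable)
  obtain ⟨G, h1, h2, h3⟩ := exists_maximal (Set.finite_singleton _) hc
  have hG : Henkin T G := ⟨h1, h3⟩
  refine hG.consistent (.mp (.hyp (h2 rfl)) (.hyp ((hG.mem_iff_realize φ).2 (h hG.Model ?_ _))))
  intro ψ hψ e
  -- The truth lemma concerns the one assignment `hG.classes`, but an axiom must hold under all
  -- assignments. So its free variables are universally closed one by one, and the truth lemma is
  -- applied to the closure.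
  have key : ∀ l : List ℕ, ∃ χ : Fm, Provable T χ ∧
      (∀ e, χ.Realize e → ∀ e' : ℕ → hG.Model, (∀ i, i ∉ l → e' i = e i) → ψ.Realize e') := by
    intro l
    induction l with
    | nil =>
      refine ⟨ψ, .ax hψ, fun e he e' h => ?_⟩
      rwa [show e' = e from funext fun i => h i (by simp)]
    | cons i l ih =>
      obtain ⟨χ, hχ, h⟩ := ih
      refine ⟨all i χ, hχ.generalize i, fun e he e' h' => ?_⟩
      refine h _ ((realize_all i χ e).1 he (e' i)) e' fun j hj => ?_
      by_cases hji : j = i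
      · simp [hji]
      · simp [hji, h' j (by simp [hji, hj])]
  obtain ⟨χ, hχ, h⟩ := key ψ.freeVarFinset.toList
  have h4 := h _ ((hG.mem_iff_realize χ).1 (hG.mem_of_provable hχ))
    (fun i => if i ∈ ψ.freeVarFinset then e i else hG.classes i) fun i hi => by simp_all
  exact (realize_congr fun i hi => by simp [hi]).1 h4

/-! ### Definability with parameters -/

section Definability

variable {M : Type} [arith.Structure M]

/-- `P` is definable with parameters, as a predicate of the entries of the assignment. -/
class Dfn (P : (ℕ → M) → Prop) : Prop where
  out : ∃ φ : arith.Formula (M ⊕ ℕ), ∀ e, φ.Realize (Sum.elim id e) ↔ P e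

/-- `f` has a definable graph. -/
class DfnF (f : (ℕ → M) → M) : Prop where
  out : Dfn fun e => e 0 = f fun i => e (i + 1)

theorem Dfn.congr {P Q : (ℕ → M) → Prop} (h : Dfn P) (hPQ : ∀ e, P e ↔ Q e) : Dfn Q :=
  (funext fun e => propext (hPQ e) : P = Q) ▸ h

theorem Dfn.reindex {P : (ℕ → M) → Prop} (h : Dfn P) (r : ℕ → ℕ) :
    Dfn fun e => P fun i => e (r i) := by
  obtain ⟨φ, hφ⟩ := h.out
  refine ⟨φ.relabel (Sum.map id r), fun e => ?_⟩
  rw [Formula.realize_relabel, ← hφ, iff_iff_eq]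
  congr 1
  funext i
  rcases i with i | i <;> rfl

/-- This and the following instances let type class search establish definability by following the
shape of a predicate. -/
instance Dfn.imp {P Q : (ℕ → M) → Prop} [hP : Dfn P] [hQ : Dfn Q] : Dfn fun e => P e → Q e := by
  obtain ⟨φ, hφ⟩ := hP.out
  obtain ⟨ψ, hψ⟩ := hQ.out
  exact ⟨φ.imp ψ, fun e => by simp [← hφ, ← hψ]⟩

instance Dfn.and {P Q : (ℕ → M) → Prop} [hP : Dfn P] [hQ : Dfn Q] : Dfn fun e => P e ∧ Q e := by
  obtain ⟨φ, hφ⟩ := hP.out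
  obtain ⟨ψ, hψ⟩ := hQ.out
  exact ⟨φ ⊓ ψ, fun e => by simp [← hφ, ← hψ]⟩

instance Dfn.or {P Q : (ℕ → M) → Prop} [hP : Dfn P] [hQ : Dfn Q] : Dfn fun e => P e ∨ Q e := by
  obtain ⟨φ, hφ⟩ := hP.out
  obtain ⟨ψ, hψ⟩ := hQ.out
  exact ⟨φ ⊔ ψ, fun e => by simp [← hφ, ← hψ]⟩

instance Dfn.not {P : (ℕ → M) → Prop} [hP : Dfn P] : Dfn fun e => ¬P e := by
  obtain ⟨φ, hφ⟩ := hP.out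
  exact ⟨φ.not, fun e => by simp [← hφ]⟩

instance Dfn.iff {P Q : (ℕ → M) → Prop} [Dfn P] [Dfn Q] : Dfn fun e => P e ↔ Q e :=
  Dfn.congr (P := fun e => (P e → Q e) ∧ (Q e → P e)) inferInstance fun _ => iff_def.symm

/-- De Bruijn convention: under the quantifier, the bound element is entry `0` of the assignment and
the outer entries are shifted by one. -/
instance Dfn.ex {P : M → (ℕ → M) → Prop} [h : Dfn fun e => P (e 0) fun i => e (i + 1)] :
    Dfn fun e => ∃ x, P x e := by
  obtain ⟨φ, hφ⟩ := h.out
  refine ⟨BoundedFormula.ex (n := 0) (BoundedFormula.relabel (n := 1) (Sum.elim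
    (fun m => Sum.inl (Sum.inl m))
    fun i => Nat.casesOn i (Sum.inr 0) fun i => Sum.inl (Sum.inr i)) φ), fun e => ?_⟩
  unfold Formula.Realize
  rw [BoundedFormula.realize_ex]
  refine exists_congr fun x => ?_
  refine (BoundedFormula.realize_relabel (n := 0)).trans ?_
  rw [← show P ((fun i => Nat.casesOn i x e : ℕ → M) 0)
    (fun i => (fun i => Nat.casesOn i x e : ℕ → M) (i + 1)) ↔ P x e from Iff.rfl, ← hφ, iff_iff_eq]
  unfold Formula.Realize
  congr 1
  · funext i
    rcases i with i | _ | i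
    · rfl
    · rfl
    · rfl
  · exact Subsingleton.elim _ _

instance Dfn.all {P : M → (ℕ → M) → Prop} [Dfn fun e => P (e 0) fun i => e (i + 1)] :
    Dfn fun e => ∀ x, P x e :=
  Dfn.congr (P := fun e => ¬∃ x, ¬P x e) inferInstance fun _ => not_exists_not

theorem DfnF.reindex {f : (ℕ → M) → M} (h : DfnF f) (r : ℕ → ℕ) :
    DfnF fun e => f fun i => e (r i) :=
  ⟨h.out.reindex fun i => Nat.casesOn i 0 fun i => r i + 1⟩

/-- Substitution of a definable function into a definable predicate. -/
theorem Dfn.comp {P : M → (ℕ → M) → Prop} (h : Dfn fun e => P (e 0) fun i => e (i + 1))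
    {f : (ℕ → M) → M} (hf : DfnF f) : Dfn fun e => P (f e) e := by
  have := hf.out
  exact Dfn.congr (P := fun e => ∃ x, x = f e ∧ P x e) inferInstance fun e => by simp

theorem Dfn.comp1 {R : M → Prop} (h : Dfn fun e => R (e 0)) {f : (ℕ → M) → M} (hf : DfnF f) :
    Dfn fun e => R (f e) :=
  Dfn.comp (P := fun x _ => R x) h hf

theorem Dfn.comp2 {R : M → M → Prop} (h : Dfn fun e => R (e 0) (e 1)) {f g : (ℕ → M) → M}
    (hf : DfnF f) (hg : DfnF g) : Dfn fun e => R (f e) (g e) := by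
  refine Dfn.comp (P := fun x e => R x (g e)) ?_ hf
  refine Dfn.comp (P := fun y e => R (e 0) y) ?_ (hg.reindex (· + 1))
  -- Each substitution puts its new variable in front, so the arguments have arrived in reverse
  -- order. Truncation of the subtraction is harmless, because only the entries `0` and `1` are
  -- read.
  exact h.reindex fun i => 1 - i

theorem Dfn.comp3 {R : M → M → M → Prop} (h : Dfn fun e => R (e 0) (e 1) (e 2))
    {f g k : (ℕ → M) → M} (hf : DfnF f) (hg : DfnF g) (hk : DfnF k) :
    Dfn fun e => R (f e) (g e) (k e) := by
  refine Dfn.comp (P := fun x e => R x (g e) (k e)) ?_ hf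
  refine Dfn.comp (P := fun y e => R (e 0) y (k fun i => e (i + 1))) ?_ (hg.reindex (· + 1))
  refine Dfn.comp (P := fun z e => R (e 1) (e 0) z) ?_ (hk.reindex (· + 2))
  exact h.reindex fun i => 2 - i

theorem Dfn.comp4 {R : M → M → M → M → Prop} (h : Dfn fun e => R (e 0) (e 1) (e 2) (e 3))
    {f g k l : (ℕ → M) → M} (hf : DfnF f) (hg : DfnF g) (hk : DfnF k) (hl : DfnF l) :
    Dfn fun e => R (f e) (g e) (k e) (l e) := by
  refine Dfn.comp (P := fun x e => R x (g e) (k e) (l e)) ?_ hf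
  refine Dfn.comp (P := fun y e => R (e 0) y (k fun i => e (i + 1)) (l fun i => e (i + 1))) ?_
    (hg.reindex (· + 1))
  refine Dfn.comp (P := fun z e => R (e 1) (e 0) z (l fun i => e (i + 2))) ?_
    (hk.reindex (· + 2))
  refine Dfn.comp (P := fun z e => R (e 2) (e 1) (e 0) z) ?_ (hl.reindex (· + 3))
  exact h.reindex fun i => 3 - i

theorem Dfn.comp5 {R : M → M → M → M → M → Prop}
    (h : Dfn fun e => R (e 0) (e 1) (e 2) (e 3) (e 4)) {f g k l m : (ℕ → M) → M}
    (hf : DfnF f) (hg : DfnF g) (hk : DfnF k) (hl : DfnF l) (hm : DfnF m) :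
    Dfn fun e => R (f e) (g e) (k e) (l e) (m e) := by
  refine Dfn.comp (P := fun x e => R x (g e) (k e) (l e) (m e)) ?_ hf
  refine Dfn.comp (P := fun y e => R (e 0) y (k fun i => e (i + 1)) (l fun i => e (i + 1))
    (m fun i => e (i + 1))) ?_ (hg.reindex (· + 1))
  refine Dfn.comp (P := fun z e => R (e 1) (e 0) z (l fun i => e (i + 2)) (m fun i => e (i + 2))) ?_
    (hk.reindex (· + 2))
  refine Dfn.comp (P := fun z e => R (e 2) (e 1) (e 0) z (m fun i => e (i + 3))) ?_
    (hl.reindex (· + 3))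
  refine Dfn.comp (P := fun z e => R (e 3) (e 2) (e 1) (e 0) z) ?_ (hm.reindex (· + 4))
  exact h.reindex fun i => 4 - i

instance Dfn.eq {f g : (ℕ → M) → M} [hf : DfnF f] [hg : DfnF g] : Dfn fun e => f e = g e :=
  Dfn.comp2 (R := fun x y => x = y) ⟨Term.equal (Term.var (Sum.inr 0)) (Term.var (Sum.inr 1)),
    fun e => by simp [Formula.realize_equal]⟩ hf hg

instance DfnF.var (i : ℕ) : DfnF fun e : ℕ → M => e i :=
  ⟨⟨Term.equal (Term.var (Sum.inr 0)) (Term.var (Sum.inr (i + 1))),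
    fun e => by simp [Formula.realize_equal]⟩⟩

instance DfnF.const (c : M) : DfnF fun _ : ℕ → M => c :=
  ⟨⟨Term.equal (Term.var (Sum.inr 0)) (Term.var (Sum.inl c)),
    fun e => by simp [Formula.realize_equal]⟩⟩

theorem DfnF.comp1 {F : M → M} (h : Dfn fun e : ℕ → M => e 0 = F (e 1)) {f : (ℕ → M) → M}
    (hf : DfnF f) : DfnF fun e => F (f e) :=
  ⟨Dfn.comp2 (R := fun x y => x = F y) h (DfnF.var 0) (hf.reindex (· + 1))⟩

theorem DfnF.comp2 {F : M → M → M} (h : Dfn fun e : ℕ → M => e 0 = F (e 1) (e 2))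
    {f g : (ℕ → M) → M} (hf : DfnF f) (hg : DfnF g) : DfnF fun e => F (f e) (g e) :=
  ⟨Dfn.comp3 (R := fun x y z => x = F y z) h (DfnF.var 0) (hf.reindex (· + 1))
    (hg.reindex (· + 1))⟩

theorem DfnF.comp3 {F : M → M → M → M} (h : Dfn fun e : ℕ → M => e 0 = F (e 1) (e 2) (e 3))
    {f g k : (ℕ → M) → M} (hf : DfnF f) (hg : DfnF g) (hk : DfnF k) :
    DfnF fun e => F (f e) (g e) (k e) :=
  ⟨Dfn.comp4 (R := fun x y z w => x = F y z w) h (DfnF.var 0) (hf.reindex (· + 1))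
    (hg.reindex (· + 1)) (hk.reindex (· + 1))⟩

theorem DfnF.comp4 {F : M → M → M → M → M}
    (h : Dfn fun e : ℕ → M => e 0 = F (e 1) (e 2) (e 3) (e 4))
    {f g k l : (ℕ → M) → M} (hf : DfnF f) (hg : DfnF g) (hk : DfnF k) (hl : DfnF l) :
    DfnF fun e => F (f e) (g e) (k e) (l e) :=
  ⟨Dfn.comp5 (R := fun x y z w u => x = F y z w u) h (DfnF.var 0) (hf.reindex (· + 1))
    (hg.reindex (· + 1)) (hk.reindex (· + 1)) (hl.reindex (· + 1))⟩

instance DfnF.ite {P : (ℕ → M) → Prop} {_ : ∀ e, Decidable (P e)} {f g : (ℕ → M) → M} [hP : Dfn P]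
    [hf : DfnF f] [hg : DfnF g] : DfnF fun e => if P e then f e else g e := by
  have h1 := hP.reindex (· + 1)
  have h2 := hf.out
  have h3 := hg.out
  refine ⟨Dfn.congr (P := fun e => ((P fun i => e (i + 1)) ∧ e 0 = f fun i => e (i + 1)) ∨
    (¬(P fun i => e (i + 1)) ∧ e 0 = g fun i => e (i + 1))) inferInstance fun e => ?_⟩
  split_ifs with h <;> simp [h]

/-- The axiom schemata speak of formulas without constants. The finitely many constants and outer
variables of a definition are therefore moved to variables from `n` on, whose values `p` are then
fixed. -/
theorem exists_params {P : (ℕ → M) → Prop} (h : Dfn P) (e₀ : ℕ → M) (n : ℕ) :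
    ∃ (φ : Fm) (p : ℕ → M), ∀ e : ℕ → M, (∀ i, e (i + n) = p i) →
      (φ.Realize e ↔ P fun i => if i < n then e i else e₀ i) := by
  classical
  obtain ⟨φ, hφ⟩ := h.out
  -- `q` numbers the finitely many free variables injectively, so that distinct parameters are sent
  -- to distinct variables.
  obtain ⟨q, hq⟩ : ∃ q : M ⊕ ℕ → ℕ, ∀ x ∈ φ.freeVarFinset, ∀ y ∈ φ.freeVarFinset,
      q x = q y → x = y := by
    refine ⟨fun x => if h : x ∈ φ.freeVarFinset then φ.freeVarFinset.equivFin ⟨x, h⟩ else 0,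
      fun x hx y hy hxy => ?_⟩
    simpa [hx, hy, Fin.val_inj] using hxy
  let val : M ⊕ ℕ → M := Sum.elim id e₀
  let r : M ⊕ ℕ → ℕ := fun x => match x with
    | Sum.inl m => q (Sum.inl m) + n
    | Sum.inr i => if i < n then i else q (Sum.inr i) + n
  refine ⟨φ.relabel r, fun i => if h : ∃ x ∈ φ.freeVarFinset, q x = i then val h.choose else e₀ 0,
    fun e he => ?_⟩
  have hval : ∀ x ∈ φ.freeVarFinset, e (q x + n) = val x := by
    intro x hx
    have hex : ∃ y ∈ φ.freeVarFinset, q y = q x := ⟨x, hx, rfl⟩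
    refine (he _).trans ((dif_pos hex).trans ?_)
    rw [hq _ hex.choose_spec.1 _ hx hex.choose_spec.2]
  rw [Formula.realize_relabel, ← hφ]
  have h1 := BoundedFormula.realize_restrictFreeVar' (φ := φ) (s := {i | i ∈ φ.freeVarFinset})
    (fun i hi => hi) (v := e ∘ r) (xs := default)
  have h2 := BoundedFormula.realize_restrictFreeVar' (φ := φ) (s := {i | i ∈ φ.freeVarFinset})
    (fun i hi => hi) (v := Sum.elim id fun i => if i < n then e i else e₀ i) (xs := default)
  unfold Formula.Realize
  rw [← h1, ← h2, iff_iff_eq]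
  congr 1
  funext ⟨x, hx⟩
  rcases x with m | i
  · exact hval _ hx
  · by_cases hi : i < n
    · simp [r, hi]
    · simp only [Function.comp, r, hi, if_false, Sum.elim_inr]
      exact hval _ hx

end Definability

/-! ### Models of Peano arithmetic -/

/-- Models of Peano arithmetic. -/
structure PAModel where
  /-- the domain -/
  carrier : Type
  [str : arith.Structure carrier]
  realize_of_mem : ∀ ψ ∈ PA, ∀ e : ℕ → carrier, ψ.Realize e

instance : CoeSort PAModel Type := ⟨PAModel.carrier⟩

attribute [instance] PAModel.str

theorem realize_ap {M : Type} [arith.Structure M] (φ : Fm) (l : List Tm) (e : ℕ → M) :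
    (ap φ l).Realize e ↔ φ.Realize fun i => (l.getD i (v i)).realize e :=
  BoundedFormula.realize_subst

section Realize

variable {M : PAModel}

instance : Zero M := ⟨Structure.funMap (L := arith) ArithFunc.zero ![]⟩
instance : Add M := ⟨fun x y => Structure.funMap (L := arith) ArithFunc.add ![x, y]⟩
instance : Mul M := ⟨fun x y => Structure.funMap (L := arith) ArithFunc.mul ![x, y]⟩

/-- The successor function of a model. -/
def sc (x : M) : M := Structure.funMap (L := arith) ArithFunc.succ ![x]

instance : One M := ⟨sc 0⟩

theorem realize_v (i : ℕ) (e : ℕ → M) : (v i).realize e = e i := rfl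

theorem realize_O (e : ℕ → M) : O.realize e = (0 : M) :=
  congrArg (Structure.funMap (L := arith) (n := 0) ArithFunc.zero) (Subsingleton.elim _ _)

theorem realize_sc (t : Tm) (e : ℕ → M) : (S t).realize e = sc (t.realize e) :=
  congrArg (Structure.funMap (L := arith) (n := 1) ArithFunc.succ)
    (funext fun i => by fin_cases i; rfl)

theorem realize_plus (s t : Tm) (e : ℕ → M) :
    (plus s t).realize e = s.realize e + t.realize e :=
  congrArg (Structure.funMap (L := arith) (n := 2) ArithFunc.add)
    (funext fun i => by fin_cases i <;> rfl)

theorem realize_times (s t : Tm) (e : ℕ → M) :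
    (times s t).realize e = s.realize e * t.realize e :=
  congrArg (Structure.funMap (L := arith) (n := 2) ArithFunc.mul)
    (funext fun i => by fin_cases i <;> rfl)

theorem realize_eqF (s t : Tm) (e : ℕ → M) : (eqF s t).Realize e ↔ s.realize e = t.realize e :=
  Formula.realize_equal

theorem dfn_term (t : arith.Term (M ⊕ ℕ)) : DfnF fun e : ℕ → M => t.realize (Sum.elim id e) := by
  refine ⟨⟨Term.equal (Term.var (Sum.inr 0)) (t.relabel (Sum.map id (· + 1))), fun e => ?_⟩⟩
  rw [Formula.realize_equal, Term.realize_relabel, Term.realize_var, Sum.elim_inr, iff_iff_eq]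
  congr 2
  funext i
  rcases i with i | i <;> rfl

instance {f : (ℕ → M) → M} [hf : DfnF f] : DfnF fun e => sc (f e) :=
  DfnF.comp1 (F := sc) ((dfn_term (Term.func (L := arith) ArithFunc.succ
    ![Term.var (Sum.inr 0)])).out.congr fun e => by
      rw [iff_iff_eq]
      refine congrArg (e 0 = ·) (congrArg (Structure.funMap (L := arith) (n := 1) ArithFunc.succ) ?_)
      funext i
      fin_cases i
      rfl) hf

instance {f g : (ℕ → M) → M} [hf : DfnF f] [hg : DfnF g] : DfnF fun e => f e + g e :=
  DfnF.comp2 (F := fun x y => x + y) ((dfn_term (Term.func (L := arith) ArithFunc.add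
    ![Term.var (Sum.inr 0), Term.var (Sum.inr 1)])).out.congr fun e => by
      rw [iff_iff_eq]
      refine congrArg (e 0 = ·) (congrArg (Structure.funMap (L := arith) (n := 2) ArithFunc.add) ?_)
      funext i
      fin_cases i <;> rfl) hf hg

instance {f g : (ℕ → M) → M} [hf : DfnF f] [hg : DfnF g] : DfnF fun e => f e * g e :=
  DfnF.comp2 (F := fun x y => x * y) ((dfn_term (Term.func (L := arith) ArithFunc.mul
    ![Term.var (Sum.inr 0), Term.var (Sum.inr 1)])).out.congr fun e => by
      rw [iff_iff_eq]
      refine congrArg (e 0 = ·) (congrArg (Structure.funMap (L := arith) (n := 2) ArithFunc.mul) ?_)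
      funext i
      fin_cases i <;> rfl) hf hg

theorem sc_ne_zero (x : M) : sc x ≠ 0 := by
  have := M.realize_of_mem ((eqF (S (v 0)) O).imp ⊥) (by simp [PA]) fun _ => x
  rw [Formula.realize_imp, realize_eqF, realize_sc, realize_O] at this
  exact this

theorem sc_injective {x y : M} (h : sc x = sc y) : x = y := by
  have := M.realize_of_mem ((eqF (S (v 0)) (S (v 1))).imp (eqF (v 0) (v 1))) (by simp [PA])
    fun i => if i = 0 then x else y
  rw [Formula.realize_imp, realize_eqF, realize_eqF, realize_sc, realize_sc] at this
  exact this h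

theorem add_zero' (x : M) : x + 0 = x := by
  have := M.realize_of_mem (eqF (plus (v 0) O) (v 0)) (by simp [PA]) fun _ => x
  rw [realize_eqF, realize_plus, realize_O] at this
  exact this

theorem add_sc (x y : M) : x + sc y = sc (x + y) := by
  have := M.realize_of_mem (eqF (plus (v 0) (S (v 1))) (S (plus (v 0) (v 1)))) (by simp [PA])
    fun i => if i = 0 then x else y
  rw [realize_eqF, realize_plus, realize_sc, realize_sc, realize_plus] at this
  exact this

theorem mul_zero' (x : M) : x * 0 = 0 := by
  have := M.realize_of_mem (eqF (times (v 0) O) O) (by simp [PA]) fun _ => x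
  rw [realize_eqF, realize_times, realize_O] at this
  exact this

theorem mul_sc (x y : M) : x * sc y = x * y + x := by
  have := M.realize_of_mem (eqF (times (v 0) (S (v 1))) (plus (times (v 0) (v 1)) (v 0)))
    (by simp [PA]) fun i => if i = 0 then x else y
  rw [realize_eqF, realize_times, realize_sc, realize_plus, realize_times] at this
  exact this

/-- The induction schema, with parameters from the model. As `M` need not be well-founded, this is
the source of all inductions over its elements, and it is restricted to definable predicates. -/
theorem sc_induction (P : M → Prop) [hP : Dfn fun e : ℕ → M => P (e 0)] (h0 : P 0)
    (hs : ∀ x, P x → P (sc x)) (x : M) : P x := by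
  obtain ⟨φ, p, hp⟩ := exists_params hP (fun _ => 0) 1
  have := M.realize_of_mem (inductionF φ) (Or.inr ⟨φ, rfl⟩) fun i => Nat.casesOn i 0 p
  simp only [inductionF, Formula.realize_imp, realize_ap, realize_all] at this
  have e1 : ∀ y : M, φ.Realize (Function.update (fun i => Nat.casesOn i 0 p : ℕ → M) 0 y) ↔ P y :=
    fun y => (hp _ fun i => by simp).trans (by simp)
  simp only [e1] at this
  refine this ?_ (fun y hy => ?_) x
  · refine (hp _ fun i => rfl).2 ?_
    simpa [realize_O] using h0
  · refine (hp _ fun i => ?_).2 ?_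
    · simp [realize_v]
    · simpa [realize_sc, realize_v] using hs y hy

theorem sc_eq (x : M) : sc x = x + 1 := by
  rw [show (1 : M) = sc 0 from rfl, add_sc, add_zero']

theorem induction (P : M → Prop) [hP : Dfn fun e : ℕ → M => P (e 0)] (h0 : P 0)
    (hs : ∀ x, P x → P (x + 1)) (x : M) : P x :=
  sc_induction P h0 (fun x hx => sc_eq x ▸ hs x hx) x

theorem add_assoc' (x y z : M) : x + y + z = x + (y + z) :=
  sc_induction (fun z => x + y + z = x + (y + z)) (by simp [add_zero'])
    (fun z h => by simp [add_sc, h]) z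

theorem zero_add' (x : M) : 0 + x = x :=
  sc_induction (fun x => 0 + x = x) (by simp [add_zero']) (fun z h => by simp [add_sc, h]) x

theorem sc_add (x y : M) : sc x + y = sc (x + y) :=
  sc_induction (fun y => sc x + y = sc (x + y)) (by simp [add_zero'])
    (fun z h => by simp [add_sc, h]) y

theorem add_comm' (x y : M) : x + y = y + x :=
  sc_induction (fun y => x + y = y + x) (by simp [add_zero', zero_add'])
    (fun z h => by simp [add_sc, sc_add, h]) y

instance : AddCommMonoid M where
  add_assoc := add_assoc'
  zero_add := zero_add'
  add_zero := add_zero'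
  add_comm := add_comm'
  nsmul := nsmulRec

theorem mul_add' (x y z : M) : x * (y + z) = x * y + x * z :=
  sc_induction (fun z => x * (y + z) = x * y + x * z) (by simp [mul_zero'])
    (fun z h => by simp [add_sc, mul_sc, h, add_assoc]) z

theorem mul_assoc' (x y z : M) : x * y * z = x * (y * z) :=
  sc_induction (fun z => x * y * z = x * (y * z)) (by simp [mul_zero'])
    (fun z h => by simp [mul_sc, mul_add', h]) z

theorem zero_mul' (x : M) : 0 * x = 0 :=
  sc_induction (fun x => 0 * x = 0) (by simp [mul_zero']) (fun z h => by simp [mul_sc, h]) x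

theorem sc_mul (x y : M) : sc x * y = x * y + y :=
  sc_induction (fun y => sc x * y = x * y + y) (by simp [mul_zero'])
    (fun z h => by simp only [add_sc, mul_sc, h]; rw [add_assoc, add_assoc, add_comm x z]) y

theorem mul_comm' (x y : M) : x * y = y * x :=
  sc_induction (fun y => x * y = y * x) (by simp [mul_zero', zero_mul'])
    (fun z h => by simp [mul_sc, sc_mul, h]) y

theorem mul_one' (x : M) : x * 1 = x := by
  rw [show (1 : M) = sc 0 from rfl, mul_sc, mul_zero', zero_add]

instance : CommSemiring M where
  mul_assoc := mul_assoc'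
  mul_comm := mul_comm'
  one_mul x := by rw [mul_comm', mul_one']
  mul_one := mul_one'
  zero_mul := zero_mul'
  mul_zero := mul_zero'
  left_distrib := mul_add'
  right_distrib x y z := by rw [mul_comm', mul_add', mul_comm', mul_comm' z]

theorem add_right_cancel' {x y z : M} (h : x + z = y + z) : x = y :=
  sc_induction (fun z => x + z = y + z → x = y) (by simp)
    (fun z h h' => h (sc_injective (by simpa [add_sc] using h'))) z h

instance : IsCancelAdd M where
  add_left_cancel x y z h := add_right_cancel' (z := x) (by rw [add_comm y, add_comm z]; exact h)
  add_right_cancel x y z h := add_right_cancel' (z := x) h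

theorem add_one_ne_zero (x : M) : x + 1 ≠ 0 := sc_eq x ▸ sc_ne_zero x

theorem eq_zero_or_succ (x : M) : x = 0 ∨ ∃ y, x = y + 1 :=
  induction (fun x => x = 0 ∨ ∃ y, x = y + 1) (Or.inl rfl) (fun x _ => Or.inr ⟨x, rfl⟩) x

theorem eq_zero_of_add {x y : M} (h : x + y = 0) : x = 0 := by
  rcases eq_zero_or_succ x with h' | ⟨z, rfl⟩
  · exact h'
  · exact (add_one_ne_zero (z + y) (by rw [← h]; ring)).elim

theorem total' (x y : M) : (∃ z, x + z = y) ∨ ∃ z, y + z = x := by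
  refine induction (fun x => (∃ z, x + z = y) ∨ ∃ z, y + z = x) (Or.inl ⟨y, zero_add y⟩)
    (fun x ih => ?_) x
  rcases ih with ⟨z, rfl⟩ | ⟨z, rfl⟩
  · rcases eq_zero_or_succ z with rfl | ⟨z, rfl⟩
    · exact Or.inr ⟨1, by ring⟩
    · exact Or.inl ⟨z, by ring⟩
  · exact Or.inr ⟨z + 1, by ring⟩

noncomputable instance : LinearOrder M where
  le x y := ∃ z, x + z = y
  le_refl x := ⟨0, add_zero x⟩
  le_trans := by
    rintro x _ _ ⟨z, rfl⟩ ⟨w, rfl⟩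
    exact ⟨z + w, by ring⟩
  le_antisymm := by
    rintro x _ ⟨z, rfl⟩ ⟨w, h⟩
    have : z + w = 0 := by
      rw [add_assoc] at h
      exact add_eq_left.1 h
    rw [eq_zero_of_add this, add_zero]
  le_total := total'
  toDecidableLE := Classical.decRel _

theorem le_iff {x y : M} : x ≤ y ↔ ∃ z, x + z = y := Iff.rfl

instance : IsOrderedRing M where
  zero_le_one := ⟨1, zero_add 1⟩
  add_le_add_left := by
    rintro x _ ⟨z, rfl⟩ y
    exact ⟨z, by ring⟩
  mul_le_mul_of_nonneg_left := by
    rintro x _ y z ⟨w, rfl⟩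
    exact ⟨x * w, by ring⟩
  mul_le_mul_of_nonneg_right := by
    rintro x _ y z ⟨w, rfl⟩
    exact ⟨w * x, by ring⟩

instance : CanonicallyOrderedAdd M where
  exists_add_of_le := by
    rintro x _ ⟨z, rfl⟩
    exact ⟨z, rfl⟩
  le_add_self x y := ⟨y, add_comm x y⟩
  le_self_add x y := ⟨y, rfl⟩

instance : Nontrivial M := ⟨⟨0, 1, fun h => add_one_ne_zero 0 (by rw [zero_add, h])⟩⟩

theorem add_one_le_of_lt' {x y : M} (h : x < y) : x + 1 ≤ y := by
  obtain ⟨z, rfl⟩ := h.le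
  rcases eq_zero_or_succ z with rfl | ⟨z, rfl⟩
  · simp at h
  · exact ⟨z, by ring⟩

theorem lt_add_one' (x : M) : x < x + 1 :=
  lt_of_le_of_ne ⟨1, rfl⟩ fun h => one_ne_zero (left_eq_add.1 h)

instance : IsStrictOrderedRing M where
  le_of_add_le_add_left x y z h := by
    obtain ⟨w, h⟩ := h
    exact ⟨w, add_left_cancel (a := x) (by rw [← h]; ring)⟩
  mul_lt_mul_of_pos_left := by
    intro x hx y z hyz
    obtain ⟨w, rfl⟩ := add_one_le_of_lt' hyz
    refine lt_of_le_of_ne ⟨x * (w + 1), by ring⟩ fun h => ?_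
    have h2 : x + x * w = 0 := by
      have : x * y + (x + x * w) = x * y + 0 := by
        rw [add_zero]
        refine Eq.trans ?_ h.symm
        ring
      exact add_left_cancel this
    exact hx.ne' (eq_zero_of_add h2)
  mul_lt_mul_of_pos_right := by
    intro x hx y z hyz
    obtain ⟨w, rfl⟩ := add_one_le_of_lt' hyz
    refine lt_of_le_of_ne ⟨x * (w + 1), by ring⟩ fun h => ?_
    have h2 : x + x * w = 0 := by
      have : y * x + (x + x * w) = y * x + 0 := by
        rw [add_zero]
        refine Eq.trans ?_ h.symm
        ring
      exact add_left_cancel this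
    exact hx.ne' (eq_zero_of_add h2)

noncomputable instance : SuccOrder M :=
  SuccOrder.ofSuccLeIff (fun x => x + 1)
    fun {x _} => ⟨(lt_add_one' x).trans_le, add_one_le_of_lt'⟩

noncomputable instance : SuccAddOrder M := ⟨fun _ => rfl⟩

instance : NoMaxOrder M := ⟨fun x => ⟨x + 1, lt_add_one' x⟩⟩

instance {f g : (ℕ → M) → M} [hf : DfnF f] [hg : DfnF g] : Dfn fun e => f e ≤ g e :=
  Dfn.comp2 (R := fun x y => x ≤ y)
    (Dfn.congr (P := fun e => ∃ z, e 0 + z = e 1) inferInstance fun _ => Iff.rfl) hf hg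

instance {f g : (ℕ → M) → M} [hf : DfnF f] [hg : DfnF g] : Dfn fun e => f e < g e :=
  Dfn.congr (P := fun e => ¬g e ≤ f e) inferInstance fun _ => not_le

theorem strong_induction (P : M → Prop) [Dfn fun e : ℕ → M => P (e 0)]
    (h : ∀ x, (∀ y < x, P y) → P x) (x : M) : P x := by
  refine h x (induction (fun x => ∀ y < x, P y) (fun y hy => (not_lt_zero hy).elim)
    (fun x ih y hy => ?_) x)
  rcases (Order.lt_add_one_iff.1 hy).lt_or_eq with hy | rfl
  · exact ih y hy
  · exact h y ih

end Realize

/-! ### Finite sets and inductive definitions in models of arithmetic -/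

section Coding

variable {M : PAModel}

/-- The pairing of a model. -/
def pr (x y : M) : M := (x + y) * (x + y) + x

instance {f g : (ℕ → M) → M} [DfnF f] [DfnF g] : DfnF fun e => pr (f e) (g e) := by
  unfold pr
  infer_instance

/-- A remainder `x ≤ a` keeps `a² + x` below `(a + 1)²`, so the square can be recovered. This is why
the pairing is injective. -/
theorem sq_add_inj {a b x y : M} (hx : x ≤ a) (hy : y ≤ b) (h : a * a + x = b * b + y) :
    a = b := by
  have key : ∀ {a b x y : M}, x ≤ a → a < b → a * a + x < b * b + y := by
    intro a b x y hx hab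
    obtain ⟨z, rfl⟩ := le_iff.1 (Order.add_one_le_iff.2 hab)
    calc a * a + x ≤ a * a + a := by gcongr
      _ < a * a + a + 1 := Order.lt_add_one_iff.2 le_rfl
      _ ≤ a * a + a + 1 + (a + 2 * a * z + 2 * z + z * z + y) := le_self_add
      _ = (a + 1 + z) * (a + 1 + z) + y := by ring
  rcases lt_trichotomy a b with hab | hab | hab
  · exact ((key hx hab).ne h).elim
  · exact hab
  · exact ((key hy hab).ne h.symm).elim

@[simp]
theorem pr_inj {x y x' y' : M} : pr x y = pr x' y' ↔ x = x' ∧ y = y' := by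
  refine ⟨fun h => ?_, fun h => by rw [h.1, h.2]⟩
  have h1 := sq_add_inj le_self_add le_self_add h
  have h2 : x = x' := by
    unfold pr at h
    rw [h1] at h
    exact add_left_cancel h
  subst h2
  exact ⟨rfl, add_left_cancel h1⟩

instance {f g : (ℕ → M) → M} [DfnF f] [DfnF g] : Dfn fun e => f e ∣ g e :=
  Dfn.congr (P := fun e => ∃ z, g e = f e * z) (Dfn.comp2 (R := fun x y => ∃ z, y = x * z)
    inferInstance inferInstance inferInstance) fun _ => Iff.rfl

/-- A substitute for `x = a * (t - K)` in a semiring without subtraction. -/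
theorem dvd_of_add_mul {a x K t : M} (h : x + a * K = a * t) : a ∣ x := by
  rcases eq_or_ne a 0 with rfl | ha
  · simp only [zero_mul, add_zero] at h
    exact ⟨0, by simp [h]⟩
  · have h1 : K ≤ t := by
      by_contra! hlt
      have := mul_lt_mul_of_pos_left hlt (pos_iff_ne_zero.2 ha)
      rw [← h] at this
      exact (le_add_self.trans_lt this).false
    obtain ⟨s, rfl⟩ := le_iff.1 h1
    refine ⟨s, add_right_cancel (b := a * K) ?_⟩
    rw [h]
    ring

/-- The moduli `1 + (x + 1) * d` are pairwise coprime. -/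
theorem modulus_coprime {x j e c : M} :
    ((x + 1) * (j * e) + 1 ∣ c * ((x + j + 1) * (j * e) + 1) → (x + 1) * (j * e) + 1 ∣ c) ∧
    ((x + j + 1) * (j * e) + 1 ∣ c * ((x + 1) * (j * e) + 1) →
      (x + j + 1) * (j * e) + 1 ∣ c) := by
  constructor
  · rintro ⟨t, ht⟩
    -- Here `d = j * e`. Modulo `(x + 1) * d + 1` the other modulus has the inverse `(x + 1)² * e`;
    -- in the second half the inverse is `-(x + j + 1)² * e`. Negative terms have been moved to the
    -- other side.
    refine dvd_of_add_mul (K := (x + 1) * e * (x + j + 1) * c) (t := (x + 1) * (x + 1) * e * t + c) ?_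
    calc _ = (x + 1) * (x + 1) * e * (c * ((x + j + 1) * (j * e) + 1)) +
          ((x + 1) * (j * e) + 1) * c := by ring
      _ = _ := by rw [ht]; ring
  · rintro ⟨t, ht⟩
    refine dvd_of_add_mul (K := e * (x + j + 1) * (x + j + 1) * t)
      (t := e * (x + 1) * (x + j + 1) * c + c) ?_
    calc _ = c + e * (x + j + 1) * (x + j + 1) * (((x + j + 1) * (j * e) + 1) * t) := by ring
      _ = _ := by rw [← ht]; ring

/-- Plays the role of `N!`: each difference `j` of two indices up to `N` divides `d`, as the
coprimality of the moduli requires. -/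
theorem exists_common_multiple (N : M) : ∃ d, 0 < d ∧ ∀ i, 0 < i → i ≤ N → i ∣ d := by
  refine induction (fun N => ∃ d, 0 < d ∧ ∀ i, 0 < i → i ≤ N → i ∣ d)
    ⟨1, zero_lt_one, fun i h h' => (h.not_ge h').elim⟩ (fun N ih => ?_) N
  obtain ⟨d, hd, h⟩ := ih
  refine ⟨d * (N + 1), mul_pos hd (Order.lt_add_one_iff.2 zero_le), fun i hi hiN => ?_⟩
  rcases hiN.lt_or_eq with h' | rfl
  · exact (h i hi (Order.lt_add_one_iff.1 h')).mul_right _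
  · exact dvd_mul_left _ _

/-- `x` belongs to the finite set coded by `c, d, N`. -/
def Mem (x c d N : M) : Prop := x < N ∧ ∃ y, ((x + 1) * d + 1) * y = c

instance {f g h k : (ℕ → M) → M} [hf : DfnF f] [hg : DfnF g] [hh : DfnF h] [hk : DfnF k] :
    Dfn fun e => Mem (f e) (g e) (h e) (k e) :=
  Dfn.comp4 (by unfold Mem; infer_instance) hf hg hh hk

theorem mem_iff {x c d N : M} : Mem x c d N ↔ x < N ∧ (x + 1) * d + 1 ∣ c :=
  and_congr_right fun _ => ⟨fun ⟨y, h⟩ => ⟨y, h.symm⟩, fun ⟨y, h⟩ => ⟨y, h.symm⟩⟩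

/-- Every bounded definable set has a code. -/
theorem comprehension (P : M → Prop) [Dfn fun e : ℕ → M => P (e 0)] (N : M) :
    ∃ c d, ∀ x, Mem x c d N ↔ x < N ∧ P x := by
  obtain ⟨d, hd, h⟩ := exists_common_multiple N
  have key : ∀ n, n ≤ N → ∃ c, ∀ x < N, (x + 1) * d + 1 ∣ c ↔ x < n ∧ P x := by
    refine induction (fun n => n ≤ N → ∃ c, ∀ x < N, (x + 1) * d + 1 ∣ c ↔ x < n ∧ P x) ?_ ?_
    · refine fun _ => ⟨1, fun x _ => iff_of_false ?_ (by simp)⟩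
      rintro ⟨t, ht⟩
      have h1 : 0 < (x + 1) * d := mul_pos (Order.lt_add_one_iff.2 zero_le) hd
      rcases eq_zero_or_succ t with rfl | ⟨t, rfl⟩
      · simp at ht
      · have : 0 + 1 = ((x + 1) * d + (((x + 1) * d + 1) * t)) + 1 := by
          rw [zero_add]
          refine ht.trans ?_
          ring
        exact h1.ne' (eq_zero_of_add (add_right_cancel this).symm)
    · intro n ih hn
      obtain ⟨c, hc⟩ := ih ((Order.lt_add_one_iff.2 le_rfl).le.trans hn)
      have hnN : n < N := Order.add_one_le_iff.1 hn
      by_cases hP : P n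
      -- Multiplying the code by the modulus of `n` adds `n` to the set; by coprimality the
      -- membership of every other index is unaffected.
      · refine ⟨c * ((n + 1) * d + 1), fun x hx => ?_⟩
        rcases lt_trichotomy x n with hxn | rfl | hxn
        · obtain ⟨j, rfl⟩ := le_iff.1 hxn.le
          obtain ⟨e, rfl⟩ := h j (by simpa using hxn) (le_add_self.trans hnN.le)
          refine (Iff.trans ⟨modulus_coprime.1, fun h => h.mul_right _⟩ (hc x hx)).trans ?_
          simp [hxn, hxn.trans (lt_add_one' _)]
        · exact iff_of_true (dvd_mul_left _ _) ⟨lt_add_one' _, hP⟩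
        · obtain ⟨j, rfl⟩ := le_iff.1 hxn.le
          obtain ⟨e, rfl⟩ := h j (by simpa using hxn) (le_add_self.trans hx.le)
          refine (Iff.trans ⟨modulus_coprime.2, fun h => h.mul_right _⟩ (hc _ hx)).trans ?_
          exact iff_of_false (fun h => hxn.not_gt h.1)
            fun h => (Order.lt_add_one_iff.1 h.1).not_gt hxn
      · refine ⟨c, fun x hx => (hc x hx).trans ?_⟩
        rw [Order.lt_add_one_iff]
        exact ⟨fun h => ⟨h.1.le, h.2⟩, fun h => ⟨h.1.lt_of_ne fun e => hP (e ▸ h.2), h.2⟩⟩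
  obtain ⟨c, hc⟩ := key N le_rfl
  refine ⟨c, d, fun x => ?_⟩
  rw [mem_iff]
  exact ⟨fun h => ⟨h.1, ((hc x h.1).1 h.2).2⟩, fun h => ⟨h.1, (hc x h.1).2 h⟩⟩

/-- The predicate that is defined inductively by the clauses `F`: its elements belong to a finite
set in which each element follows from elements of the set. -/
def IndPred (F : (M → Prop) → M → Prop) (x : M) : Prop :=
  ∃ c d N, Mem x c d N ∧ ∀ y, Mem y c d N → F (fun z => Mem z c d N) y

/-- Each element follows from finitely many elements. -/
def Finitary (F : (M → Prop) → M → Prop) : Prop :=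
  ∀ K x, F K x → ∃ l : List M, (∀ y ∈ l, K y) ∧ ∀ K' : M → Prop, (∀ y ∈ l, K' y) → F K' x

theorem Finitary.mono {F : (M → Prop) → M → Prop} (hF : Finitary F) {K K' : M → Prop}
    (h : ∀ y, K y → K' y) {x : M} (hx : F K x) : F K' x := by
  obtain ⟨l, hl, hl'⟩ := hF K x hx
  exact hl' K' fun y hy => h y (hl y hy)

/-- The finite set that justifies `x` also justifies each of its other elements. -/
theorem IndPred.unfold {F : (M → Prop) → M → Prop} (hF : Finitary F) {x : M}
    (h : IndPred F x) : F (IndPred F) x := by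
  obtain ⟨c, d, N, h1, h2⟩ := h
  exact hF.mono (fun y hy => ⟨c, d, N, hy, h2⟩) (h2 x h1)

/-- The premises of the last clause form a genuinely finite list. The union of the coded sets that
justify them is again closed under justification, and `x` can be added to it. -/
theorem IndPred.fold {F : (M → Prop) → M → Prop} (hF : Finitary F) {x : M}
    (h : F (IndPred F) x) : IndPred F x := by
  obtain ⟨l, hl, hl'⟩ := hF _ x h
  have key : ∃ c d N, (∀ y ∈ l, Mem y c d N) ∧ ∀ y, Mem y c d N → F (fun z => Mem z c d N) y := by
    clear hl'
    induction l with
    | nil => exact ⟨0, 0, 0, by simp, fun y hy => (not_lt_zero hy.1).elim⟩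
    | cons x l ih =>
      obtain ⟨c, d, N, h1, h2⟩ := ih fun y hy => hl y (List.mem_cons_of_mem _ hy)
      obtain ⟨c', d', N', h3, h4⟩ := hl x List.mem_cons_self
      obtain ⟨a, b, h5⟩ := comprehension (fun y => Mem y c d N ∨ Mem y c' d' N') (max N N')
      have h6 : ∀ y, Mem y a b (max N N') ↔ Mem y c d N ∨ Mem y c' d' N' := fun y =>
        (h5 y).trans (and_iff_right_of_imp fun h => h.elim (fun h => h.1.trans_le (le_max_left _ _))
          fun h => h.1.trans_le (le_max_right _ _))
      refine ⟨a, b, max N N', fun y hy => (h6 y).2 ?_, fun y hy => ?_⟩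
      · rcases List.mem_cons.1 hy with rfl | hy
        · exact Or.inr h3
        · exact Or.inl (h1 y hy)
      · rcases (h6 y).1 hy with hy | hy
        · exact hF.mono (fun z hz => (h6 z).2 (Or.inl hz)) (h2 y hy)
        · exact hF.mono (fun z hz => (h6 z).2 (Or.inr hz)) (h4 y hy)
  obtain ⟨c, d, N, h1, h2⟩ := key
  obtain ⟨a, b, h5⟩ := comprehension (fun y => Mem y c d N ∨ y = x) (max N (x + 1))
  have h6 : ∀ y, Mem y a b (max N (x + 1)) ↔ Mem y c d N ∨ y = x := fun y =>
    (h5 y).trans (and_iff_right_of_imp fun h => h.elim (fun h => h.1.trans_le (le_max_left _ _))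
      fun h => (h ▸ lt_add_one' x : y < x + 1).trans_le (le_max_right _ _))
  refine ⟨a, b, max N (x + 1), (h6 x).2 (Or.inr rfl), fun y hy => ?_⟩
  rcases (h6 y).1 hy with hy | rfl
  · exact hF.mono (fun z hz => (h6 z).2 (Or.inl hz)) (h2 y hy)
  · exact hl' _ fun z hz => (h6 z).2 (Or.inl (h1 z hz))

/-- Only this fixed-point equation is used. That the recursively defined functions are single-valued
follows by induction on their arguments, not from leastness of the predicate. -/
theorem IndPred.iff {F : (M → Prop) → M → Prop} (hF : Finitary F) {x : M} :
    IndPred F x ↔ F (IndPred F) x :=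
  ⟨IndPred.unfold hF, IndPred.fold hF⟩

/-! ### Realizations of the formulas -/

theorem realize_S (t : Tm) (e : ℕ → M) : (S t).realize e = t.realize e + 1 := by
  rw [realize_sc, sc_eq]

theorem realize_pair (s t : Tm) (e : ℕ → M) :
    (pair s t).realize e = pr (s.realize e) (t.realize e) := by
  simp only [pair, realize_plus, realize_times, pr]

theorem realize_ltF (s t : Tm) (e : ℕ → M) :
    (ltF s t).Realize e ↔ s.realize e < t.realize e := by
  simp only [ltF, realize_ap, realize_ex, realize_eqF, realize_plus, realize_S, realize_v]
  rw [← Order.add_one_le_iff, le_iff]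
  refine exists_congr fun z => ?_
  rw [iff_iff_eq]
  congr 1
  rw [add_assoc, add_comm 1 z]
  rfl

theorem realize_leF (s t : Tm) (e : ℕ → M) :
    (leF s t).Realize e ↔ s.realize e ≤ t.realize e := by
  simp only [leF, realize_ap, realize_ex, realize_eqF, realize_plus, realize_v]
  exact Iff.rfl

theorem realize_memF (x c d N : Tm) (e : ℕ → M) : (memF x c d N).Realize e ↔
    Mem (x.realize e) (c.realize e) (d.realize e) (N.realize e) := by
  simp only [memF, realize_ap, Formula.realize_inf, realize_ltF, realize_ex, realize_eqF,
    realize_times, realize_S, realize_v]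
  exact Iff.rfl

theorem realize_known (x : Tm) (e : ℕ → M) :
    (known x).Realize e ↔ Mem (x.realize e) (e 1) (e 2) (e 3) :=
  realize_memF _ _ _ _ _

/-- The variables `0, …, 3` are bound again by the formula, so the clauses only need to be evaluated
at assignments with the given parameters from `4` on. -/
theorem realize_inductiveF (Φ : Fm) (F : (M → Prop) → M → Prop) (e : ℕ → M)
    (h : ∀ e' : ℕ → M, (∀ i, e' (i + 4) = e (i + 4)) →
      (Φ.Realize e' ↔ F (fun z => Mem z (e' 1) (e' 2) (e' 3)) (e' 0))) :
    (inductiveF Φ).Realize e ↔ IndPred F (e 0) := by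
  simp only [inductiveF, exs, List.foldr, realize_ex, Formula.realize_inf, realize_known,
    realize_all, Formula.realize_imp]
  refine exists_congr fun c => exists_congr fun d => exists_congr fun N => and_congr Iff.rfl ?_
  refine forall_congr' fun y => imp_congr Iff.rfl ?_
  exact h _ fun i => by simp

end Coding

/-! ### The Ackermann function of a model -/

section Ackermann

variable {M : PAModel}

/-- The clauses for the Ackermann function. -/
def AckStep (k : M) (K : M → Prop) (x : M) : Prop :=
  x = pr 0 (pr 0 (pr 0 1)) ∨
  (∃ b c, x = pr 0 (pr 0 (pr (b + 1) (c * k))) ∧ K (pr 0 (pr 0 (pr b c)))) ∨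
  (∃ a c, x = pr 0 (pr (a + 1) (pr 0 c)) ∧ K (pr 1 (pr a (pr k (pr 0 c))))) ∨
  (∃ a b c d, x = pr 0 (pr (a + 1) (pr (b + 1) d)) ∧ K (pr 0 (pr (a + 1) (pr b c))) ∧
    K (pr 1 (pr a (pr k (pr c d))))) ∨
  (∃ a u, x = pr 1 (pr a (pr 0 (pr u u)))) ∨
  ∃ a i u w z, x = pr 1 (pr a (pr (i + 1) (pr u z))) ∧ K (pr 1 (pr a (pr i (pr u w)))) ∧
    K (pr 0 (pr a (pr w z)))

theorem ackStep_finitary (k : M) : Finitary (AckStep k) := by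
  rintro K x (h | ⟨b, c, h, h1⟩ | ⟨a, c, h, h1⟩ | ⟨a, b, c, d, h, h1, h2⟩ | ⟨a, u, h⟩ |
    ⟨a, i, u, w, z, h, h1, h2⟩)
  · exact ⟨[], by simp, fun K' _ => Or.inl h⟩
  · exact ⟨[_], by simpa using h1, fun K' hK => Or.inr (Or.inl ⟨b, c, h, hK _ (by simp)⟩)⟩
  · exact ⟨[_], by simpa using h1, fun K' hK => Or.inr (Or.inr (Or.inl ⟨a, c, h, hK _ (by simp)⟩))⟩
  · exact ⟨[_, _], by simpa using ⟨h1, h2⟩, fun K' hK => Or.inr (Or.inr (Or.inr (Or.inl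
      ⟨a, b, c, d, h, hK _ List.mem_cons_self, hK _ (by simp)⟩)))⟩
  · exact ⟨[], by simp, fun K' _ => Or.inr (Or.inr (Or.inr (Or.inr (Or.inl ⟨a, u, h⟩))))⟩
  · exact ⟨[_, _], by simpa using ⟨h1, h2⟩, fun K' hK => Or.inr (Or.inr (Or.inr (Or.inr (Or.inr
      ⟨a, i, u, w, z, h, hK _ List.mem_cons_self, hK _ (by simp)⟩))))⟩

/-- The graph of the Ackermann function. -/
def AckR (k a b c : M) : Prop := IndPred (AckStep k) (pr 0 (pr a (pr b c)))

/-- The graph of the iterations of the Ackermann function. -/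
def IterR (k a i x y : M) : Prop := IndPred (AckStep k) (pr 1 (pr a (pr i (pr x y))))

set_option synthInstance.maxSize 2000 in
set_option synthInstance.maxHeartbeats 400000 in
instance indPred_ackStep_dfn {f g : (ℕ → M) → M} [hf : DfnF f] [hg : DfnF g] :
    Dfn fun e => IndPred (AckStep (f e)) (g e) :=
  Dfn.comp2 (R := fun k x => IndPred (AckStep k) x)
    (by unfold IndPred AckStep; beta_reduce; infer_instance) hf hg

instance {f g h k : (ℕ → M) → M} [DfnF f] [DfnF g] [DfnF h] [DfnF k] :
    Dfn fun e => AckR (f e) (g e) (h e) (k e) := by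
  unfold AckR
  infer_instance

instance {f g h k l : (ℕ → M) → M} [DfnF f] [DfnF g] [DfnF h] [DfnF k] [DfnF l] :
    Dfn fun e => IterR (f e) (g e) (h e) (k e) (l e) := by
  unfold IterR
  infer_instance

theorem ackR_zero_zero {k c : M} : AckR k 0 0 c ↔ c = 1 := by
  unfold AckR
  rw [IndPred.iff (ackStep_finitary k)]
  simp only [AckStep, pr_inj, true_and, (add_one_ne_zero _).symm, false_and, zero_ne_one,
    exists_false, or_false]

theorem ackR_zero_succ {k b c : M} : AckR k 0 (b + 1) c ↔ ∃ c', c = c' * k ∧ AckR k 0 b c' := by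
  unfold AckR
  rw [IndPred.iff (ackStep_finitary k)]
  simp only [AckStep, pr_inj, true_and, add_left_inj, add_one_ne_zero, (add_one_ne_zero _).symm,
    false_and, zero_ne_one, exists_false, false_or, or_false]
  exact ⟨fun ⟨_, c, ⟨rfl, h⟩, h'⟩ => ⟨c, h, h'⟩, fun ⟨c, h, h'⟩ => ⟨b, c, ⟨rfl, h⟩, h'⟩⟩

theorem ackR_succ_zero {k a c : M} : AckR k (a + 1) 0 c ↔ IterR k a k 0 c := by
  unfold AckR IterR
  rw [IndPred.iff (ackStep_finitary k)]
  simp only [AckStep, pr_inj, true_and, add_left_inj, add_one_ne_zero, (add_one_ne_zero _).symm,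
    false_and, and_false, zero_ne_one, exists_false, false_or, or_false]
  exact ⟨fun ⟨_, _, ⟨rfl, rfl⟩, h'⟩ => h', fun h' => ⟨a, c, ⟨rfl, rfl⟩, h'⟩⟩

theorem ackR_succ_succ {k a b d : M} :
    AckR k (a + 1) (b + 1) d ↔ ∃ c, AckR k (a + 1) b c ∧ IterR k a k c d := by
  unfold AckR IterR
  rw [IndPred.iff (ackStep_finitary k)]
  simp only [AckStep, pr_inj, true_and, add_left_inj, add_one_ne_zero, false_and, and_false,
    zero_ne_one, exists_false, false_or, or_false]
  exact ⟨fun ⟨_, _, c, _, ⟨rfl, rfl, rfl⟩, h'⟩ => ⟨c, h'⟩,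
    fun ⟨c, h'⟩ => ⟨a, b, c, d, ⟨rfl, rfl, rfl⟩, h'⟩⟩

theorem iterR_zero {k a x y : M} : IterR k a 0 x y ↔ y = x := by
  unfold IterR
  rw [IndPred.iff (ackStep_finitary k)]
  simp only [AckStep, pr_inj, true_and, (add_one_ne_zero _).symm,
    false_and, and_false, one_ne_zero, exists_false, false_or, or_false]
  exact ⟨fun ⟨_, _, _, h1, h2⟩ => h2.trans h1.symm, fun h => ⟨a, x, rfl, rfl, h⟩⟩

theorem iterR_succ {k a i x z : M} :
    IterR k a (i + 1) x z ↔ ∃ w, IterR k a i x w ∧ AckR k a w z := by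
  unfold AckR IterR
  rw [IndPred.iff (ackStep_finitary k)]
  simp only [AckStep, pr_inj, true_and, add_one_ne_zero, add_left_inj,
    false_and, and_false, one_ne_zero, exists_false, false_or]
  exact ⟨fun ⟨_, _, _, w, _, ⟨rfl, rfl, rfl, rfl⟩, h⟩ => ⟨w, h⟩,
    fun ⟨w, h⟩ => ⟨a, i, x, w, z, ⟨rfl, rfl, rfl, rfl⟩, h⟩⟩

theorem iterR_functional {k a : M} (h : ∀ b, ∃ c, ∀ d, AckR k a b d ↔ d = c) (i x : M) :
    ∃ c, ∀ d, IterR k a i x d ↔ d = c := by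
  refine induction (fun i => ∃ c, ∀ d, IterR k a i x d ↔ d = c) ⟨x, fun d => iterR_zero⟩
    (fun i ih => ?_) i
  obtain ⟨w, hw⟩ := ih
  obtain ⟨c, hc⟩ := h w
  exact ⟨c, fun d => by simp [iterR_succ, hw, hc]⟩

/-- Totality and uniqueness are proved together, by an outer induction on `a` for all arguments, and
inner inductions on `b` and on the number of iterations. -/
theorem ackR_functional (k a : M) : ∀ b, ∃ c, ∀ d, AckR k a b d ↔ d = c := by
  refine induction (fun a => ∀ b, ∃ c, ∀ d, AckR k a b d ↔ d = c) ?_ (fun a ih => ?_) a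
  · refine induction (fun b => ∃ c, ∀ d, AckR k 0 b d ↔ d = c) ⟨1, fun d => ackR_zero_zero⟩ ?_
    rintro b ⟨c, hc⟩
    exact ⟨c * k, fun d => by simp [ackR_zero_succ, hc]⟩
  · refine induction (fun b => ∃ c, ∀ d, AckR k (a + 1) b d ↔ d = c) ?_ ?_
    · obtain ⟨c, hc⟩ := iterR_functional ih k 0
      exact ⟨c, fun d => ackR_succ_zero.trans (hc d)⟩
    · rintro b ⟨w, hw⟩
      obtain ⟨c, hc⟩ := iterR_functional ih k w
      exact ⟨c, fun d => by simp [ackR_succ_succ, hw, hc]⟩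

/-- The Ackermann function `A_a(k, b)` of a model. -/
noncomputable def ack (k a b : M) : M := (ackR_functional k a b).choose

/-- The iteration `A_a^i(k, ·)(x)` in a model. -/
noncomputable def iter (k a i x : M) : M := (iterR_functional (ackR_functional k a) i x).choose

theorem ackR_iff {k a b c : M} : AckR k a b c ↔ c = ack k a b :=
  (ackR_functional k a b).choose_spec c

theorem iterR_iff {k a i x y : M} : IterR k a i x y ↔ y = iter k a i x :=
  (iterR_functional (ackR_functional k a) i x).choose_spec y

instance {f g h : (ℕ → M) → M} [hf : DfnF f] [hg : DfnF g] [hh : DfnF h] :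
    DfnF fun e => ack (f e) (g e) (h e) :=
  DfnF.comp3 (Dfn.congr (P := fun e => AckR (e 1) (e 2) (e 3) (e 0)) inferInstance
    fun _ => ackR_iff) hf hg hh

instance {f g h k : (ℕ → M) → M} [hf : DfnF f] [hg : DfnF g] [hh : DfnF h] [hk : DfnF k] :
    DfnF fun e => iter (f e) (g e) (h e) (k e) :=
  DfnF.comp4 (Dfn.congr (P := fun e => IterR (e 1) (e 2) (e 3) (e 4) (e 0)) inferInstance
    fun _ => iterR_iff) hf hg hh hk

@[simp]
theorem ack_zero_zero (k : M) : ack k 0 0 = 1 := (ackR_zero_zero.1 (ackR_iff.2 rfl))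

theorem ack_zero_succ (k b : M) : ack k 0 (b + 1) = ack k 0 b * k :=
  (ackR_iff.1 (ackR_zero_succ.2 ⟨_, rfl, ackR_iff.2 rfl⟩)).symm

theorem ack_succ_zero (k a : M) : ack k (a + 1) 0 = iter k a k 0 :=
  (ackR_iff.1 (ackR_succ_zero.2 (iterR_iff.2 rfl))).symm

theorem ack_succ_succ (k a b : M) : ack k (a + 1) (b + 1) = iter k a k (ack k (a + 1) b) :=
  (ackR_iff.1 (ackR_succ_succ.2 ⟨_, ackR_iff.2 rfl, iterR_iff.2 rfl⟩)).symm

@[simp]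
theorem iter_zero (k a x : M) : iter k a 0 x = x := (iterR_iff.1 (iterR_zero.2 rfl)).symm

theorem iter_succ (k a i x : M) : iter k a (i + 1) x = ack k a (iter k a i x) :=
  (iterR_iff.1 (iterR_succ.2 ⟨_, iterR_iff.2 rfl, ackR_iff.2 rfl⟩)).symm

end Ackermann

/-! ### Monotonicity of the Ackermann function -/

section Monotonicity

variable {M : PAModel} {k : M}

/-- The passage from successors to arbitrary distances is an internal induction, hence the
definability hypothesis. -/
theorem strictMono_of_lt_succ_dfn {f : M → M} (hf : DfnF fun e : ℕ → M => f (e 0))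
    (h : ∀ x, f x < f (x + 1)) : StrictMono f := by
  intro x y hxy
  obtain ⟨z, rfl⟩ := le_iff.1 (Order.add_one_le_iff.2 hxy)
  have h1 : Dfn fun e : ℕ → M => f x < f (x + 1 + e 0) :=
    Dfn.comp1 (R := fun y => f x < y) inferInstance
      (DfnF.comp1 (F := f) (Dfn.comp2 (R := fun u v => u = v) inferInstance (DfnF.var 0)
        (hf.reindex (· + 1))) inferInstance)
  refine induction (fun z => f x < f (x + 1 + z)) ?_ (fun z ih => ?_) z
  · simpa using h x
  · exact ih.trans (by simpa [add_assoc] using h (x + 1 + z))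

theorem le_iter {a : M} (h : ∀ x, x < ack k a x) (i x : M) : x ≤ iter k a i x :=
  induction (fun i => x ≤ iter k a i x) (by simp)
    (fun i ih => by rw [iter_succ]; exact ih.trans (h _).le) i

theorem lt_iter {a : M} (h : ∀ x, x < ack k a x) {i : M} (hi : 0 < i) (x : M) :
    x < iter k a i x := by
  obtain ⟨j, rfl⟩ := (eq_zero_or_succ i).resolve_left hi.ne'
  rw [iter_succ]
  exact (le_iter h j x).trans_lt (h _)

theorem ack_lt_and (hk : 2 ≤ k) (a : M) : ∀ b, b < ack k a b ∧ ack k a b < ack k a (b + 1) := by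
  have h2 : (1 : M) < k := lt_of_lt_of_le (by rw [← one_add_one_eq_two]; exact lt_add_one' _) hk
  have h0 : (0 : M) < k := zero_lt_one.trans h2
  refine induction (fun a => ∀ b, b < ack k a b ∧ ack k a b < ack k a (b + 1)) ?_ ?_ a
  · refine induction (fun b => b < ack k 0 b ∧ ack k 0 b < ack k 0 (b + 1)) ?_ ?_
    · have h := ack_zero_succ k 0
      rw [zero_add] at h
      simpa [h] using h2
    · rintro b ⟨h3, h4⟩
      refine ⟨(Order.add_one_le_iff.2 h3).trans_lt h4, ?_⟩
      rw [ack_zero_succ _ (b + 1)]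
      exact lt_mul_of_one_lt_right (zero_le.trans_lt h4) h2
  · intro a ih
    have h5 : ∀ x, x < ack k a x := fun x => (ih x).1
    have h6 : ∀ b, ack k (a + 1) b < ack k (a + 1) (b + 1) := fun b => by
      rw [ack_succ_succ]
      exact lt_iter h5 h0 _
    refine fun b => ⟨?_, h6 b⟩
    refine induction (fun b => b < ack k (a + 1) b) ?_ (fun b hb => ?_) b
    · rw [ack_succ_zero]
      exact lt_iter h5 h0 _
    · exact (Order.add_one_le_iff.2 hb).trans_lt (h6 b)

theorem lt_ack (hk : 2 ≤ k) (a b : M) : b < ack k a b := (ack_lt_and hk a b).1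

theorem ack_pos (hk : 2 ≤ k) (a b : M) : 0 < ack k a b := zero_le.trans_lt (lt_ack hk a b)

theorem ack_strictMono (hk : 2 ≤ k) (a : M) : StrictMono (ack k a) :=
  strictMono_of_lt_succ_dfn inferInstance fun b => (ack_lt_and hk a b).2

/-- The outermost of the `k` iterations is one application of `A_a(k, ·)`, and its argument is
already at least `b`. -/
theorem ack_le_succ (hk : 2 ≤ k) (a b : M) : ack k a b ≤ ack k (a + 1) b := by
  have h0 : (0 : M) < k := zero_lt_two.trans_le hk
  obtain ⟨j, rfl⟩ := (eq_zero_or_succ k).resolve_left h0.ne'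
  rcases eq_zero_or_succ b with rfl | ⟨b, rfl⟩
  · rw [ack_succ_zero, iter_succ]
    exact (ack_strictMono hk a).monotone zero_le
  · rw [ack_succ_succ, iter_succ]
    exact (ack_strictMono hk a).monotone
      ((Order.add_one_le_iff.2 (lt_ack hk (a + 1) b)).trans (le_iter (lt_ack hk a) _ _))

theorem ack_zero_lt_succ (hk : 2 ≤ k) (a : M) : ack k a 0 < ack k (a + 1) 0 := by
  have h1 : (1 : M) < k := lt_of_lt_of_le (by rw [← one_add_one_eq_two]; exact lt_add_one' _) hk
  obtain ⟨j, rfl⟩ := (eq_zero_or_succ k).resolve_left (zero_lt_one.trans h1).ne'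
  rw [ack_succ_zero, iter_succ]
  exact ack_strictMono hk a (lt_iter (lt_ack hk a)
    (pos_iff_ne_zero.2 fun h => by simp [h] at h1) _)

theorem ack_zero_strictMono (hk : 2 ≤ k) : StrictMono fun a => ack k a 0 :=
  strictMono_of_lt_succ_dfn inferInstance (ack_zero_lt_succ hk)

theorem lt_ack_index (hk : 2 ≤ k) (a : M) : a < ack k a 0 :=
  induction (fun a => a < ack k a 0) (by simp)
    (fun a ih => (Order.add_one_le_iff.2 ih).trans_lt (ack_zero_lt_succ hk a)) a

theorem ack_le_ack_index (hk : 2 ≤ k) {a a' : M} (h : a ≤ a') (b : M) :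
    ack k a b ≤ ack k a' b := by
  obtain ⟨z, rfl⟩ := le_iff.1 h
  refine induction (fun z => ack k a b ≤ ack k (a + z) b) (by simp) (fun z ih => ?_) z
  rw [← add_assoc]
  exact ih.trans (ack_le_succ hk _ _)

theorem iter_le_iter {k' a a' : M} (hk' : 2 ≤ k') (h : ∀ b, ack k a b ≤ ack k' a' b) {i i' x x' : M}
    (hi : i ≤ i') (hx : x ≤ x') : iter k a i x ≤ iter k' a' i' x' := by
  have h1 : iter k a i x ≤ iter k' a' i x' := by
    refine induction (fun i => iter k a i x ≤ iter k' a' i x') (by simpa) (fun i ih => ?_) i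
    rw [iter_succ, iter_succ]
    exact (h _).trans ((ack_strictMono hk' a').monotone ih)
  obtain ⟨z, rfl⟩ := le_iff.1 hi
  refine h1.trans (induction (fun z => iter k' a' i x' ≤ iter k' a' (i + z) x') (by simp)
    (fun z ih => ?_) z)
  rw [← add_assoc, iter_succ]
  exact ih.trans (lt_ack hk' _ _).le

theorem ack_le_ack_base {k' : M} (hk : 2 ≤ k) (hk' : k ≤ k') (a : M) :
    ∀ b, ack k a b ≤ ack k' a b := by
  have hk2 := hk.trans hk'
  refine induction (fun a => ∀ b, ack k a b ≤ ack k' a b) ?_ (fun a ih => ?_) a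
  · refine induction (fun b => ack k 0 b ≤ ack k' 0 b) (by simp) fun b ih => ?_
    rw [ack_zero_succ, ack_zero_succ]
    gcongr
  · refine induction (fun b => ack k (a + 1) b ≤ ack k' (a + 1) b) ?_ fun b ihb => ?_
    · rw [ack_succ_zero, ack_succ_zero]
      exact iter_le_iter hk2 ih hk' le_rfl
    · rw [ack_succ_succ, ack_succ_succ]
      exact iter_le_iter hk2 ih hk' ihb

theorem ack_le_ack {k' a a' b b' : M} (hk : 2 ≤ k) (hk' : k ≤ k') (ha : a ≤ a') (hb : b ≤ b') :
    ack k a b ≤ ack k' a' b' :=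
  (ack_le_ack_base hk hk' a b).trans ((ack_le_ack_index (hk.trans hk') ha b).trans
    ((ack_strictMono (hk.trans hk') a').monotone hb))

/-- The lower order terms make the induction work, since `(x + 1)² + (x + 1) + 1 ≤ 3 * (x² + x +
1)`. For base `2` even `x² ≤ 2 ^ x` fails at `x = 3`; it matters that the new base `k + 1` is at
least `3`. -/
theorem sq_lt_ack_zero (hk : 3 ≤ k) (x : M) : x * x + x + 1 ≤ ack k 0 x := by
  refine induction (fun x => x * x + x + 1 ≤ ack k 0 x) (by simp) (fun x ih => ?_) x
  rw [ack_zero_succ]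
  calc (x + 1) * (x + 1) + (x + 1) + 1 ≤ (x + 1) * (x + 1) + (x + 1) + 1 + 2 * x * x := le_self_add
    _ = (x * x + x + 1) * 3 := by ring
    _ ≤ ack k 0 x * k := by gcongr

theorem mul_self_le_ack (hk : 3 ≤ k) (a x : M) : x * x ≤ ack k a x := by
  have h2 : (2 : M) ≤ k := le_trans (by
    rw [show (3 : M) = 2 + 1 by norm_num]; exact le_self_add) hk
  exact ((le_self_add.trans le_self_add).trans (sq_lt_ack_zero hk x)).trans
    (ack_le_ack_index h2 zero_le x)

end Monotonicity

/-! ### Normal forms in a model -/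

section Normal_forms

variable {M : PAModel} {k c : M}

theorem exists_between_dfn {g : M → M} (hg : DfnF fun e : ℕ → M => g (e 0)) (hm : StrictMono g)
    (h0 : g 0 ≤ c) : ∃ i, g i ≤ c ∧ c < g (i + 1) := by
  have h1 : Dfn fun e : ℕ → M => e 0 = g (e 1) :=
    Dfn.comp2 (R := fun u v => u = v) inferInstance (DfnF.var 0) (hg.reindex (· + 1))
  have hle : ∀ x, x ≤ g x := fun x => by
    have : Dfn fun e : ℕ → M => e 0 ≤ g (e 0) :=
      Dfn.comp2 (R := fun u v => u ≤ v) inferInstance (DfnF.var 0) hg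
    exact induction (fun x => x ≤ g x) zero_le (fun x ih =>
      Order.add_one_le_iff.2 (ih.trans_lt (hm (lt_add_one' x)))) x
  by_contra! h
  have h2 : ∀ i, g i ≤ c := by
    have : Dfn fun e : ℕ → M => g (e 0) ≤ c :=
      Dfn.comp2 (R := fun u v => u ≤ v) inferInstance hg inferInstance
    exact induction (fun i => g i ≤ c) h0 h
  exact (((lt_add_one' c).trans_le (hle (c + 1))).trans_le (h2 _)).false

theorem exists_div (c : M) {B : M} (hB : 0 < B) : ∃ m n, c = B * m + n ∧ n < B := by
  refine induction (fun c => ∃ m n, c = B * m + n ∧ n < B) ⟨0, 0, by simp, hB⟩ ?_ c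
  rintro c ⟨m, n, rfl, hn⟩
  rcases (Order.add_one_le_iff.2 hn).lt_or_eq with h | h
  · exact ⟨m, n + 1, by ring, h⟩
  · exact ⟨m + 1, 0, by rw [add_assoc, h]; ring, hB⟩

theorem div_unique {B m n m' n' : M} (h : B * m + n = B * m' + n') (hn : n < B) (hn' : n' < B) :
    m = m' ∧ n = n' := by
  have key : ∀ {m n m' n' : M}, n < B → m < m' → B * m + n < B * m' + n' := by
    intro m n m' n' hn hm
    calc B * m + n < B * m + B := by gcongr
      _ = B * (m + 1) := by ring
      _ ≤ B * m' := by gcongr; exact Order.add_one_le_iff.2 hm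
      _ ≤ _ := le_self_add
  rcases lt_trichotomy m m' with hm | rfl | hm
  · exact ((key hn hm).ne h).elim
  · exact ⟨rfl, add_left_cancel h⟩
  · exact ((key hn' hm).ne h.symm).elim

/-- `c = A_a(k, b) * m + n` is the `k`-normal form of `c`. -/
def NF (k c a b m n : M) : Prop :=
  c = ack k a b * m + n ∧ ack k a 0 ≤ c ∧ c < ack k (a + 1) 0 ∧ ack k a b ≤ c ∧
    c < ack k a (b + 1) ∧ n < ack k a b

/-- `A_a(k, b)` is the leading term of the `k`-normal form of `c`. -/
def Lead (k c a b : M) : Prop :=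
  ack k a 0 ≤ c ∧ c < ack k (a + 1) 0 ∧ ack k a b ≤ c ∧ c < ack k a (b + 1)

theorem NF.lead {a b m n : M} (h : NF k c a b m n) : Lead k c a b :=
  ⟨h.2.1, h.2.2.1, h.2.2.2.1, h.2.2.2.2.1⟩

theorem exists_lead (hk : 2 ≤ k) (hc : 0 < c) : ∃ a b, Lead k c a b := by
  obtain ⟨a, h1, h2⟩ := exists_between_dfn (g := fun a => ack k a 0) (c := c) inferInstance
    (ack_zero_strictMono hk) (by simpa using Order.add_one_le_iff.2 hc)
  obtain ⟨b, h3, h4⟩ := exists_between_dfn (g := ack k a) inferInstance (ack_strictMono hk a) h1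
  exact ⟨a, b, h1, h2, h3, h4⟩

theorem Lead.pos {a b : M} (hk : 2 ≤ k) (h : Lead k c a b) : 0 < c :=
  (ack_pos hk a b).trans_le h.2.2.1

theorem Lead.index_lt {a b : M} (hk : 2 ≤ k) (h : Lead k c a b) : a < c :=
  (lt_ack_index hk a).trans_le h.1

theorem Lead.arg_lt {a b : M} (hk : 2 ≤ k) (h : Lead k c a b) : b < c :=
  (lt_ack hk a b).trans_le h.2.2.1

theorem Lead.exists_nf {a b : M} (hk : 2 ≤ k) (h : Lead k c a b) : ∃ m n, NF k c a b m n := by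
  obtain ⟨m, n, h5, h6⟩ := exists_div c (ack_pos hk a b)
  exact ⟨m, n, h5, h.1, h.2.1, h.2.2.1, h.2.2.2, h6⟩

/-- Leading terms are compared lexicographically. -/
theorem Lead.lex {a b c' a' b' : M} (hk : 2 ≤ k) (h : Lead k c a b) (h' : Lead k c' a' b')
    (hc : c ≤ c') : a < a' ∨ a = a' ∧ b ≤ b' := by
  have h1 : a ≤ a' := Order.lt_add_one_iff.1
    ((ack_zero_strictMono hk).lt_iff_lt.1 ((h.1.trans hc).trans_lt h'.2.1))
  rcases h1.lt_or_eq with h1 | rfl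
  · exact Or.inl h1
  · exact Or.inr ⟨rfl, Order.lt_add_one_iff.1
      ((ack_strictMono hk a).lt_iff_lt.1 ((h.2.2.1.trans hc).trans_lt h'.2.2.2))⟩

theorem Lead.unique {a b a' b' : M} (hk : 2 ≤ k) (h : Lead k c a b) (h' : Lead k c a' b') :
    a = a' ∧ b = b' := by
  rcases h.lex hk h' le_rfl with h1 | ⟨rfl, h1⟩
  · rcases h'.lex hk h le_rfl with h2 | ⟨rfl, -⟩
    · exact (h1.asymm h2).elim
    · exact (h1.false).elim
  · rcases h'.lex hk h le_rfl with h2 | ⟨-, h2⟩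
    · exact h2.false.elim
    · exact ⟨rfl, h1.antisymm h2⟩

theorem NF.unique {a b m n a' b' m' n' : M} (hk : 2 ≤ k) (h : NF k c a b m n)
    (h' : NF k c a' b' m' n') : a = a' ∧ b = b' ∧ m = m' ∧ n = n' := by
  obtain ⟨rfl, rfl⟩ := h.lead.unique hk h'.lead
  exact ⟨rfl, rfl, div_unique (h.1.symm.trans h'.1) h.2.2.2.2.2 h'.2.2.2.2.2⟩

theorem exists_nf (hk : 2 ≤ k) (hc : 0 < c) : ∃ p : M × M × M × M, NF k c p.1 p.2.1 p.2.2.1 p.2.2.2 := by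
  obtain ⟨a, b, h⟩ := exists_lead hk hc
  obtain ⟨m, n, h⟩ := h.exists_nf hk
  exact ⟨(a, b, m, n), h⟩

instance {f g h l m n : (ℕ → M) → M} [DfnF f] [DfnF g] [DfnF h] [DfnF l] [DfnF m] [DfnF n] :
    Dfn fun e => NF (f e) (g e) (h e) (l e) (m e) (n e) := by
  unfold NF
  infer_instance

open Classical in
/-- The components of the `k`-normal form of `c`. -/
noncomputable def nf (k c : M) : M × M × M × M :=
  if h : 2 ≤ k ∧ 0 < c then (exists_nf h.1 h.2).choose else (0, 0, 0, 0)

theorem nf_iff {a b m n : M} : nf k c = (a, b, m, n) ↔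
    (2 ≤ k ∧ 0 < c) ∧ NF k c a b m n ∨ ¬(2 ≤ k ∧ 0 < c) ∧ a = 0 ∧ b = 0 ∧ m = 0 ∧ n = 0 := by
  by_cases h : 2 ≤ k ∧ 0 < c
  · have h1 := (exists_nf h.1 h.2).choose_spec
    rw [nf, dif_pos h]
    simp only [h, true_and, not_true, false_and, or_false]
    refine ⟨fun e => by rw [e] at h1; exact h1, fun h2 => ?_⟩
    obtain ⟨e1, e2, e3, e4⟩ := h1.unique h.1 h2
    ext <;> assumption
  · rw [nf, dif_neg h]
    simp only [h, false_and, false_or, not_false_iff, true_and, Prod.mk.injEq, eq_comm]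

theorem nf_spec (hk : 2 ≤ k) (hc : 0 < c) :
    NF k c (nf k c).1 (nf k c).2.1 (nf k c).2.2.1 (nf k c).2.2.2 := by
  rcases nf_iff.1 (rfl : nf k c = ((nf k c).1, (nf k c).2.1, (nf k c).2.2.1, (nf k c).2.2.2)) with
    h | h
  · exact h.2
  · exact (h.1 ⟨hk, hc⟩).elim

theorem NF.eq_nf {a b m n : M} (hk : 2 ≤ k) (h : NF k c a b m n) : nf k c = (a, b, m, n) :=
  nf_iff.2 (Or.inl ⟨⟨hk, h.lead.pos hk⟩, h⟩)

instance {f g : (ℕ → M) → M} [hf : DfnF f] [hg : DfnF g] : DfnF fun e => (nf (f e) (g e)).1 :=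
  DfnF.comp2 (F := fun k c => (nf k c).1) (Dfn.congr (P := fun e => ∃ b m n : M,
    (2 ≤ e 1 ∧ 0 < e 2) ∧ NF (e 1) (e 2) (e 0) b m n ∨
      ¬(2 ≤ e 1 ∧ 0 < e 2) ∧ e 0 = 0 ∧ b = 0 ∧ m = 0 ∧ n = 0) inferInstance fun e => by
    simp only [← nf_iff]
    exact ⟨fun ⟨b, m, n, h⟩ => by rw [h], fun h => ⟨_, _, _, by rw [h]⟩⟩) hf hg

instance {f g : (ℕ → M) → M} [hf : DfnF f] [hg : DfnF g] : DfnF fun e => (nf (f e) (g e)).2.1 :=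
  DfnF.comp2 (F := fun k c => (nf k c).2.1) (Dfn.congr (P := fun e => ∃ a m n : M,
    (2 ≤ e 1 ∧ 0 < e 2) ∧ NF (e 1) (e 2) a (e 0) m n ∨
      ¬(2 ≤ e 1 ∧ 0 < e 2) ∧ a = 0 ∧ e 0 = 0 ∧ m = 0 ∧ n = 0) inferInstance fun e => by
    simp only [← nf_iff]
    exact ⟨fun ⟨b, m, n, h⟩ => by rw [h], fun h => ⟨_, _, _, by rw [h]⟩⟩) hf hg

instance {f g : (ℕ → M) → M} [hf : DfnF f] [hg : DfnF g] : DfnF fun e => (nf (f e) (g e)).2.2.1 :=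
  DfnF.comp2 (F := fun k c => (nf k c).2.2.1) (Dfn.congr (P := fun e => ∃ a b n : M,
    (2 ≤ e 1 ∧ 0 < e 2) ∧ NF (e 1) (e 2) a b (e 0) n ∨
      ¬(2 ≤ e 1 ∧ 0 < e 2) ∧ a = 0 ∧ b = 0 ∧ e 0 = 0 ∧ n = 0) inferInstance fun e => by
    simp only [← nf_iff]
    exact ⟨fun ⟨b, m, n, h⟩ => by rw [h], fun h => ⟨_, _, _, by rw [h]⟩⟩) hf hg

instance {f g : (ℕ → M) → M} [hf : DfnF f] [hg : DfnF g] : DfnF fun e => (nf (f e) (g e)).2.2.2 :=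
  DfnF.comp2 (F := fun k c => (nf k c).2.2.2) (Dfn.congr (P := fun e => ∃ a b m : M,
    (2 ≤ e 1 ∧ 0 < e 2) ∧ NF (e 1) (e 2) a b m (e 0) ∨
      ¬(2 ≤ e 1 ∧ 0 < e 2) ∧ a = 0 ∧ b = 0 ∧ m = 0 ∧ e 0 = 0) inferInstance fun e => by
    simp only [← nf_iff]
    exact ⟨fun ⟨b, m, n, h⟩ => by rw [h], fun h => ⟨_, _, _, by rw [h]⟩⟩) hf hg

end Normal_forms

/-! ### Definitions by recursion -/

section Recursion

variable {M : PAModel}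

/-- The clauses of the recursion `f 0 = 0` and `f c = H c (f (p c)) (f (q c)) (f (r c))`. -/
def RecStep (p q r : M → M) (H : M → M → M → M → M) (K : M → Prop) (x : M) : Prop :=
  x = pr 0 0 ∨ ∃ c x₁ x₂ x₃, x = pr c (H c x₁ x₂ x₃) ∧ 0 < c ∧ K (pr (p c) x₁) ∧ K (pr (q c) x₂) ∧
    K (pr (r c) x₃)

variable {p q r : M → M} {H : M → M → M → M → M}

theorem recStep_finitary : Finitary (RecStep p q r H) := by
  rintro K x (h | ⟨c, x₁, x₂, x₃, h, hc, h1, h2, h3⟩)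
  · exact ⟨[], by simp, fun K' _ => Or.inl h⟩
  · exact ⟨[_, _, _], by simpa using ⟨h1, h2, h3⟩, fun K' hK => Or.inr ⟨c, x₁, x₂, x₃, h, hc,
      hK _ List.mem_cons_self, hK _ (List.mem_cons_of_mem _ List.mem_cons_self), hK _ (by simp)⟩⟩

theorem recStep_zero {d : M} : IndPred (RecStep p q r H) (pr 0 d) ↔ d = 0 := by
  rw [IndPred.iff recStep_finitary]
  refine ⟨?_, fun h => Or.inl (by rw [h])⟩
  rintro (h | ⟨c, x₁, x₂, x₃, h, hc, -⟩)
  · exact (pr_inj.1 h).2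
  · exact (hc.ne (pr_inj.1 h).1).elim

theorem recStep_pos {c d : M} (hc : 0 < c) : IndPred (RecStep p q r H) (pr c d) ↔
    ∃ x₁ x₂ x₃, d = H c x₁ x₂ x₃ ∧ IndPred (RecStep p q r H) (pr (p c) x₁) ∧
      IndPred (RecStep p q r H) (pr (q c) x₂) ∧ IndPred (RecStep p q r H) (pr (r c) x₃) := by
  rw [IndPred.iff recStep_finitary]
  constructor
  · rintro (h | ⟨c', x₁, x₂, x₃, h, -, h'⟩)
    · exact (hc.ne' (pr_inj.1 h).1).elim
    · obtain ⟨rfl, rfl⟩ := pr_inj.1 h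
      exact ⟨x₁, x₂, x₃, rfl, h'⟩
  · rintro ⟨x₁, x₂, x₃, rfl, h'⟩
    exact Or.inr ⟨c, x₁, x₂, x₃, rfl, hc, h'⟩

/-- Course-of-values recursion: all three recursive calls go to smaller arguments, so strong
induction gives existence and uniqueness of the value. -/
theorem recStep_functional (hD : Dfn fun e : ℕ → M => IndPred (RecStep p q r H) (e 0))
    (hp : ∀ c, 0 < c → p c < c) (hq : ∀ c, 0 < c → q c < c) (hr : ∀ c, 0 < c → r c < c) (c : M) :
    ∃ d, ∀ x, IndPred (RecStep p q r H) (pr c x) ↔ x = d := by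
  have hD' : ∀ {f g : (ℕ → M) → M} [DfnF f] [DfnF g],
      Dfn fun e => IndPred (RecStep p q r H) (pr (f e) (g e)) :=
    fun {f g} _ _ => Dfn.comp1 (R := IndPred (RecStep p q r H)) hD inferInstance
  have : Dfn fun e : ℕ → M => ∃ d, ∀ x, IndPred (RecStep p q r H) (pr (e 0) x) ↔ x = d := by
    have : Dfn fun e : ℕ → M => IndPred (RecStep p q r H) (pr (e 2) (e 0)) := hD'
    exact @Dfn.ex _ _ _ (@Dfn.all _ _ _ (@Dfn.iff _ _ _ _ this inferInstance))
  refine strong_induction (fun c => ∃ d, ∀ x, IndPred (RecStep p q r H) (pr c x) ↔ x = d)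
    (fun c ih => ?_) c
  rcases eq_or_ne c 0 with rfl | hc
  · exact ⟨0, fun x => recStep_zero⟩
  · have hc := pos_iff_ne_zero.2 hc
    obtain ⟨d₁, h1⟩ := ih _ (hp c hc)
    obtain ⟨d₂, h2⟩ := ih _ (hq c hc)
    obtain ⟨d₃, h3⟩ := ih _ (hr c hc)
    refine ⟨H c d₁ d₂ d₃, fun x => ?_⟩
    simp [recStep_pos hc, h1, h2, h3]

end Recursion

/-! ### The base change in a model -/

section Base_change

variable {M : PAModel} {k c : M}

/-- The graph of the base change. -/
def BcR (k c d : M) : Prop :=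
  IndPred (RecStep (fun c => (nf k c).1) (fun c => (nf k c).2.1) (fun c => (nf k c).2.2.2)
    fun c x y z => ack (k + 1) x y * (nf k c).2.2.1 + z) (pr c d)

set_option synthInstance.maxSize 2000 in
set_option synthInstance.maxHeartbeats 400000 in
theorem indPred_bcR_dfn : Dfn fun e : ℕ → M =>
    IndPred (RecStep (fun c => (nf (e 0) c).1) (fun c => (nf (e 0) c).2.1)
      (fun c => (nf (e 0) c).2.2.2)
      fun c x y z => ack (e 0 + 1) x y * (nf (e 0) c).2.2.1 + z) (e 1) := by
  unfold IndPred RecStep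
  beta_reduce
  infer_instance

theorem bcR_functional (hk : 2 ≤ k) (c : M) : ∃ d, ∀ x, BcR k c x ↔ x = d :=
  recStep_functional (Dfn.comp2 (R := fun k x => IndPred (RecStep (fun c => (nf k c).1)
      (fun c => (nf k c).2.1) (fun c => (nf k c).2.2.2)
      fun c x y z => ack (k + 1) x y * (nf k c).2.2.1 + z) x)
      indPred_bcR_dfn (DfnF.const k) (DfnF.var 0))
    (fun _ hc => (nf_spec hk hc).lead.index_lt hk) (fun _ hc => (nf_spec hk hc).lead.arg_lt hk)
    (fun _ hc => (nf_spec hk hc).2.2.2.2.2.trans_le (nf_spec hk hc).2.2.2.1) c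

instance {f g h : (ℕ → M) → M} [hf : DfnF f] [hg : DfnF g] [hh : DfnF h] :
    Dfn fun e => BcR (f e) (g e) (h e) := by
  unfold BcR
  exact Dfn.comp2 (R := fun k x => IndPred (RecStep (fun c => (nf k c).1)
      (fun c => (nf k c).2.1) (fun c => (nf k c).2.2.2)
      fun c x y z => ack (k + 1) x y * (nf k c).2.2.1 + z) x)
      indPred_bcR_dfn inferInstance inferInstance

open Classical in
/-- The base change of a model. -/
noncomputable def bc (k c : M) : M := if h : 2 ≤ k then (bcR_functional h c).choose else 0

theorem bcR_iff (hk : 2 ≤ k) {d : M} : BcR k c d ↔ d = bc k c := by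
  rw [bc, dif_pos hk]
  exact (bcR_functional hk c).choose_spec d

instance {f g : (ℕ → M) → M} [hf : DfnF f] [hg : DfnF g] : DfnF fun e => bc (f e) (g e) :=
  DfnF.comp2 (F := bc) (Dfn.congr (P := fun e => 2 ≤ e 1 ∧ BcR (e 1) (e 2) (e 0) ∨
    ¬2 ≤ e 1 ∧ e 0 = 0) inferInstance fun e => by
      by_cases h : 2 ≤ e 1
      · simp [h, bcR_iff h]
      · simp [h, bc]) hf hg

theorem bc_zero (hk : 2 ≤ k) : bc k 0 = 0 :=
  ((bcR_iff hk).1 (recStep_zero.2 rfl)).symm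

theorem NF.bc_eq {a b m n : M} (hk : 2 ≤ k) (h : NF k c a b m n) :
    bc k c = ack (k + 1) (bc k a) (bc k b) * m + bc k n := by
  refine ((bcR_iff hk).1 ((recStep_pos (h.lead.pos hk)).2
    ⟨bc k a, bc k b, bc k n, ?_, ?_⟩)).symm
  · rw [h.eq_nf hk]
  · rw [h.eq_nf hk]
    exact ⟨(bcR_iff hk).2 rfl, (bcR_iff hk).2 rfl, (bcR_iff hk).2 rfl⟩

theorem NF.mult_pos {a b m n : M} (h : NF k c a b m n) : 0 < m := by
  rcases eq_or_ne m 0 with rfl | hm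
  · have h1 := h.2.2.2.2.2.trans_le h.2.2.2.1
    rw [h.1] at h1
    simp at h1
  · exact pos_iff_ne_zero.2 hm

/-- The number `c` and its base change are related as needed for the preservation of order and
normal forms. -/
def Good (k c : M) : Prop :=
  c ≤ bc k c ∧ (∀ d, d < c → bc k d < bc k c) ∧ ∀ a b m n, NF k c a b m n →
    bc k n < ack (k + 1) (bc k a) (bc k b) ∧ bc k c < ack (k + 1) (bc k a) (bc k b + 1) ∧
      bc k c < ack (k + 1) (bc k a + 1) 0

set_option synthInstance.maxSize 2000 in
set_option synthInstance.maxHeartbeats 400000 in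
instance {f g : (ℕ → M) → M} [hf : DfnF f] [hg : DfnF g] : Dfn fun e => Good (f e) (g e) :=
  Dfn.comp2 (R := Good) (by unfold Good; infer_instance) hf hg

theorem two_le_succ (hk : 2 ≤ k) : 2 ≤ k + 1 := hk.trans le_self_add

theorem three_le_succ (hk : 2 ≤ k) : 3 ≤ k + 1 := by
  rw [← two_add_one_eq_three]
  gcongr

theorem lead_ack {a b : M} (hk : 2 ≤ k) (h : ack k a b < ack k (a + 1) 0) :
    Lead k (ack k a b) a b :=
  ⟨(ack_strictMono hk a).monotone zero_le, h, le_rfl, ack_strictMono hk a (lt_add_one' b)⟩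

/-- If `n ≠ 0`, then `A_a(k, b) < c`, and monotonicity below `c` applies to `n < A_a(k, b)`. The
base change of this leading term can be computed, as its normal form has coefficient `1` and
remainder `0`. -/
theorem NF.bc_rem_lt {a b m n : M} (hk : 2 ≤ k) (ih : ∀ d < c, Good k d) (h : NF k c a b m n) :
    bc k n < ack (k + 1) (bc k a) (bc k b) := by
  have hm := h.mult_pos
  obtain ⟨h0, h1, h2, h3, h4, h5⟩ := h
  rcases eq_or_ne n 0 with rfl | hn
  · rw [bc_zero hk]
    exact ack_pos (two_le_succ hk) _ _
  · have hB : ack k a b < c := by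
      rw [h0]
      calc ack k a b ≤ ack k a b * m := le_mul_of_one_le_right zero_le (by
            simpa using Order.add_one_le_iff.2 hm)
        _ < _ := lt_add_of_pos_right _ (pos_iff_ne_zero.2 hn)
    have h6 : NF k (ack k a b) a b 1 0 :=
      have h7 := lead_ack hk (hB.trans h2)
      ⟨by simp, h7.1, h7.2.1, h7.2.2.1, h7.2.2.2, ack_pos hk _ _⟩
    have h7 := (ih _ hB).2.1 n h5
    rw [h6.bc_eq hk, bc_zero hk, mul_one, add_zero] at h7
    exact h7

theorem NF.bc_lt_mul {a b m n : M} (hk : 2 ≤ k) (h : NF k c a b m n)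
    (hn : bc k n < ack (k + 1) (bc k a) (bc k b)) :
    bc k c < ack (k + 1) (bc k a) (bc k b) * (m + 1) := by
  rw [h.bc_eq hk, mul_add, mul_one]
  gcongr

/-- If `a = 0`, the coefficient satisfies `m < k`, and `m + 1 ≤ k + 1` suffices. If `a > 0`, both
the new leading term and `m + 1` are at most the result `X` of `k` iterations to the new base; the
additional iteration to that base turns `X` into at least `X²`. -/
theorem NF.bc_lt_arg {a b m n : M} (hk : 2 ≤ k) (ih : ∀ d < c, Good k d) (h : NF k c a b m n) :
    bc k c < ack (k + 1) (bc k a) (bc k b + 1) := by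
  refine (h.bc_lt_mul hk (h.bc_rem_lt hk ih)).trans_le ?_
  have hk' := two_le_succ hk
  have ha := (ih a (h.lead.index_lt hk)).1
  have hb := (ih b (h.lead.arg_lt hk)).1
  have hm : ack k a b * m < ack k a (b + 1) := by
    refine lt_of_le_of_lt ?_ h.2.2.2.2.1
    rw [h.1]
    exact le_self_add
  rcases eq_zero_or_succ a with rfl | ⟨a, rfl⟩
  · rw [bc_zero hk, ack_zero_succ]
    rw [ack_zero_succ] at hm
    have := lt_of_mul_lt_mul_left hm zero_le
    gcongr
  · obtain ⟨z, hz⟩ := le_iff.1 ha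
    have hz : bc k (a + 1) = a + z + 1 := by rw [← hz]; ring
    rw [hz, ack_succ_succ, iter_succ]
    rw [ack_succ_succ] at hm
    have hB : ack k (a + 1) b ≤ ack (k + 1) (a + z + 1) (bc k b) :=
      ack_le_ack hk le_self_add (by gcongr; exact le_self_add) hb
    have hX : iter k a k (ack k (a + 1) b) ≤
        iter (k + 1) (a + z) k (ack (k + 1) (a + z + 1) (bc k b)) :=
      iter_le_iter hk' (fun x => ack_le_ack hk le_self_add le_self_add le_rfl) le_rfl hB
    have hmX : m + 1 ≤ iter (k + 1) (a + z) k (ack (k + 1) (a + z + 1) (bc k b)) := by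
      refine Order.add_one_le_iff.2 (lt_of_le_of_lt ?_ (hm.trans_le hX))
      exact le_mul_of_one_le_left zero_le (by
        simpa using Order.add_one_le_iff.2 (ack_pos hk (a + 1) b))
    calc _ ≤ iter (k + 1) (a + z) k (ack (k + 1) (a + z + 1) (bc k b)) *
          iter (k + 1) (a + z) k (ack (k + 1) (a + z + 1) (bc k b)) := by
            gcongr
            exact le_iter (lt_ack hk' _) _ _
      _ ≤ _ := mul_self_le_ack (three_le_succ hk) _ _

/-- As `b < A_{a+1}(k, 0)`, the argument `b` is below the `k`-fold iterate at `0`. By `key` its base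
change is below the `k`-fold iterate to the new base, and the additional iteration absorbs the
application to `bc k b + 1`. -/
theorem NF.bc_lt_index {a b m n : M} (hk : 2 ≤ k) (ih : ∀ d < c, Good k d) (h : NF k c a b m n) :
    bc k c < ack (k + 1) (bc k a + 1) 0 := by
  refine (h.bc_lt_arg hk ih).trans_le ?_
  have hk' := two_le_succ hk
  have hac := h.lead.index_lt hk
  rw [ack_succ_zero, iter_succ]
  refine (ack_strictMono hk' _).monotone (Order.add_one_le_iff.2 ?_)
  -- Induction on the number `j` of iterations. If the leading index of `x` is below `a`, a single
  -- application already dominates; if it is `a`, the leading argument of `x` lies below the iterate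
  -- with one iteration fewer.
  have key : ∀ j x, x < c → x < iter k a j 0 → x < ack k (a + 1) 0 →
      bc k x < iter (k + 1) (bc k a) j 0 := by
    intro j
    refine induction (fun j => ∀ x, x < c → x < iter k a j 0 → x < ack k (a + 1) 0 →
      bc k x < iter (k + 1) (bc k a) j 0) ?_ (fun j ihj x hxc hx hxa => ?_) j
    · intro x _ hx
      simp at hx
    · rw [iter_succ] at hx ⊢
      rcases eq_or_ne x 0 with rfl | hx0
      · rw [bc_zero hk]
        exact ack_pos hk' _ _
      · have hN := nf_spec hk (pos_iff_ne_zero.2 hx0)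
        set ax := (nf k x).1
        set bx := (nf k x).2.1
        have hle : ax ≤ a := Order.lt_add_one_iff.1
          ((ack_zero_strictMono hk).lt_iff_lt.1 (hN.2.1.trans_lt hxa))
        obtain ⟨-, h1, h2⟩ := (ih x hxc).2.2 _ _ _ _ hN
        rcases hle.lt_or_eq with hlt | heq
        · refine h2.trans_le (ack_le_ack hk' le_rfl ?_ zero_le)
          exact Order.add_one_le_iff.2 ((ih a hac).2.1 _ hlt)
        · rw [heq] at h1
          refine h1.trans_le ((ack_strictMono hk' _).monotone (Order.add_one_le_iff.2 ?_))
          have hbx := hN.lead.arg_lt hk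
          refine ihj bx (hbx.trans hxc) ?_ (hbx.trans hxa)
          have h3 := hN.2.2.2.1.trans_lt hx
          rw [heq] at h3
          exact (ack_strictMono hk a).lt_iff_lt.1 h3
  have hb := h.lead.arg_lt hk
  refine key k b hb ?_ (hb.trans h.2.2.1)
  rw [← ack_succ_zero]
  exact hb.trans h.2.2.1

theorem NF.ack_le_bc {a b m n : M} (hk : 2 ≤ k) (h : NF k c a b m n) :
    ack (k + 1) (bc k a) (bc k b) ≤ bc k c := by
  rw [h.bc_eq hk]
  exact (le_mul_of_one_le_right zero_le (by
    simpa using Order.add_one_le_iff.2 h.mult_pos)).trans le_self_add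

/-- The clauses support each other without circularity: the bounds at `c` need monotonicity below
`c`, while monotonicity at `c` needs the bounds only for the smaller number `d`. Then `c ≤ bc k c`
follows from monotonicity. -/
theorem good (hk : 2 ≤ k) (c : M) : Good k c := by
  refine strong_induction (fun c => Good k c) (fun c ih => ?_) c
  have hk' := two_le_succ hk
  have hmono : ∀ d < c, bc k d < bc k c := by
    intro d hd
    have hN := nf_spec hk (zero_le.trans_lt hd)
    revert hN
    generalize (nf k c).1 = a
    generalize (nf k c).2.1 = b
    generalize (nf k c).2.2.1 = m
    generalize (nf k c).2.2.2 = n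
    intro hN
    rcases eq_or_ne d 0 with rfl | hd0
    · rw [bc_zero hk]
      exact (ack_pos hk' _ _).trans_le (hN.ack_le_bc hk)
    · have hD := nf_spec hk (pos_iff_ne_zero.2 hd0)
      revert hD
      generalize (nf k d).1 = a₁
      generalize (nf k d).2.1 = b₁
      generalize (nf k d).2.2.1 = m₁
      generalize (nf k d).2.2.2 = n₁
      intro hD
      obtain ⟨h0, h1, h2⟩ := (ih d hd).2.2 _ _ _ _ hD
      rcases hD.lead.lex hk hN.lead hd.le with hlt | ⟨rfl, hle⟩
      · refine h2.trans_le ((ack_le_ack hk' le_rfl ?_ zero_le).trans (hN.ack_le_bc hk))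
        exact Order.add_one_le_iff.2 ((ih a (hN.lead.index_lt hk)).2.1 _ hlt)
      rcases hle.lt_or_eq with hlt | rfl
      · refine h1.trans_le (((ack_strictMono hk' _).monotone ?_).trans (hN.ack_le_bc hk))
        exact Order.add_one_le_iff.2 ((ih b (hN.lead.arg_lt hk)).2.1 _ hlt)
      rcases lt_trichotomy m₁ m with hlt | rfl | hlt
      · refine (hD.bc_lt_mul hk h0).trans_le ?_
        rw [hN.bc_eq hk]
        refine le_trans ?_ le_self_add
        gcongr
        exact Order.add_one_le_iff.2 hlt
      · rw [hN.bc_eq hk, hD.bc_eq hk]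
        gcongr
        have h3 := hd
        rw [hN.1, hD.1] at h3
        exact (ih n (hN.2.2.2.2.2.trans_le hN.2.2.2.1)).2.1 _ (lt_of_add_lt_add_left h3)
      · refine (hd.not_ge ?_).elim
        have := hN.2.2.2.2.2
        calc c = ack k a₁ b₁ * m + n := hN.1
          _ ≤ ack k a₁ b₁ * m + ack k a₁ b₁ := by gcongr
          _ = ack k a₁ b₁ * (m + 1) := by ring
          _ ≤ ack k a₁ b₁ * m₁ := by gcongr; exact Order.add_one_le_iff.2 hlt
          _ ≤ _ := le_self_add
          _ = d := hD.1.symm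
  refine ⟨?_, hmono, fun a b m n h => ⟨h.bc_rem_lt hk ih, h.bc_lt_arg hk ih, h.bc_lt_index hk ih⟩⟩
  rcases eq_zero_or_succ c with rfl | ⟨c, rfl⟩
  · exact zero_le
  · exact Order.add_one_le_iff.2 ((ih c (lt_add_one' c)).1.trans_lt (hmono c (lt_add_one' c)))

theorem bc_strictMono (hk : 2 ≤ k) : StrictMono (bc k) := fun _ c h => (good hk c).2.1 _ h

/-- The base change preserves leading terms. -/
theorem Lead.bc {a b : M} (hk : 2 ≤ k) (h : Lead k c a b) :
    Lead (k + 1) (bc k c) (bc k a) (bc k b) := by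
  obtain ⟨m, n, h⟩ := h.exists_nf hk
  obtain ⟨-, h1, h2⟩ := (good hk c).2.2 _ _ _ _ h
  exact ⟨((ack_strictMono (two_le_succ hk) _).monotone zero_le).trans (h.ack_le_bc hk), h2,
    h.ack_le_bc hk, h1⟩

/-- Splits off a single copy of the leading term instead of all `m`. Ordinal notations have no
coefficients, so the assignment of ordinals recurses in this way. -/
theorem Lead.bc_eq {a b r : M} (hk : 2 ≤ k) (h : Lead k c a b) (hr : c = ack k a b + r) :
    Goodstein.bc k c = ack (k + 1) (Goodstein.bc k a) (Goodstein.bc k b) + Goodstein.bc k r := by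
  obtain ⟨m, n, hN⟩ := h.exists_nf hk
  rw [hN.bc_eq hk]
  obtain ⟨m, rfl⟩ := (eq_zero_or_succ m).resolve_left hN.mult_pos.ne'
  have hr' : r = ack k a b * m + n := by
    refine add_left_cancel (a := ack k a b) ?_
    rw [← hr, hN.1]
    ring
  rcases eq_or_ne m 0 with rfl | hm
  · rw [hr']
    simp
  · have hle : ack k a b ≤ r := by
      rw [hr']
      exact (le_mul_of_one_le_right zero_le (by
        simpa using Order.add_one_le_iff.2 (pos_iff_ne_zero.2 hm))).trans le_self_add
    have hrc : r ≤ c := by rw [hr]; exact le_add_self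
    have hN' : NF k r a b m n := ⟨hr', ((ack_strictMono hk _).monotone zero_le).trans hle,
      hrc.trans_lt h.2.1, hle, hrc.trans_lt h.2.2.2, hN.2.2.2.2.2⟩
    rw [hN'.bc_eq hk]
    ring

end Base_change

/-! ### Ordinal notations in a model -/

section Ordinals

variable {M : PAModel} {k c : M}

/-- The notation for `ω ^ x + y` or `ε_x + y`. -/
def ordn (t x y : M) : M := pr t (pr x y) + 1

instance {f g h : (ℕ → M) → M} [DfnF f] [DfnF g] [DfnF h] :
    DfnF fun e => ordn (f e) (g e) (h e) := by
  unfold ordn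
  infer_instance

@[simp]
theorem ordn_inj {t x y t' x' y' : M} : ordn t x y = ordn t' x' y' ↔ t = t' ∧ x = x' ∧ y = y' := by
  simp [ordn]

theorem ordn_ne_zero (t x y : M) : ordn t x y ≠ 0 := add_one_ne_zero _

/-- The clauses for the order of the notations. -/
def OrdLtStep (K : M → Prop) (z : M) : Prop :=
  (∃ t x y, z = pr 0 (ordn t x y)) ∨
  (∃ t x y y', z = pr (ordn t x y) (ordn t x y') ∧ K (pr y y')) ∨
  (∃ t x x' y y', z = pr (ordn t x y) (ordn t x' y') ∧ K (pr x x')) ∨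
  (∃ x x' y y', z = pr (ordn 0 x y) (ordn 1 x' y') ∧ K (pr x (ordn 1 x' 0))) ∨
  ∃ x x' y y', z = pr (ordn 1 x y) (ordn 0 x' y') ∧ K (pr (ordn 1 x 0) x')

theorem ordLtStep_finitary : Finitary (OrdLtStep (M := M)) := by
  rintro K z (⟨t, x, y, h⟩ | ⟨t, x, y, y', h, h1⟩ | ⟨t, x, x', y, y', h, h1⟩ |
    ⟨x, x', y, y', h, h1⟩ | ⟨x, x', y, y', h, h1⟩)
  · exact ⟨[], by simp, fun K' _ => Or.inl ⟨t, x, y, h⟩⟩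
  · exact ⟨[_], by simpa using h1, fun K' hK => Or.inr (Or.inl ⟨t, x, y, y', h, hK _ (by simp)⟩)⟩
  · exact ⟨[_], by simpa using h1, fun K' hK => Or.inr (Or.inr (Or.inl
      ⟨t, x, x', y, y', h, hK _ (by simp)⟩))⟩
  · exact ⟨[_], by simpa using h1, fun K' hK => Or.inr (Or.inr (Or.inr (Or.inl
      ⟨x, x', y, y', h, hK _ (by simp)⟩)))⟩
  · exact ⟨[_], by simpa using h1, fun K' hK => Or.inr (Or.inr (Or.inr (Or.inr
      ⟨x, x', y, y', h, hK _ (by simp)⟩)))⟩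

/-- The order of the notations. -/
def OrdLt (x y : M) : Prop := IndPred OrdLtStep (pr x y)

set_option synthInstance.maxSize 2000 in
set_option synthInstance.maxHeartbeats 400000 in
instance {f g : (ℕ → M) → M} [hf : DfnF f] [hg : DfnF g] : Dfn fun e => OrdLt (f e) (g e) :=
  Dfn.comp2 (R := OrdLt) (by unfold OrdLt IndPred OrdLtStep; beta_reduce; infer_instance) hf hg

/-- Only these introduction rules for the order are needed below; transitivity and linearity play no
role. -/
theorem zero_ordLt (t x y : M) : OrdLt 0 (ordn t x y) :=
  IndPred.fold ordLtStep_finitary (Or.inl ⟨t, x, y, rfl⟩)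

theorem ordLt_tail {t x y y' : M} (h : OrdLt y y') : OrdLt (ordn t x y) (ordn t x y') :=
  IndPred.fold ordLtStep_finitary (Or.inr (Or.inl ⟨t, x, y, y', rfl, h⟩))

theorem ordLt_head {t x x' y y' : M} (h : OrdLt x x') : OrdLt (ordn t x y) (ordn t x' y') :=
  IndPred.fold ordLtStep_finitary (Or.inr (Or.inr (Or.inl ⟨t, x, x', y, y', rfl, h⟩)))

theorem ordLt_epsilon {x x' y y' : M} (h : OrdLt x (ordn 1 x' 0)) :
    OrdLt (ordn 0 x y) (ordn 1 x' y') :=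
  IndPred.fold ordLtStep_finitary (Or.inr (Or.inr (Or.inr (Or.inl ⟨x, x', y, y', rfl, h⟩))))

theorem epsilon_ordLt {x x' y y' : M} (h : OrdLt (ordn 1 x 0) x') :
    OrdLt (ordn 1 x y) (ordn 0 x' y') :=
  IndPred.fold ordLtStep_finitary (Or.inr (Or.inr (Or.inr (Or.inr ⟨x, x', y, y', rfl, h⟩))))

/-- The summands of `y` are at most the term with the type `t` and the exponent or index `x`. -/
def TailLe (t x y : M) : Prop :=
  y = 0 ∨ ∃ t' x' y', y = ordn t' x' y' ∧
    (ordn t' x' 0 = ordn t x 0 ∨ OrdLt (ordn t' x' 0) (ordn t x 0))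

/-- The clauses for the notations in normal form. -/
def OrdNFStep (K : M → Prop) (z : M) : Prop :=
  z = 0 ∨ ∃ t x y, z = ordn t x y ∧ (t = 0 ∨ t = 1) ∧ K x ∧ K y ∧
    (t = 0 → ¬∃ u, x = ordn 1 u 0) ∧ TailLe t x y

theorem ordNFStep_finitary : Finitary (OrdNFStep (M := M)) := by
  rintro K z (h | ⟨t, x, y, h, h1, h2, h3, h4⟩)
  · exact ⟨[], by simp, fun K' _ => Or.inl h⟩
  · exact ⟨[x, y], by simpa using ⟨h2, h3⟩, fun K' hK => Or.inr ⟨t, x, y, h, h1,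
      hK _ (by simp), hK _ (by simp), h4⟩⟩

/-- The notations in normal form. -/
def OrdNF (x : M) : Prop := IndPred OrdNFStep x

set_option synthInstance.maxSize 2000 in
set_option synthInstance.maxHeartbeats 800000 in
instance {f : (ℕ → M) → M} [hf : DfnF f] : Dfn fun e => OrdNF (f e) :=
  Dfn.comp1 (R := OrdNF)
    (by unfold OrdNF IndPred OrdNFStep TailLe; beta_reduce; infer_instance) hf

theorem ordNF_zero : OrdNF (0 : M) := IndPred.fold ordNFStep_finitary (Or.inl rfl)

theorem ordNF_ordn {t x y : M} (ht : t = 0 ∨ t = 1) (hx : OrdNF x) (hy : OrdNF y)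
    (he : t = 0 → ¬∃ u, x = ordn 1 u 0) (hle : TailLe t x y) : OrdNF (ordn t x y) :=
  IndPred.fold ordNFStep_finitary (Or.inr ⟨t, x, y, rfl, ht, hx, hy, he, hle⟩)

/-! ### The ordinal of a number -/

theorem exists_rest (hk : 2 ≤ k) (hc : 0 < c) : ∃ r, c = ack k (nf k c).1 (nf k c).2.1 + r := by
  obtain ⟨r, h⟩ := le_iff.1 (nf_spec hk hc).2.2.2.1
  exact ⟨r, h.symm⟩

open Classical in
/-- The difference of `c` and its leading term. -/
noncomputable def rest (k c : M) : M :=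
  if h : 2 ≤ k ∧ 0 < c then (exists_rest h.1 h.2).choose else 0

theorem rest_spec (hk : 2 ≤ k) (hc : 0 < c) :
    c = ack k (nf k c).1 (nf k c).2.1 + rest k c := by
  have h : 2 ≤ k ∧ 0 < c := ⟨hk, hc⟩
  rw [rest, dif_pos h]
  exact (exists_rest hk hc).choose_spec

theorem rest_lt (hk : 2 ≤ k) (hc : 0 < c) : rest k c < c := by
  have h := rest_spec hk hc
  calc rest k c < ack k (nf k c).1 (nf k c).2.1 + rest k c :=
        lt_add_of_pos_left _ (ack_pos hk _ _)
    _ = c := h.symm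

instance {f g : (ℕ → M) → M} [hf : DfnF f] [hg : DfnF g] : DfnF fun e => rest (f e) (g e) :=
  DfnF.comp2 (F := rest) (Dfn.congr (P := fun e =>
    (2 ≤ e 1 ∧ 0 < e 2) ∧ e 2 = ack (e 1) (nf (e 1) (e 2)).1 (nf (e 1) (e 2)).2.1 + e 0 ∨
      ¬(2 ≤ e 1 ∧ 0 < e 2) ∧ e 0 = 0) inferInstance fun e => by
    by_cases h : 2 ≤ e 1 ∧ 0 < e 2
    · simp only [h, true_and, not_true, false_and, or_false]
      exact ⟨fun h1 => add_left_cancel (h1.symm.trans (rest_spec h.1 h.2)),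
        fun h1 => h1 ▸ rest_spec h.1 h.2⟩
    · simp only [h, false_and, not_false_iff, true_and, false_or, rest, dif_neg]) hf hg

/-- The notation `ε_α + β` is not in normal form for the ordinals `α` and `β` of `a` and `b`, since
`β` absorbs `ε_α`. -/
def Absorbs (k a b : M) : Prop := a = (nf k b).1 ∧ 0 < (nf k b).2.1

open Classical in
/-- The notation for `ω ^ (ε_α + β) + ρ` if `α` and `β` are the ordinals of `a` and `b`. -/
noncomputable def ordTerm (k a b α β ρ : M) : M :=
  if b = 0 then ordn 1 α ρ else if Absorbs k a b then ordn 0 β ρ else ordn 0 (ordn 1 α β) ρ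

instance {f g h : (ℕ → M) → M} [hf : DfnF f] [hg : DfnF g] [hh : DfnF h] :
    Dfn fun e => Absorbs (f e) (g e) (h e) := by
  unfold Absorbs
  infer_instance

instance {f₁ f₂ f₃ f₄ f₅ f₆ : (ℕ → M) → M} [DfnF f₁] [DfnF f₂] [DfnF f₃] [DfnF f₄] [DfnF f₅]
    [DfnF f₆] : DfnF fun e => ordTerm (f₁ e) (f₂ e) (f₃ e) (f₄ e) (f₅ e) (f₆ e) := by
  classical
  unfold ordTerm
  have : DfnF fun e => if Absorbs (f₁ e) (f₂ e) (f₃ e) then ordn 0 (f₅ e) (f₆ e)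
      else ordn 0 (ordn 1 (f₄ e) (f₅ e)) (f₆ e) :=
    DfnF.ite (P := fun e => Absorbs (f₁ e) (f₂ e) (f₃ e))
  exact DfnF.ite (P := fun e => f₃ e = 0)

/-- The graph of the assignment of ordinals to numbers. -/
def OdR (k c d : M) : Prop :=
  IndPred (RecStep (fun c => (nf k c).1) (fun c => (nf k c).2.1) (rest k)
    fun c x y z => ordTerm k (nf k c).1 (nf k c).2.1 x y z) (pr c d)

set_option synthInstance.maxSize 2000 in
set_option synthInstance.maxHeartbeats 800000 in
theorem indPred_odR_dfn : Dfn fun e : ℕ → M =>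
    IndPred (RecStep (fun c => (nf (e 0) c).1) (fun c => (nf (e 0) c).2.1) (rest (e 0))
      fun c x y z => ordTerm (e 0) (nf (e 0) c).1 (nf (e 0) c).2.1 x y z) (e 1) := by
  unfold IndPred RecStep
  beta_reduce
  infer_instance

theorem odR_functional (hk : 2 ≤ k) (c : M) : ∃ d, ∀ x, OdR k c x ↔ x = d :=
  recStep_functional (Dfn.comp2 (R := fun k x => IndPred (RecStep (fun c => (nf k c).1)
      (fun c => (nf k c).2.1) (rest k)
      fun c x y z => ordTerm k (nf k c).1 (nf k c).2.1 x y z) x)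
      indPred_odR_dfn (DfnF.const k) (DfnF.var 0))
    (fun _ hc => (nf_spec hk hc).lead.index_lt hk) (fun _ hc => (nf_spec hk hc).lead.arg_lt hk)
    (fun _ hc => rest_lt hk hc) c

instance {f g h : (ℕ → M) → M} [hf : DfnF f] [hg : DfnF g] [hh : DfnF h] :
    Dfn fun e => OdR (f e) (g e) (h e) := by
  unfold OdR
  exact Dfn.comp2 (R := fun k x => IndPred (RecStep (fun c => (nf k c).1)
      (fun c => (nf k c).2.1) (rest k)
      fun c x y z => ordTerm k (nf k c).1 (nf k c).2.1 x y z) x)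
      indPred_odR_dfn inferInstance inferInstance

open Classical in
/-- The ordinal of the number `c` with respect to the base `k`. -/
noncomputable def od (k c : M) : M := if h : 2 ≤ k then (odR_functional h c).choose else 0

theorem odR_iff (hk : 2 ≤ k) {d : M} : OdR k c d ↔ d = od k c := by
  rw [od, dif_pos hk]
  exact (odR_functional hk c).choose_spec d

instance {f g : (ℕ → M) → M} [hf : DfnF f] [hg : DfnF g] : DfnF fun e => od (f e) (g e) :=
  DfnF.comp2 (F := od) (Dfn.congr (P := fun e => 2 ≤ e 1 ∧ OdR (e 1) (e 2) (e 0) ∨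
    ¬2 ≤ e 1 ∧ e 0 = 0) inferInstance fun e => by
      by_cases h : 2 ≤ e 1
      · simp [h, odR_iff h]
      · simp [h, od]) hf hg

theorem od_zero (hk : 2 ≤ k) : od k 0 = 0 :=
  ((odR_iff hk).1 (recStep_zero.2 rfl)).symm

/-- The leading term of the ordinal, followed by `ρ`. -/
noncomputable def odTerm (k a b ρ : M) : M := ordTerm k a b (od k a) (od k b) ρ

theorem Lead.nf_eq {a b : M} (hk : 2 ≤ k) (h : Lead k c a b) :
    (nf k c).1 = a ∧ (nf k c).2.1 = b := by
  obtain ⟨m, n, h⟩ := h.exists_nf hk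
  rw [h.eq_nf hk]
  exact ⟨rfl, rfl⟩

theorem Lead.od_eq {a b r : M} (hk : 2 ≤ k) (h : Lead k c a b) (hr : c = ack k a b + r) :
    od k c = odTerm k a b (od k r) := by
  obtain ⟨ha, hb⟩ := h.nf_eq hk
  have hr' : rest k c = r := by
    refine add_left_cancel (a := ack k a b) ?_
    rw [← hr]
    have := rest_spec hk (h.pos hk)
    rw [ha, hb] at this
    exact this.symm
  refine ((odR_iff hk).1 ((recStep_pos (h.pos hk)).2
    ⟨od k a, od k b, od k r, ?_, ?_⟩)).symm
  · rw [ha, hb]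
    rfl
  · rw [ha, hb, hr']
    exact ⟨(odR_iff hk).2 rfl, (odR_iff hk).2 rfl, (odR_iff hk).2 rfl⟩

theorem exists_od_eq (hk : 2 ≤ k) (hc : 0 < c) : ∃ a b r, Lead k c a b ∧ c = ack k a b + r ∧
    a < c ∧ b < c ∧ r < c ∧ od k c = odTerm k a b (od k r) :=
  have h := (nf_spec hk hc).lead
  ⟨_, _, _, h, rest_spec hk hc, h.index_lt hk, h.arg_lt hk, rest_lt hk hc,
    h.od_eq hk (rest_spec hk hc)⟩

set_option synthInstance.maxSize 2000 in
set_option synthInstance.maxHeartbeats 800000 in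
instance {f g h l : (ℕ → M) → M} [hf : DfnF f] [hg : DfnF g] [hh : DfnF h] [hl : DfnF l] :
    DfnF fun e => odTerm (f e) (g e) (h e) (l e) :=
  DfnF.comp4 (by unfold odTerm; infer_instance) hf hg hh hl

theorem odTerm_zero (k a ρ : M) : odTerm k a 0 ρ = ordn 1 (od k a) ρ := if_pos rfl

theorem odTerm_absorbs {a b : M} (hb : 0 < b) (h : Absorbs k a b) (ρ : M) :
    odTerm k a b ρ = ordn 0 (od k b) ρ := by
  rw [odTerm, ordTerm, if_neg hb.ne', if_pos h]

theorem odTerm_not_absorbs {a b : M} (hb : 0 < b) (h : ¬Absorbs k a b) (ρ : M) :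
    odTerm k a b ρ = ordn 0 (ordn 1 (od k a) (od k b)) ρ := by
  rw [odTerm, ordTerm, if_neg hb.ne', if_neg h]

/-- The type and the exponent do not depend on the tail, so tails can be compared or exchanged
without distinguishing cases. -/
theorem odTerm_form (k a b : M) : ∃ t x, ∀ ρ, odTerm k a b ρ = ordn t x ρ := by
  by_cases hb : b = 0
  · exact ⟨_, _, fun ρ => by rw [hb, odTerm_zero]⟩
  · by_cases h : Absorbs k a b
    · exact ⟨_, _, fun ρ => odTerm_absorbs (pos_iff_ne_zero.2 hb) h ρ⟩
    · exact ⟨_, _, fun ρ => odTerm_not_absorbs (pos_iff_ne_zero.2 hb) h ρ⟩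

theorem odTerm_tail {a b ρ ρ' : M} (h : OrdLt ρ ρ') : OrdLt (odTerm k a b ρ) (odTerm k a b ρ') := by
  obtain ⟨t, x, hf⟩ := odTerm_form k a b
  rw [hf, hf]
  exact ordLt_tail h

theorem zero_ordLt_od (hk : 2 ≤ k) (hc : 0 < c) : OrdLt 0 (od k c) := by
  obtain ⟨a, b, r, -, -, -, -, -, h⟩ := exists_od_eq hk hc
  obtain ⟨t, x, hf⟩ := odTerm_form k a b
  rw [h, hf]
  exact zero_ordLt _ _ _

theorem od_ne_zero (hk : 2 ≤ k) (hc : 0 < c) : od k c ≠ 0 := by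
  obtain ⟨a, b, r, -, -, -, -, -, h⟩ := exists_od_eq hk hc
  obtain ⟨t, x, hf⟩ := odTerm_form k a b
  rw [h, hf]
  exact ordn_ne_zero _ _ _

/-- In the absorbing case the exponent is itself a term with the same index and a smaller positive
argument. Comparisons with epsilon numbers can thus be proved by induction on the argument. -/
theorem Absorbs.od_eq {a b : M} (hk : 2 ≤ k) (hb : 0 < b) (h : Absorbs k a b) :
    ∃ b' r, 0 < b' ∧ b' < b ∧ od k b = odTerm k a b' (od k r) := by
  obtain ⟨a', b', r, h1, h2, h3, h4, h5, h6⟩ := exists_od_eq hk hb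
  obtain ⟨e1, e2⟩ := h1.nf_eq hk
  obtain ⟨rfl, h8⟩ := h
  rw [e1, h6]
  exact ⟨b', r, e2 ▸ h8, h4, rfl⟩

/-- An epsilon number is below the leading terms of a larger index, and below those of the same
index and a positive argument. -/
theorem epsilon_ordLt_odTerm (hk : 2 ≤ k) {a a' : M} (b : M)
    (h : OrdLt (od k a') (od k a) ∨ a' = a ∧ 0 < b) (ρ ρ' : M) :
    OrdLt (ordn 1 (od k a') ρ) (odTerm k a b ρ') := by
  refine strong_induction (fun b => ∀ ρ ρ', OrdLt (od k a') (od k a) ∨ a' = a ∧ 0 < b →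
    OrdLt (ordn 1 (od k a') ρ) (odTerm k a b ρ')) (fun b ih ρ ρ' h => ?_) b ρ ρ' h
  rcases eq_or_ne b 0 with rfl | hb
  · rw [odTerm_zero]
    exact ordLt_head (h.resolve_right fun h => h.2.false)
  · have hb := pos_iff_ne_zero.2 hb
    by_cases hA : Absorbs k a b
    · rw [odTerm_absorbs hb hA]
      obtain ⟨b', r, h1, h2, h3⟩ := hA.od_eq hk hb
      rw [h3]
      exact epsilon_ordLt (ih b' h2 _ _ (h.imp_right fun h => ⟨h.1, h1⟩))
    · rw [odTerm_not_absorbs hb hA]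
      refine epsilon_ordLt ?_
      rcases h with h | ⟨rfl, -⟩
      · exact ordLt_head h
      · exact ordLt_tail (zero_ordLt_od hk hb)

/-- The leading terms of a smaller index are below an epsilon number. -/
theorem odTerm_ordLt_epsilon (hk : 2 ≤ k) {a a' : M} (h : OrdLt (od k a') (od k a)) (b : M)
    (ρ ρ' : M) : OrdLt (odTerm k a' b ρ) (ordn 1 (od k a) ρ') := by
  refine strong_induction (fun b => ∀ ρ ρ', OrdLt (odTerm k a' b ρ) (ordn 1 (od k a) ρ'))
    (fun b ih ρ ρ' => ?_) b ρ ρ'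
  rcases eq_or_ne b 0 with rfl | hb
  · rw [odTerm_zero]
    exact ordLt_head h
  · have hb := pos_iff_ne_zero.2 hb
    by_cases hA : Absorbs k a' b
    · rw [odTerm_absorbs hb hA]
      obtain ⟨b', r, h1, h2, h3⟩ := hA.od_eq hk hb
      rw [h3]
      exact ordLt_epsilon (ih b' h2 _ _)
    · rw [odTerm_not_absorbs hb hA]
      exact ordLt_epsilon (ordLt_head h)

/-- Leading terms are ordered lexicographically. -/
theorem odTerm_lex (hk : 2 ≤ k) {c d a b a' b' : M} (h : Lead k c a b) (h' : Lead k d a' b')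
    (hM : ∀ x < c, ∀ y < x, OrdLt (od k y) (od k x)) (hlt : a' < a ∨ a' = a ∧ b' < b) (ρ ρ' : M) :
    OrdLt (odTerm k a' b' ρ) (odTerm k a b ρ') := by
  have hac := h.index_lt hk
  have hbc := h.arg_lt hk
  rcases eq_or_ne b 0 with rfl | hb
  · rw [odTerm_zero]
    rcases hlt with hlt | ⟨-, hlt⟩
    · exact odTerm_ordLt_epsilon hk (hM a hac a' hlt) _ _ _
    · exact (not_lt_zero hlt).elim
  have hb := pos_iff_ne_zero.2 hb
  rcases eq_or_ne b' 0 with rfl | hb'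
  · rw [odTerm_zero]
    exact epsilon_ordLt_odTerm hk b (hlt.imp (hM a hac a') fun h => ⟨h.1, hb⟩) _ _
  have hb' := pos_iff_ne_zero.2 hb'
  have index_le : ∀ {c a b : M}, Lead k c a b → 0 < b → (nf k b).1 ≤ a := by
    intro c a b h hb
    rcases (nf_spec hk hb).lead.lex hk h (h.arg_lt hk).le with h1 | h1
    · exact h1.le
    · exact h1.1.le
  by_cases hA' : Absorbs k a' b' <;> by_cases hA : Absorbs k a b
  · rw [odTerm_absorbs hb' hA', odTerm_absorbs hb hA]
    -- Both exponents are ordinals of arguments, so `b' < b` must be shown. For `a' < a` this holds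
    -- because absorption makes `a'` and `a` the leading indices of `b'` and `b`.
    refine ordLt_head (hM b hbc b' ?_)
    rcases hlt with hlt | hlt
    · by_contra! hle
      rcases (nf_spec hk hb).lead.lex hk (nf_spec hk hb').lead hle with h1 | h1
      · rw [← hA.1, ← hA'.1] at h1
        exact h1.asymm hlt
      · rw [← hA.1, ← hA'.1] at h1
        exact hlt.ne' h1.1
    · exact hlt.2
  · rw [odTerm_absorbs hb' hA', odTerm_not_absorbs hb hA]
    refine ordLt_head ?_
    rcases hlt with hlt | ⟨rfl, hlt⟩
    · obtain ⟨b₁, r, h1, h2, h3⟩ := hA'.od_eq hk hb'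
      rw [h3]
      exact odTerm_ordLt_epsilon hk (hM a hac a' hlt) _ _ _
    -- This case cannot occur: `b` has leading index at most `a`, and it exceeds `b'`, whose leading
    -- term has index `a` and a positive argument. So `b` absorbs as well.
    · refine (hA ?_).elim
      have h1 := index_le h hb
      rcases (nf_spec hk hb').lead.lex hk (nf_spec hk hb).lead hlt.le with h2 | ⟨h2, h3⟩
      · rw [← hA'.1] at h2
        exact (h2.not_ge h1).elim
      · rw [← hA'.1] at h2
        exact ⟨h2, hA'.2.trans_le h3⟩
  · rw [odTerm_not_absorbs hb' hA', odTerm_absorbs hb hA]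
    obtain ⟨b₁, r, h1, h2, h3⟩ := hA.od_eq hk hb
    rw [h3]
    exact ordLt_head (epsilon_ordLt_odTerm hk b₁
      (hlt.imp (hM a hac a') fun h => ⟨h.1, h1⟩) _ _)
  · rw [odTerm_not_absorbs hb' hA', odTerm_not_absorbs hb hA]
    refine ordLt_head ?_
    rcases hlt with hlt | ⟨rfl, hlt⟩
    · exact ordLt_head (hM a hac a' hlt)
    · exact ordLt_tail (hM b hbc b' hlt)

/-- Leading terms are compared first, with the induction hypothesis as the monotonicity assumption
of `odTerm_lex`. If they agree, the rests decide, and they are smaller numbers. -/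
theorem od_strictMono (hk : 2 ≤ k) {c d : M} (h : d < c) : OrdLt (od k d) (od k c) := by
  refine strong_induction (fun c => ∀ d < c, OrdLt (od k d) (od k c)) (fun c ih d hd => ?_) c d h
  obtain ⟨a, b, r, h1, h2, ha, hb, hr, h3⟩ := exists_od_eq hk (zero_le.trans_lt hd)
  rcases eq_or_ne d 0 with rfl | hd0
  · rw [od_zero hk]
    exact zero_ordLt_od hk hd
  obtain ⟨a', b', r', h1', h2', ha', hb', hr', h3'⟩ := exists_od_eq hk (pos_iff_ne_zero.2 hd0)
  rw [h3, h3']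
  rcases h1'.lex hk h1 hd.le with hlt | ⟨rfl, hle⟩
  · exact odTerm_lex hk h1 h1' ih (Or.inl hlt) _ _
  rcases hle.lt_or_eq with hlt | rfl
  · exact odTerm_lex hk h1 h1' ih (Or.inr ⟨rfl, hlt⟩) _ _
  · rw [h2, h2'] at hd
    exact odTerm_tail (ih r hr _ (lt_of_add_lt_add_left hd))

theorem tailLe_od (hk : 2 ≤ k) {t x : M} (h : ∀ a b, 0 < c → Lead k c a b →
    odTerm k a b 0 = ordn t x 0 ∨ OrdLt (odTerm k a b 0) (ordn t x 0)) : TailLe t x (od k c) := by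
  rcases eq_or_ne c 0 with rfl | hc
  · exact Or.inl (od_zero hk)
  · have hc := pos_iff_ne_zero.2 hc
    obtain ⟨a, b, r, h1, -, -, -, -, h2⟩ := exists_od_eq hk hc
    obtain ⟨t', x', hf⟩ := odTerm_form k a b
    have h3 := h a b hc h1
    rw [hf] at h2 h3
    exact Or.inr ⟨t', x', _, h2, h3⟩

/-- Summands do not increase because the leading term of the rest is at most that of `c`. An
exponent under `ω` is never a bare epsilon number: in the absorbing case it starts with an
`ω`-power, in the other it is `ε_α + β` with `β ≠ 0`. -/
theorem ordNF_od (hk : 2 ≤ k) (c : M) : OrdNF (od k c) := by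
  refine strong_induction (fun c => OrdNF (od k c)) (fun c ih => ?_) c
  have hmono : ∀ x < c, ∀ y < x, OrdLt (od k y) (od k x) := fun x _ y hy => od_strictMono hk hy
  rcases eq_or_ne c 0 with rfl | hc
  · rw [od_zero hk]
    exact ordNF_zero
  obtain ⟨a, b, r, h1, h2, ha, hb, hr, h3⟩ := exists_od_eq hk (pos_iff_ne_zero.2 hc)
  rw [h3]
  have htail : ∀ t x, (∀ ρ, odTerm k a b ρ = ordn t x ρ) → TailLe t x (od k r) := by
    refine fun t x hf => tailLe_od hk fun a' b' _ h' => ?_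
    rw [← hf]
    rcases h'.lex hk h1 hr.le with hlt | ⟨rfl, hle⟩
    · exact Or.inr (odTerm_lex hk h1 h' hmono (Or.inl hlt) _ _)
    rcases hle.lt_or_eq with hlt | rfl
    · exact Or.inr (odTerm_lex hk h1 h' hmono (Or.inr ⟨rfl, hlt⟩) _ _)
    · exact Or.inl rfl
  rcases eq_or_ne b 0 with rfl | hb0
  · rw [odTerm_zero]
    exact ordNF_ordn (Or.inr rfl) (ih a ha) (ih r hr) (fun h => (one_ne_zero h).elim)
      (htail _ _ fun ρ => odTerm_zero _ _ _)
  have hb0 := pos_iff_ne_zero.2 hb0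
  by_cases hA : Absorbs k a b
  · rw [odTerm_absorbs hb0 hA]
    refine ordNF_ordn (Or.inl rfl) (ih b hb) (ih r hr) (fun _ => ?_)
      (htail _ _ fun ρ => odTerm_absorbs hb0 hA ρ)
    rintro ⟨u, hu⟩
    obtain ⟨b', r', h4, -, h5⟩ := hA.od_eq hk hb0
    rw [h5] at hu
    by_cases hA' : Absorbs k a b'
    · rw [odTerm_absorbs h4 hA', ordn_inj] at hu
      exact zero_ne_one hu.1
    · rw [odTerm_not_absorbs h4 hA', ordn_inj] at hu
      exact zero_ne_one hu.1
  · rw [odTerm_not_absorbs hb0 hA]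
    refine ordNF_ordn (Or.inl rfl) (ordNF_ordn (Or.inr rfl) (ih a ha) (ih b hb)
      (fun h => (one_ne_zero h).elim) ?_) (ih r hr) (fun _ => ?_)
      (htail _ _ fun ρ => odTerm_not_absorbs hb0 hA ρ)
    -- The sum `ε_α + β` is in normal form: without absorption, the leading term of `β` has a
    -- smaller index than `a`, or index `a` and argument `0`, in which case it is `ε_α`.
    · refine tailLe_od hk fun a' b' _ h' => ?_
      rcases h'.lex hk h1 hb.le with hlt | ⟨rfl, -⟩
      · exact Or.inr (odTerm_ordLt_epsilon hk (od_strictMono hk hlt) _ _ _)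
      · rcases eq_or_ne b' 0 with rfl | hb'
        · exact Or.inl (odTerm_zero _ _ _)
        · obtain ⟨e1, e2⟩ := h'.nf_eq hk
          exact (hA ⟨e1.symm, e2 ▸ pos_iff_ne_zero.2 hb'⟩).elim
    · rintro ⟨u, hu⟩
      exact od_ne_zero hk hb0 (ordn_inj.1 hu).2.2

/-- The base change preserves ordinals. -/
theorem od_bc (hk : 2 ≤ k) (c : M) : od (k + 1) (bc k c) = od k c := by
  have hk' := two_le_succ hk
  refine strong_induction (fun c => od (k + 1) (bc k c) = od k c) (fun c ih => ?_) c
  rcases eq_or_ne c 0 with rfl | hc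
  · rw [bc_zero hk, od_zero hk, od_zero hk']
  obtain ⟨a, b, r, h1, h2, ha, hb, hr, h3⟩ := exists_od_eq hk (pos_iff_ne_zero.2 hc)
  rw [h3, (h1.bc hk).od_eq hk' (h1.bc_eq hk h2), odTerm, odTerm, ih a ha, ih b hb, ih r hr]
  -- The notation depends on `a` and `b` beyond their ordinals only through the tests `b = 0` and
  -- `Absorbs`. Both are invariant, since the base change is injective, fixes `0` and preserves
  -- leading terms.
  have hb0 : bc k b = 0 ↔ b = 0 := by
    rw [← bc_zero hk, (bc_strictMono hk).injective.eq_iff]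
    simp [bc_zero hk]
  rcases eq_or_ne b 0 with rfl | hb'
  · simp [ordTerm, bc_zero hk]
  have hA : Absorbs (k + 1) (bc k a) (bc k b) ↔ Absorbs k a b := by
    have h4 := (nf_spec hk (pos_iff_ne_zero.2 hb')).lead
    obtain ⟨e1, e2⟩ := (h4.bc hk).nf_eq hk'
    rw [Absorbs, Absorbs, e1, e2, (bc_strictMono hk).injective.eq_iff]
    nth_rw 1 [← bc_zero hk]
    rw [(bc_strictMono hk).lt_iff_lt]
  by_cases h : Absorbs k a b <;> simp [ordTerm, hb0, hA, h]

end Ordinals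

/-! ### The arithmetized predicates in a model -/

section Realizations

variable {M : PAModel}

theorem realize_ackClauses (e : ℕ → M) :
    ackClauses.Realize e ↔ AckStep (e 4) (fun z => Mem z (e 1) (e 2) (e 3)) (e 0) := by
  simp [ackClauses, disj, conj, exs, tup, realize_ex, realize_known, realize_pair, realize_S,
    realize_times, realize_v, realize_O, realize_eqF, AckStep]

theorem realize_ackF (a k b c : Tm) (e : ℕ → M) : (ackF a k b c).Realize e ↔
    c.realize e = ack (k.realize e) (a.realize e) (b.realize e) := by
  rw [← ackR_iff, ackF, realize_ap, realize_ap, realize_inductiveF _ (AckStep (k.realize e))]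
  · simp [AckR, tup, realize_pair, realize_v, realize_O]
  · intro e' he'
    rw [realize_ackClauses, he' 0]
    rfl

theorem realize_nfF (k c a b m n : Tm) (e : ℕ → M) : (nfF k c a b m n).Realize e ↔
    NF (k.realize e) (c.realize e) (a.realize e) (b.realize e) (m.realize e) (n.realize e) := by
  simp [nfF, realize_ap, conj, exs, realize_ex, realize_ackF, realize_v, realize_O, realize_S,
    realize_eqF, realize_plus, realize_times, realize_leF, realize_ltF, NF]

/-- The formula quantifies over the components of a normal form, while `RecStep` uses the function
`nf`. They agree by uniqueness, which requires `2 ≤ k`. -/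
theorem realize_baseChangeClauses (e : ℕ → M) (hk : 2 ≤ e 4) :
    baseChangeClauses.Realize e ↔ RecStep (fun c => (nf (e 4) c).1) (fun c => (nf (e 4) c).2.1)
      (fun c => (nf (e 4) c).2.2.2)
      (fun c x y z => ack (e 4 + 1) x y * (nf (e 4) c).2.2.1 + z)
      (fun z => Mem z (e 1) (e 2) (e 3)) (e 0) := by
  simp [baseChangeClauses, disj, conj, exs, tup, realize_ex, realize_known, realize_pair, realize_S,
    realize_times, realize_plus, realize_v, realize_O, realize_eqF, realize_nfF, realize_ackF,
    RecStep]
  refine or_congr Iff.rfl ⟨?_, ?_⟩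
  · rintro ⟨c, a, b, m, n, x₁, x₂, x₃, h, hnf, h'⟩
    have h1 := hnf.eq_nf hk
    refine ⟨c, x₁, x₂, x₃, ?_, hnf.lead.pos hk, ?_⟩ <;> rw [h1]
    exacts [h, h']
  · rintro ⟨c, x₁, x₂, x₃, h, hc, h'⟩
    exact ⟨c, _, _, _, _, x₁, x₂, x₃, h, nf_spec hk hc, h'⟩

theorem realize_baseChangeF (k c d : Tm) (e : ℕ → M) (hk : 2 ≤ k.realize e) :
    (baseChangeF k c d).Realize e ↔ d.realize e = bc (k.realize e) (c.realize e) := by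
  rw [← bcR_iff hk, baseChangeF, realize_ap, realize_ap, realize_inductiveF _ (RecStep
    (fun c => (nf (k.realize e) c).1) (fun c => (nf (k.realize e) c).2.1)
    (fun c => (nf (k.realize e) c).2.2.2)
    (fun c x y z => ack (k.realize e + 1) x y * (nf (k.realize e) c).2.2.1 + z))]
  · simp [BcR, tup, realize_pair, realize_v]
  · intro e' he'
    have h : e' 4 = k.realize e := he' 0
    rw [← h] at hk ⊢
    exact realize_baseChangeClauses e' hk

/-- The clauses for the Goodstein process that starts with `l`. -/
def GoodsteinStep (l : M) (K : M → Prop) (z : M) : Prop :=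
  z = pr 0 l ∨ (∃ k, z = pr (k + 1) 0 ∧ K (pr k 0)) ∨
    ∃ k y y', z = pr (k + 1) y' ∧ K (pr k y) ∧ 0 < y ∧ y' + 1 = bc (k + 2) y

theorem goodsteinStep_finitary (l : M) : Finitary (GoodsteinStep l) := by
  rintro K z (h | ⟨k, h, h1⟩ | ⟨k, y, y', h, h1, h2, h3⟩)
  · exact ⟨[], by simp, fun K' _ => Or.inl h⟩
  · exact ⟨[_], by simpa using h1, fun K' hK => Or.inr (Or.inl ⟨k, h, hK _ (by simp)⟩)⟩
  · exact ⟨[_], by simpa using h1, fun K' hK => Or.inr (Or.inr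
      ⟨k, y, y', h, hK _ (by simp), h2, h3⟩)⟩

/-- The graph of the Goodstein process. -/
def GoodsteinR (l k y : M) : Prop := IndPred (GoodsteinStep l) (pr k y)

set_option synthInstance.maxSize 2000 in
set_option synthInstance.maxHeartbeats 400000 in
instance {f g h : (ℕ → M) → M} [hf : DfnF f] [hg : DfnF g] [hh : DfnF h] :
    Dfn fun e => GoodsteinR (f e) (g e) (h e) :=
  Dfn.comp3 (R := GoodsteinR)
    (by unfold GoodsteinR IndPred GoodsteinStep; beta_reduce; infer_instance) hf hg hh

theorem two_le_add_two (k : M) : 2 ≤ k + 2 := le_add_self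

theorem add_one_add_one (k : M) : k + 1 + 1 = k + 2 := by
  ring

theorem realize_goodsteinClauses (e : ℕ → M) : goodsteinClauses.Realize e ↔
    GoodsteinStep (e 4) (fun z => Mem z (e 1) (e 2) (e 3)) (e 0) := by
  have h : ∀ e : ℕ → M, (baseChangeF (S (S (v 5))) (v 6) (S (v 7))).Realize e ↔
      e 7 + 1 = bc (e 5 + 2) (e 6) := by
    intro e
    have h1 : (S (S (v 5))).realize e = e 5 + 2 := by
      rw [realize_S, realize_S, realize_v, add_one_add_one]
    rw [realize_baseChangeF _ _ _ _ (h1 ▸ two_le_add_two _), h1, realize_S, realize_v, realize_v]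
  simp [goodsteinClauses, disj, conj, exs, tup, realize_ex, realize_known, realize_pair, realize_S,
    realize_v, realize_O, realize_eqF, realize_ltF, h, GoodsteinStep]

theorem realize_goodsteinF (l k y : Tm) (e : ℕ → M) : (goodsteinF l k y).Realize e ↔
    GoodsteinR (l.realize e) (k.realize e) (y.realize e) := by
  rw [goodsteinF, realize_ap, realize_ap,
    realize_inductiveF _ (GoodsteinStep (l.realize e))]
  · simp [GoodsteinR, tup, realize_pair, realize_v]
  · intro e' he'
    rw [realize_goodsteinClauses, he' 0]
    rfl

theorem realize_terminationF (e : ℕ → M) :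
    terminationF.Realize e ↔ ∀ l : M, ∃ k, GoodsteinR l k 0 := by
  simp [terminationF, realize_all, realize_ex, realize_goodsteinF, realize_v, realize_O]

theorem realize_ordLtClauses (e : ℕ → M) :
    ordLtClauses.Realize e ↔ OrdLtStep (fun z => Mem z (e 1) (e 2) (e 3)) (e 0) := by
  simp [ordLtClauses, ord, ordn, disj, conj, exs, tup, realize_ex, realize_known, realize_pair,
    realize_S, realize_v, realize_O, realize_eqF, OrdLtStep]

theorem realize_ordLtF (x y : Tm) (e : ℕ → M) :
    (ordLtF x y).Realize e ↔ OrdLt (x.realize e) (y.realize e) := by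
  rw [ordLtF, realize_ap, realize_inductiveF _ OrdLtStep]
  · simp [OrdLt, realize_pair]
  · exact fun e' _ => realize_ordLtClauses e'

theorem realize_ordNFClauses (e : ℕ → M) :
    ordNFClauses.Realize e ↔ OrdNFStep (fun z => Mem z (e 1) (e 2) (e 3)) (e 0) := by
  simp [ordNFClauses, ord, ordn, disj, conj, exs, tup, realize_ex, realize_known, realize_pair,
    realize_S, realize_v, realize_O, realize_eqF, realize_ordLtF, OrdNFStep, TailLe]

theorem realize_ordNFF (x : Tm) (e : ℕ → M) :
    (ordNFF x).Realize e ↔ OrdNF (x.realize e) := by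
  rw [ordNFF, realize_ap, realize_inductiveF _ OrdNFStep]
  · simp [OrdNF]
  · exact fun e' _ => realize_ordNFClauses e'

/-- Transfinite induction in a model, for definable properties. -/
theorem transfinite_induction (hM : ∀ ψ ∈ TI, ∀ e : ℕ → M, ψ.Realize e) (P : M → Prop)
    [hP : Dfn fun e : ℕ → M => P (e 0)]
    (h : ∀ x, OrdNF x → (∀ y, OrdNF y → OrdLt y x → P y) → P x) (x : M) (hx : OrdNF x) : P x := by
  obtain ⟨φ, p, hφ⟩ := exists_params hP (fun _ => 0) 1
  -- The schema shifts the parameters by one to free variable `1`, so they are read from variable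
  -- `2` on.
  have h1 : ∀ (i : ℕ) (e : ℕ → M), (∀ j, e (j + 2) = p j) →
      (Formula.Realize (φ.subst fun j => if j = 0 then v i else v (j + 1)) e ↔ P (e i)) := by
    intro i e he
    rw [Formula.Realize, BoundedFormula.realize_subst]
    exact hφ _ fun j => he j
  have h2 := hM _ ⟨φ, rfl⟩ fun i => p (i - 2)
  simp only [transfiniteInductionF, Formula.realize_imp, realize_all, realize_ordNFF,
    realize_ordLtF, realize_v] at h2
  have h3 := h2 fun x hx hlt => by
    rw [h1 0 _ fun j => by simp]
    refine h x hx fun y hy hyx => ?_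
    have := hlt y hy hyx
    rw [h1 1 _ fun j => by simp] at this
    exact this
  have h4 := h3 x hx
  rw [h1 0 _ fun j => by simp] at h4
  exact h4

/-- Transfinite induction on the notation of the current value, for all stages `k` of the process at
once. Only the existence of the next stage is used, so uniqueness of the values is not needed. -/
theorem goodsteinR_terminates (hM : ∀ ψ ∈ TI, ∀ e : ℕ → M, ψ.Realize e) (l : M) :
    ∃ k, GoodsteinR l k 0 := by
  have key : ∀ x : M, OrdNF x → ∀ k y, GoodsteinR l k y → od (k + 2) y = x →
      ∃ j, GoodsteinR l j 0 := by
    have : Dfn fun e : ℕ → M => ∀ k y, GoodsteinR l k y → od (k + 2) y = e 0 →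
        ∃ j, GoodsteinR l j 0 := inferInstance
    refine transfinite_induction hM (fun x => ∀ k y, GoodsteinR l k y → od (k + 2) y = x →
      ∃ j, GoodsteinR l j 0) ?_
    rintro x hx ih k y hy rfl
    rcases eq_or_ne y 0 with rfl | hy0
    · exact ⟨k, hy⟩
    have hk := two_le_add_two k
    have h1 : bc (k + 2) y ≠ 0 := fun h =>
      hy0 ((bc_strictMono hk).injective (h.trans (bc_zero hk).symm))
    obtain ⟨y', h2⟩ := (eq_zero_or_succ _).resolve_left h1
    have h3 : od (k + 1 + 2) (bc (k + 2) y) = od (k + 2) y := by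
      rw [← od_bc hk, add_right_comm]
    refine ih (od (k + 1 + 2) y') (ordNF_od (two_le_add_two _) _) ?_ (k + 1) y' ?_ rfl
    · rw [← h3, h2]
      exact od_strictMono (two_le_add_two _) (lt_add_one' y')
    · exact IndPred.fold (goodsteinStep_finitary l)
        (Or.inr (Or.inr ⟨k, y, y', rfl, hy, pos_iff_ne_zero.2 hy0, h2.symm⟩))
  exact key _ (ordNF_od (two_le_add_two 0) l) 0 l
    (IndPred.fold (goodsteinStep_finitary l) (Or.inl rfl)) rfl

end Realizations

theorem provable_terminationF : Provable (PA ∪ TI) terminationF :=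
  provable_of_models fun M _ _ hM e =>
    (realize_terminationF (M := ⟨M, fun ψ h => hM ψ (Or.inl h)⟩) e).2
      (goodsteinR_terminates fun ψ h => hM ψ (Or.inr h))

/-- Stated for all models so that it can be read in the standard one. -/
theorem NF.bc {M : PAModel} {k c a b m n : M} (hk : 2 ≤ k) (h : NF k c a b m n) :
    NF (k + 1) (bc k c) (bc k a) (bc k b) m (bc k n) :=
  have h' := h.lead.bc hk
  ⟨h.bc_eq hk, h'.1, h'.2.1, h'.2.2.1, h'.2.2.2, ((good hk c).2.2 _ _ _ _ h).1⟩

/-! ### The standard model -/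

section Standard

/-- The standard interpretation of the language of arithmetic. -/
instance : arith.Structure ℕ where
  funMap f := match f with
    | .zero => fun _ => 0
    | .succ => fun x => x 0 + 1
    | .add => fun x => x 0 + x 1
    | .mul => fun x => x 0 * x 1
  RelMap r := nomatch r

/-- The standard model of Peano arithmetic. -/
def std : PAModel where
  carrier := ℕ
  realize_of_mem := by
    have hO : ∀ e : ℕ → ℕ, O.realize e = 0 := fun _ => rfl
    have hS : ∀ (t : Tm) (e : ℕ → ℕ), (S t).realize e = t.realize e + 1 := fun _ _ => rfl
    have hplus : ∀ (s t : Tm) (e : ℕ → ℕ), (plus s t).realize e = s.realize e + t.realize e :=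
      fun _ _ _ => rfl
    have htimes : ∀ (s t : Tm) (e : ℕ → ℕ), (times s t).realize e = s.realize e * t.realize e :=
      fun _ _ _ => rfl
    have hv : ∀ (i : ℕ) (e : ℕ → ℕ), (v i).realize e = e i := fun _ _ => rfl
    have hE : ∀ (s t : Tm) (e : ℕ → ℕ), (eqF s t).Realize e ↔ s.realize e = t.realize e :=
      fun _ _ _ => Formula.realize_equal
    have hbot : ∀ e : ℕ → ℕ, ¬(⊥ : Fm).Realize e := fun _ h => h
    rintro ψ (h | ⟨φ, rfl⟩) e
    · rcases h with rfl | rfl | rfl | rfl | rfl | rfl <;>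
        simp only [Formula.realize_imp, hE, hO, hS, hplus, htimes, hv]
      · simp [hbot]
      · exact Nat.succ.inj
      · rfl
      · exact (Nat.add_assoc _ _ _).symm
      · exact Nat.mul_zero _
      · exact Nat.mul_succ _ _
    · simp only [inductionF, Formula.realize_imp, realize_all, realize_ap]
      have key : ∀ (t : Tm) (e : ℕ → ℕ), (fun i => ([t].getD i (v i)).realize e) =
          Function.update e 0 (t.realize e) := by
        intro t e
        funext i
        rcases i with - | i
        · simp
        · simp [hv]
      simp only [key, hO, hS, hv]
      intro h0 h1 x
      induction x with
      | zero => exact h0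
      | succ x ih => simpa using h1 x ih

theorem ack_std (a k b : ℕ) : ack (M := std) k a b = A a k b := by
  have hiter : ∀ a : ℕ, (∀ x, ack (M := std) k a x = A a k x) → ∀ i x : ℕ,
      iter (M := std) k a i x = (fun x => A a k x)^[i] x := by
    intro a h i x
    induction i with
    | zero => exact iter_zero _ _ _
    | succ i ih =>
      rw [Function.iterate_succ_apply', ← ih, ← h]
      exact iter_succ (M := std) _ _ _ _
  induction a generalizing b with
  | zero =>
    induction b with
    | zero => exact (ack_zero_zero _).trans (by rw [A, pow_zero]; rfl)
    | succ b ih =>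
      refine (ack_zero_succ (M := std) _ _).trans ((congrArg (fun x : ℕ => x * k) ih).trans ?_)
      rw [A, A]
      exact (pow_succ k b).symm
  | succ a iha =>
    induction b with
    | zero =>
      rw [A.eq_2, ← hiter a iha]
      exact ack_succ_zero _ _
    | succ b ih =>
      rw [A.eq_3, ← hiter a iha, ← ih]
      exact ack_succ_succ _ _ _

theorem le_std {x y : ℕ} : (show std from x) ≤ (show std from y) ↔ x ≤ y :=
  ⟨fun ⟨_, h⟩ => Nat.le.intro h, fun h => ⟨y - x, Nat.add_sub_cancel' h⟩⟩

theorem lt_std {x y : ℕ} : (show std from x) < (show std from y) ↔ x < y := by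
  rw [← not_le, ← not_le, le_std]

theorem two_le_std {k : ℕ} : (2 : std) ≤ (show std from k) ↔ 2 ≤ k := by
  rw [← le_std (x := 2), ← one_add_one_eq_two]
  rfl

theorem nf_std {k c a b m n : ℕ} : NF (M := std) k c a b m n ↔ IsNF k c a b m n := by
  have h : NF (M := std) k c a b m n ↔ c = A a k b * m + n ∧ A a k 0 ≤ c ∧ c < A (a + 1) k 0 ∧
      A a k b ≤ c ∧ c < A a k (b + 1) ∧ n < A a k b := by
    rw [← le_std, ← le_std, ← lt_std, ← lt_std, ← lt_std, ← ack_std, ← ack_std, ← ack_std,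
      ← ack_std]
    rfl
  exact h.trans ⟨fun ⟨h1, h2, h3, h4, h5, h6⟩ => ⟨h1, h2, h3, h4, h5, h6⟩,
    fun h => ⟨h.1, h.2, h.3, h.4, h.5, h.6⟩⟩

/-- Both functions obey the same recursion along normal forms. This lets the internal theory speak
about the actual base change. -/
theorem bc_std {k : ℕ} (hk : 2 ≤ k) (c : ℕ) : bc (M := std) k c = baseChange k c := by
  induction c using Nat.strong_induction_on with
  | _ c ih =>
    rcases Nat.eq_zero_or_pos c with rfl | hc
    · exact (bc_zero (two_le_std.2 hk)).trans (baseChange_zero k).symm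
    · obtain ⟨⟨a, b, m, n⟩, h⟩ := IsNF.exists hk hc
      obtain ⟨ha, hb, hn⟩ := h.lt hk
      have h1 : ack (M := std) (k + 1 : ℕ) (bc (M := std) k a) (bc (M := std) k b) =
          A (baseChange k a) (k + 1) (baseChange k b) :=
        (ack_std _ _ _).trans (congrArg₂ (fun x y => A x (k + 1) y) (ih a ha) (ih b hb))
      rw [baseChange_of_isNF hk h]
      exact (NF.bc_eq (M := std) (two_le_std.2 hk) (nf_std.2 h)).trans
        (congrArg₂ (fun x y : ℕ => x * m + y) h1 (ih n hn))

/-- The base change preserves normal forms. -/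
theorem IsNF.baseChange {k c a b m n : ℕ} (hk : 2 ≤ k) (h : IsNF k c a b m n) :
    IsNF (k + 1) (baseChange k c) (baseChange k a) (baseChange k b) m (baseChange k n) := by
  rw [← bc_std hk, ← bc_std hk, ← bc_std hk, ← bc_std hk]
  exact nf_std.1 ((nf_std.2 h).bc (two_le_std.2 hk))

end Standard

/-! ### Termination of the Goodstein process -/

section Termination

open Ordinal

open Classical in
/-- The ordinal of `c` with respect to the base `k`: if `A_a(k, b) * m + n` is the `k`-normal form
of `c`, then it is `ω ^ (ε_α + β) * m + ν`, where `α, β, ν` are the ordinals of `a, b, n`. -/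
noncomputable def toOrdinal (k c : ℕ) : Ordinal.{0} :=
  if h : 2 ≤ k ∧ 0 < c then
    let p := (IsNF.exists h.1 h.2).choose
    ω ^ (epsilon (toOrdinal k p.1) + toOrdinal k p.2.1) * p.2.2.1 + toOrdinal k p.2.2.2
  else 0
termination_by c
decreasing_by
  all_goals
    have hs := IsNF.lt h.1 (IsNF.exists h.1 h.2).choose_spec
  · exact hs.1
  · exact hs.2.1
  · exact hs.2.2

variable {k c a b m n : ℕ}

theorem toOrdinal_zero (k : ℕ) : toOrdinal k 0 = 0 := by
  rw [toOrdinal]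
  simp

theorem IsNF.toOrdinal_eq (hk : 2 ≤ k) (h : IsNF k c a b m n) :
    toOrdinal k c = ω ^ (epsilon (toOrdinal k a) + toOrdinal k b) * m + toOrdinal k n := by
  have hc : 2 ≤ k ∧ 0 < c := ⟨hk, Nat.zero_lt_of_lt (h.lt hk).1⟩
  obtain ⟨h1, h2, h3, h4⟩ := IsNF.unique hk h (IsNF.exists hc.1 hc.2).choose_spec
  have hp : (IsNF.exists hc.1 hc.2).choose = (a, b, m, n) := by
    rw [h1, h2, h3, h4]
  rw [toOrdinal, dif_pos hc]
  dsimp only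
  rw [hp]

theorem toOrdinal_baseChange (hk : 2 ≤ k) (c : ℕ) :
    toOrdinal (k + 1) (baseChange k c) = toOrdinal k c := by
  induction c using Nat.strong_induction_on with
  | _ c ih =>
    rcases Nat.eq_zero_or_pos c with rfl | hc
    · rw [baseChange_zero, toOrdinal_zero, toOrdinal_zero]
    · obtain ⟨⟨a, b, m, n⟩, h⟩ := IsNF.exists hk hc
      obtain ⟨ha, hb, hn⟩ := h.lt hk
      rw [(h.baseChange hk).toOrdinal_eq (by omega), h.toOrdinal_eq hk, ih a ha, ih b hb, ih n hn]

theorem add_lt_omega0_opow {x y o : Ordinal} (hx : x < ω ^ o) (hy : y < ω ^ o) : x + y < ω ^ o :=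
  isPrincipal_add_omega0_opow o hx hy

/-- Powers of `ω` are additively principal, so it suffices to bound the exponent and the remainder.
-/
theorem IsNF.toOrdinal_lt {o : Ordinal} (hk : 2 ≤ k) (h : IsNF k c a b m n)
    (ho : epsilon (toOrdinal k a) + toOrdinal k b < o) (hn : toOrdinal k n < ω ^ o) :
    toOrdinal k c < ω ^ o := by
  rw [h.toOrdinal_eq hk]
  refine add_lt_omega0_opow ?_ hn
  exact (isPrincipal_add_omega0_opow o).mul_natCast_lt
    ((opow_lt_opow_iff_right one_lt_omega0).2 ho) m

theorem add_lt_epsilon {x y o : Ordinal} (hx : x < epsilon o) (hy : y < epsilon o) : x + y < epsilon o := by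
  rw [← omega0_opow_epsilon] at hx hy ⊢
  exact add_lt_omega0_opow hx hy

theorem epsilon_lt_epsilon {x y : Ordinal} (h : x < y) : epsilon x < epsilon y :=
  veblen_lt_veblen_iff_right.2 h

theorem IsNF.index_lt_of_lt {a' : ℕ} (hk : 2 ≤ k) (h : IsNF k c a b m n) (hc : c < A a' k 0) :
    a < a' :=
  (A_zero_strictMono hk).lt_iff_lt.1 (h.index_le.trans_lt hc)

/-- All indices occurring in the normal form of a number below `A_a(k, 0)` are smaller than `a`, and
its argument and remainder are below the same bound. So closure of `ε_α` under addition and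
`ω`-powers gives the claim by induction. -/
theorem toOrdinal_lt_epsilon (hk : 2 ≤ k) (h : ∀ a' < a, toOrdinal k a' < toOrdinal k a) (c : ℕ)
    (hc : c < A a k 0) : toOrdinal k c < epsilon (toOrdinal k a) := by
  induction c using Nat.strong_induction_on with
  | _ c ih =>
    rcases Nat.eq_zero_or_pos c with rfl | hc0
    · rw [toOrdinal_zero]
      exact epsilon_pos _
    · obtain ⟨⟨a', b, m, n⟩, hN⟩ := IsNF.exists hk hc0
      obtain ⟨-, hb, hn⟩ := hN.lt hk
      rw [← omega0_opow_epsilon]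
      refine hN.toOrdinal_lt hk (add_lt_epsilon
        (epsilon_lt_epsilon (h a' (hN.index_lt_of_lt hk hc))) (ih b hb (hb.trans hc))) ?_
      rw [omega0_opow_epsilon]
      exact ih n hn (hn.trans hc)

/-- By `hab` the leading index `a'` of `c` is at most `a`. If it is smaller, its argument is below
`A_{a'+1}(k, 0) ≤ A_a(k, 0)` and the whole exponent stays below `ε_α`; if it equals `a`, the
arguments decide. -/
theorem toOrdinal_lt_opow (hk : 2 ≤ k) (ha : ∀ a' < a, toOrdinal k a' < toOrdinal k a)
    (hb : ∀ b' < b, toOrdinal k b' < toOrdinal k b) (hab : A a k b < A (a + 1) k 0) (c : ℕ)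
    (hc : c < A a k b) : toOrdinal k c < ω ^ (epsilon (toOrdinal k a) + toOrdinal k b) := by
  induction c using Nat.strong_induction_on with
  | _ c ih =>
    rcases Nat.eq_zero_or_pos c with rfl | hc0
    · rw [toOrdinal_zero]
      exact opow_pos _ omega0_pos
    · obtain ⟨⟨a', b', m, n⟩, hN⟩ := IsNF.exists hk hc0
      obtain ⟨-, hb', hn⟩ := hN.lt hk
      refine hN.toOrdinal_lt hk ?_ (ih n hn (hn.trans hc))
      dsimp only at hN hb' ⊢
      rcases (Nat.lt_succ_iff.1 (hN.index_lt_of_lt hk (hc.trans hab))).lt_or_eq with hlt | rfl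
      · refine lt_of_lt_of_le (add_lt_epsilon (epsilon_lt_epsilon (ha a' hlt)) ?_) le_self_add
        refine toOrdinal_lt_epsilon hk ha b' ((hb'.trans hN.lt_index).trans_le ?_)
        exact (A_zero_strictMono hk).monotone hlt
      · refine add_lt_add_right (hb b' ?_) _
        exact (A_strictMono_and_lt hk a').1.lt_iff_lt.1 (hN.arg_le.trans_lt hc)

theorem toOrdinal_strictMono (hk : 2 ≤ k) : StrictMono (toOrdinal k) := by
  intro d c hd
  induction c using Nat.strong_induction_on generalizing d with
  | _ c ih =>
    obtain ⟨⟨a, b, m, n⟩, hN⟩ := IsNF.exists hk (Nat.zero_lt_of_lt hd)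
    dsimp only at hN
    obtain ⟨ha, hb, hn⟩ := hN.lt hk
    have key := toOrdinal_lt_opow hk (fun a' h => ih a ha h) (fun b' h => ih b hb h)
      (hN.arg_le.trans_lt hN.lt_index)
    have hA : 0 < A a k b := Nat.zero_lt_of_lt hN.rem_lt
    rcases lt_or_ge d (A a k b) with hlt | hge
    · have hm : m ≠ 0 := by
        rintro rfl
        have := hN.eq
        have := hN.arg_le
        have := hN.rem_lt
        omega
      refine (key d hlt).trans_le ?_
      rw [hN.toOrdinal_eq hk]
      refine le_trans ?_ le_self_add
      exact le_mul_of_one_le_right (zero_le) (by exact_mod_cast Nat.one_le_iff_ne_zero.2 hm)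
    -- Between its leading term and `c`, the number `d` has the same leading term, so quotients are
    -- compared first and then remainders.
    · have hD : IsNF k d a b (d / A a k b) (d % A a k b) :=
        ⟨(Nat.div_add_mod _ _).symm, ((A_strictMono_and_lt hk a).1.monotone b.zero_le).trans hge,
          hd.trans hN.lt_index, hge, hd.trans hN.lt_arg, Nat.mod_lt _ hA⟩
      rw [hN.toOrdinal_eq hk, hD.toOrdinal_eq hk]
      have hm : d / A a k b ≤ m := by
        rw [Nat.div_le_iff_le_mul_add_pred hA]
        have := hN.eq
        have := hN.rem_lt
        omega
      rcases hm.lt_or_eq with hlt | heq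
      · refine lt_of_lt_of_le (add_lt_add_right (key _ hD.rem_lt) _) (le_trans ?_ le_self_add)
        rw [← mul_add_one]
        exact mul_le_mul_right (by exact_mod_cast hlt) _
      · rw [heq]
        refine add_lt_add_right (ih n hn ?_) _
        have h1 := hN.eq
        have h2 := hD.eq
        rw [heq] at h2
        omega

/-- Well-founded induction on the ordinal of the current value: the base change keeps it and the
subtraction of `1` lowers it. -/
theorem exists_goodstein_eq_zero (l : ℕ) : ∃ k, goodstein l k = 0 := by
  have key : ∀ (o : Ordinal.{0}) (k : ℕ), toOrdinal (k + 2) (goodstein l k) = o →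
      ∃ j, goodstein l j = 0 := by
    intro o
    induction o using WellFoundedLT.induction with
    | _ o ih =>
      rintro k rfl
      have hk : 2 ≤ k + 2 := Nat.le_add_left _ _
      by_cases h0 : goodstein l k = 0
      · exact ⟨k, h0⟩
      · refine ih _ ?_ (k + 1) rfl
        have h1 : goodstein l (k + 1) = baseChange (k + 2) (goodstein l k) - 1 := by
          rw [goodstein, if_neg h0]
        have h2 := toOrdinal_baseChange hk (goodstein l k)
        have h3 : baseChange (k + 2) (goodstein l k) ≠ 0 := by
          intro h
          rw [h, toOrdinal_zero] at h2
          have := toOrdinal_strictMono hk (Nat.pos_of_ne_zero h0)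
          rw [toOrdinal_zero, ← h2] at this
          exact this.false
        rw [h1, ← h2]
        exact toOrdinal_strictMono (by omega) (by omega)
  exact key _ 0 rfl

end Termination

end Goodstein

theorem mainTheorem3 :
    (∀ l : ℕ, ∃ k : ℕ, Goodstein.goodstein l k = 0) ∧
      Goodstein.Provable (Goodstein.PA ∪ Goodstein.TI) Goodstein.terminationF :=
  ⟨Goodstein.exists_goodstein_eq_zero, Goodstein.provable_terminationF⟩
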